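/- **Setting.** Let $Q=\{x\in\mathbb R^n : \langle x,\nu_i\rangle\le a_i \text{ for all } i\}$ be a full-dimensional smooth (Delzant) lattice polytope, where $i$ runs over the facets of $Q$, $\nu_i\in\mathbb Z^n$ is the outward primitive normal of the facet $i$ and $a_i\in\mathbb Z$. Let $X$ be the smooth projective toric variety over $\mathbb C$ with moment polytope $Q$: it is glued from the affine toric varieties $U_\sigma=\operatorname{Spec}\mathbb C[\{u\in\mathbb Z^n:\langle u,\nu_i\rangle\le 0\text{ for all facets } i\supseteq\sigma\}]$ of the (open) cells $\sigma$ of $Q$. Let $T\subset X$ be the dense torus (the chart of the interior of $Q$), $\chi^u$ ($u\in\mathbb Z^n$) its monomials, and $D_i\subset X$ the toric divisor of the facet $i$. Fix an ordering $\sigma_1,\dots,\sigma_N$ of the cells of $Q$. For a family of open sets $O_1,\dots,O_N$ and a nonempty $s\subseteq\{1,\dots,N\}$ put $O_s=\bigcap_{k\in s}O_k$; Čech complexes are formed from increasing sequences $k_0<\dots<k_i$, with the usual differential and with the cup product $(\phi\cup\psi)_{k_0<\dots<k_m}=\sum_j\phi_{k_0\dots k_j}\cdot\psi_{k_j\dots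 k_m}$. *The DG category $\check{\mathrm C}\mathrm{ech}(X)$.* Its objects are the line bundles on $X$, the morphisms from $L_0$ to $L_1$ are the Čech complex of $\mathcal Hom(L_0,L_1)=L_1\otimes L_0^{-1}$ for the affine cover $U_k=U_{\sigma_k}$, and composition is the cup product. *The DG category $\check{\mathrm C}\mathrm{ech}^{\mathbb Z^n}(Q)$.* A function $H:\partial Q\to\mathbb Z$ that is constant on the facets is given by its values $H_i$ on the facets; a vector $u\in\mathbb Z^n$ defines such a function by $u_i=\langle u,\nu_i\rangle$. Let $\partial^+_HQ$ be the union of the closed facets $i$ with $H_i>0$, and $\mathscr S(H)$ the sheaf on $Q$ of locally constant $\mathbb C$-valued functions that vanish on $\partial^+_HQ$; multiplication of functions gives $\mathscr S(H)\otimes\mathscr S(H')\to\mathscr S(H+H')$. Let $W=(W_\tau)$ be a cover of $Q$ by relatively open subsets indexed by the cells, dual to the barycentric subdivision: $W_\tau$ is contained in the open star of $\tau$ (the union of the open cells that have $\tau$ in their closure); an intersection $W_{\tau_0}\cap\dots\cap W_{\tau_m}$ is nonempty if and only if $\tau_0,\dots,\tau_m$ form a chain with respect to inclusion of closures; it is connected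 if nonempty, and then meets every facet that contains all the cells $\tau_0,\dots,\tau_m$. Objects of $\check{\mathrm C}\mathrm{ech}^{\mathbb Z^n}(Q)$ are the functions $H$ as above, the morphisms from $H_0$ to $H_1$ are $\bigoplus_{u\in\mathbb Z^n}\check C^*(\mathscr S(H_1-H_0+u))$, formed with the cover $W_k=W_{\sigma_k}$, and composition is the cup product, which adds the labels $u$. **Proposition.** Every line bundle $L$ on $X$ has a nowhere vanishing section $e_L$ over $T$, and covers $W$ as above exist. Choose such a section $e_L$ for every line bundle $L$, and any such $W$. For $u\in\mathbb Z^n$ let $H(L,u)_i$ be the negative of the order along $D_i$ of the meromorphic section of $L$ defined by $\chi^u e_L$. These orders are well defined, and $H(L,u)=H(L,0)+u$. 1. Let $L_0,L_1$ be line bundles and $s\ne\emptyset$. The restriction of a morphism $\phi:L_0|_{U_s}\to L_1|_{U_s}$ to $T$ has the form $\phi(e_{L_0})=p\,e_{L_1}$ for a unique Laurent polynomial $p=\sum_u p_u\chi^u$. A Laurent polynomial $p$ arises from a (then unique) $\phi$ if and only if for every $u$ with $p_u\neq0$ one has $H(L_1,u)_i-H(L_0,0)_i\le0$ for all facets $i$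 that contain all the cells $\sigma_k$, $k\in s$. So the Čech complexes split as direct sums over $u\in\mathbb Z^n$. 2. There is a DG functor $F:\check{\mathrm C}\mathrm{ech}(X)\to\check{\mathrm C}\mathrm{ech}^{\mathbb Z^n}(Q)$ with $F(L)=H(L,0)$, which sends a cochain with components $p=\sum_u p_u\chi^u$ on $U_s$ (in the sense of 1) to the cochain whose components on $W_s$ are the constant functions $p_u$ in the summand labelled by $u$. 3. $F$ is an equivalence of DG categories in the sense that it induces an equivalence of the cohomology categories: it is bijective on the cohomology of all morphism complexes, and every object of $\check{\mathrm C}\mathrm{ech}^{\mathbb Z^n}(Q)$ is isomorphic to some $F(L)$ in the category with morphisms the cohomology in degree zero. -/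

import Mathlib

open CategoryTheory CategoryTheory.Limits AlgebraicGeometry TopologicalSpace

universe u v w z

noncomputable section

/-- A differential graded category over `ℂ`; compositions are written in diagrammatic order. -/
structure DGCategory where
  Obj : Type u
  Hom : Obj → Obj → Type v
  [homAddCommGroup : ∀ X Y, AddCommGroup (Hom X Y)]
  [homModule : ∀ X Y, Module ℂ (Hom X Y)]
  deg : ∀ X Y, ℤ → Submodule ℂ (Hom X Y)
  isInternal : ∀ X Y, DirectSum.IsInternal (deg X Y)
  d : ∀ X Y, Hom X Y →ₗ[ℂ] Hom X Y
  d_mem : ∀ {X Y} {p : ℤ} {f : Hom X Y}, f ∈ deg X Y p → d X Y f ∈ deg X Y (p + 1)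
  d_d : ∀ {X Y} (f : Hom X Y), d X Y (d X Y f) = 0
  one : ∀ X, Hom X X
  one_mem : ∀ X, one X ∈ deg X X 0
  comp : ∀ X Y Z, Hom X Y →ₗ[ℂ] Hom Y Z →ₗ[ℂ] Hom X Z
  comp_mem : ∀ {X Y Z} {p q : ℤ} {f : Hom X Y} {g : Hom Y Z}, f ∈ deg X Y p → g ∈ deg Y Z q →
    comp X Y Z f g ∈ deg X Z (p + q)
  one_comp : ∀ {X Y} (f : Hom X Y), comp X X Y (one X) f = f
  comp_one : ∀ {X Y} (f : Hom X Y), comp X Y Y f (one Y) = f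
  assoc : ∀ {W X Y Z} (f : Hom W X) (g : Hom X Y) (h : Hom Y Z),
    comp W Y Z (comp W X Y f g) h = comp W X Z f (comp X Y Z g h)
  leibniz : ∀ {X Y Z} {p : ℤ} {f : Hom X Y} (g : Hom Y Z), f ∈ deg X Y p →
    d X Z (comp X Y Z f g) = comp X Y Z (d X Y f) g + p.negOnePow • comp X Y Z f (d Y Z g)

attribute [instance] DGCategory.homAddCommGroup DGCategory.homModule

/-- Coefficients for Čech complexes with respect to a cover `(O_k)_{k ∈ K}`: a presheaf of `ℂ`-linear
categories on the intersections `O_s = ⋂_{k ∈ s} O_k`, with the same objects over all of them.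
`Hom s X Y` is the space of sections over `O_s` of the sheaf of morphisms from `X` to `Y`. -/
structure CechSystem (K : Type) where
  Obj : Type u
  Hom : Finset K → Obj → Obj → Type v
  [homAddCommGroup : ∀ s X Y, AddCommGroup (Hom s X Y)]
  [homModule : ∀ s X Y, Module ℂ (Hom s X Y)]
  res : ∀ {s t : Finset K}, s ⊆ t → ∀ X Y, Hom s X Y →ₗ[ℂ] Hom t X Y
  one : ∀ s X, Hom s X X
  comp : ∀ s X Y Z, Hom s X Y →ₗ[ℂ] Hom s Y Z →ₗ[ℂ] Hom s X Z
  res_refl : ∀ {s X Y} (f : Hom s X Y), res (Finset.Subset.refl s) X Y f = f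
  res_res : ∀ {r s t : Finset K} (h : r ⊆ s) (h' : s ⊆ t) {X Y} (f : Hom r X Y),
    res h' X Y (res h X Y f) = res (h.trans h') X Y f
  res_one : ∀ {s t : Finset K} (h : s ⊆ t) X, res h X X (one s X) = one t X
  res_comp : ∀ {s t : Finset K} (h : s ⊆ t) {X Y Z} (f : Hom s X Y) (g : Hom s Y Z),
    res h X Z (comp s X Y Z f g) = comp t X Y Z (res h X Y f) (res h Y Z g)
  one_comp : ∀ {s X Y} (f : Hom s X Y), comp s X X Y (one s X) f = f
  comp_one : ∀ {s X Y} (f : Hom s X Y), comp s X Y Y f (one s Y) = f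
  assoc : ∀ {s W X Y Z} (f : Hom s W X) (g : Hom s X Y) (h : Hom s Y Z),
    comp s W Y Z (comp s W X Y f g) h = comp s W X Z f (comp s X Y Z g h)

attribute [instance] CechSystem.homAddCommGroup CechSystem.homModule

namespace CechSystem

variable {K : Type} [LinearOrder K] (S : CechSystem.{u, v} K)

/-- The Čech cochains: a component for every nonempty finite `s ⊆ K`, that is, for every increasing
sequence `k_0 < ⋯ < k_i`. The component at `s = ∅` is normalized to be zero. -/
def cochains (X Y : S.Obj) : Submodule ℂ (∀ s : Finset K, S.Hom s X Y) where
  carrier := {f | f ∅ = 0}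
  add_mem' {f g} hf hg := by
    change f ∅ + g ∅ = 0
    rw [show f ∅ = 0 from hf, show g ∅ = 0 from hg, add_zero]
  zero_mem' := rfl
  smul_mem' c f hf := by
    change c • f ∅ = 0
    rw [show f ∅ = 0 from hf, smul_zero]

variable {S}

/-- The restriction to `O_s` of the component of a cochain on `O_t`, for `t ⊆ s`. -/
def pull (t s : Finset K) (X Y : S.Obj) : (∀ s : Finset K, S.Hom s X Y) →ₗ[ℂ] S.Hom s X Y :=
  if h : t ⊆ s then S.res h X Y ∘ₗ LinearMap.proj t else 0

theorem pull_of_subset {t s : Finset K} (h : t ⊆ s) {X Y : S.Obj} (f : ∀ s : Finset K, S.Hom s X Y) :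
    pull t s X Y f = S.res h X Y (f t) := by
  simp [pull, h]

theorem pull_self {s : Finset K} {X Y : S.Obj} (f : ∀ s : Finset K, S.Hom s X Y) :
    pull s s X Y f = f s := by
  rw [pull_of_subset (Finset.Subset.refl s), S.res_refl]

theorem res_pull {r t s : Finset K} (h : r ⊆ t) (h' : t ⊆ s) {X Y : S.Obj}
    (f : ∀ s : Finset K, S.Hom s X Y) : S.res h' X Y (pull r t X Y f) = pull r s X Y f := by
  rw [pull_of_subset h, pull_of_subset (h.trans h'), S.res_res]

/-- The sign `(-1)^m`, where `m` is the position of `j` in the increasing sequence `s`. -/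
def sign (j : K) (s : Finset K) : ℤ := (-1) ^ (s.filter (· < j)).card

/-- The Čech differential `(d f)_{k_0 < ⋯ < k_i} = ∑_j (-1)^j f_{k_0, …, k̂_j, …, k_i}`. -/
def dFun (X Y : S.Obj) : (∀ s : Finset K, S.Hom s X Y) →ₗ[ℂ] ∀ s : Finset K, S.Hom s X Y :=
  LinearMap.pi fun s ↦ ∑ j ∈ s, sign j s • pull (s.erase j) s X Y

theorem dFun_apply {X Y : S.Obj} (f : ∀ s : Finset K, S.Hom s X Y) (s : Finset K) :
    dFun X Y f s = ∑ j ∈ s, sign j s • pull (s.erase j) s X Y f := by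
  simp [dFun]

/-- The cup product `(f ∪ g)_{k_0 < ⋯ < k_m} = ∑_j f_{k_0, …, k_j} · g_{k_j, …, k_m}`. -/
def compFun (X Y Z : S.Obj) : (∀ s : Finset K, S.Hom s X Y) →ₗ[ℂ] (∀ s : Finset K, S.Hom s Y Z) →ₗ[ℂ]
    ∀ s : Finset K, S.Hom s X Z :=
  LinearMap.mk₂ ℂ (fun f g s ↦ ∑ j ∈ s, S.comp s X Y Z (pull (s.filter (· ≤ j)) s X Y f)
      (pull (s.filter (j ≤ ·)) s Y Z g))
    (fun f f' g ↦ by ext s; simp [Finset.sum_add_distrib])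
    (fun c f g ↦ by ext s; simp [Finset.smul_sum])
    (fun f g g' ↦ by ext s; simp [Finset.sum_add_distrib])
    (fun c f g ↦ by ext s; simp [Finset.smul_sum])

theorem compFun_apply {X Y Z : S.Obj} (f : ∀ s : Finset K, S.Hom s X Y)
    (g : ∀ s : Finset K, S.Hom s Y Z) (s : Finset K) :
    compFun X Y Z f g s = ∑ j ∈ s, S.comp s X Y Z (pull (s.filter (· ≤ j)) s X Y f)
      (pull (s.filter (j ≤ ·)) s Y Z g) := rfl

/-- The unit: the identity on every member `O_k` of the cover, zero on all other `O_s`. -/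
def oneFun (X : S.Obj) : ∀ s : Finset K, S.Hom s X X := fun s ↦ if s.card = 1 then S.one s X else 0

theorem pull_dFun {t s : Finset K} (h : t ⊆ s) {X Y : S.Obj} (f : ∀ s : Finset K, S.Hom s X Y) :
    pull t s X Y (dFun X Y f) = ∑ j ∈ t, sign j t • pull (t.erase j) s X Y f := by
  rw [pull_of_subset h, dFun_apply, map_sum]
  refine Finset.sum_congr rfl fun j _ ↦ ?_
  rw [map_zsmul, res_pull (Finset.erase_subset _ _) h]

theorem pull_compFun {t s : Finset K} (h : t ⊆ s) {X Y Z : S.Obj} (f : ∀ s : Finset K, S.Hom s X Y)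
    (g : ∀ s : Finset K, S.Hom s Y Z) :
    pull t s X Z (compFun X Y Z f g) = ∑ j ∈ t, S.comp s X Y Z (pull (t.filter (· ≤ j)) s X Y f)
      (pull (t.filter (j ≤ ·)) s Y Z g) := by
  rw [pull_of_subset h, compFun_apply, map_sum]
  refine Finset.sum_congr rfl fun j _ ↦ ?_
  rw [S.res_comp, res_pull (Finset.filter_subset _ _) h, res_pull (Finset.filter_subset _ _) h]

theorem sign_erase_of_lt {i j : K} {s : Finset K} (hi : i < j) :
    sign i (s.erase j) = sign i s := by
  have : (s.erase j).filter (· < i) = s.filter (· < i) := by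
    ext k
    simp only [Finset.mem_filter, Finset.mem_erase]
    constructor
    · tauto
    · rintro ⟨h, h'⟩
      exact ⟨⟨(h'.trans hi).ne, h⟩, h'⟩
  rw [sign, sign, this]

theorem sign_erase_of_gt {i j : K} {s : Finset K} (hj : j ∈ s) (hi : j < i) :
    sign i (s.erase j) = - sign i s := by
  have : (s.erase j).filter (· < i) = (s.filter (· < i)).erase j := by
    ext k
    simp only [Finset.mem_filter, Finset.mem_erase]
    tauto
  have hj' : j ∈ s.filter (· < i) := Finset.mem_filter.2 ⟨hj, hi⟩
  have hc := Finset.card_erase_add_one hj'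
  rw [sign, sign, this, ← hc, pow_succ]
  ring

theorem dFun_dFun {X Y : S.Obj} (f : ∀ s : Finset K, S.Hom s X Y) :
    dFun X Y (dFun X Y f) = 0 := by
  funext s
  rw [dFun_apply]
  have : ∀ j ∈ s, sign j s • pull (s.erase j) s X Y (dFun X Y f) =
      ∑ i ∈ s, if i = j then 0 else
        (sign j s * sign i (s.erase j)) • pull ((s.erase j).erase i) s X Y f := by
    intro j hj
    rw [pull_dFun (Finset.erase_subset _ _), Finset.smul_sum, ← Finset.sum_erase s (a := j) (by simp)]
    refine Finset.sum_congr rfl fun i hi ↦ ?_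
    rw [if_neg (Finset.ne_of_mem_erase hi), smul_smul]
  rw [Finset.sum_congr rfl this]
  set T : K → K → S.Hom s X Y := fun j i ↦ if i = j then 0 else
        (sign j s * sign i (s.erase j)) • pull ((s.erase j).erase i) s X Y f with hT
  have hanti : ∀ j ∈ s, ∀ i ∈ s, T j i = - T i j := by
    intro j hj i hi
    simp only [hT]
    rcases lt_trichotomy i j with h | h | h
    · rw [if_neg h.ne, if_neg h.ne', sign_erase_of_lt h, sign_erase_of_gt hi h,
        Finset.erase_right_comm, ← neg_smul]
      congr 1
      ring
    · simp [h]
    · rw [if_neg h.ne', if_neg h.ne, sign_erase_of_lt h, sign_erase_of_gt hj h,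
        Finset.erase_right_comm, ← neg_smul]
      congr 1
      ring
  have h2 : ∑ j ∈ s, ∑ i ∈ s, T j i = - ∑ j ∈ s, ∑ i ∈ s, T j i := by
    conv_rhs => rw [Finset.sum_comm]
    rw [← Finset.sum_neg_distrib]
    refine Finset.sum_congr rfl fun j hj ↦ ?_
    rw [← Finset.sum_neg_distrib]
    exact Finset.sum_congr rfl fun i hi ↦ hanti j hj i hi
  have h3 : (2 : ℂ) • ∑ j ∈ s, ∑ i ∈ s, T j i = 0 := by
    rw [two_smul]
    nth_rewrite 1 [h2]
    simp
  exact (smul_eq_zero.1 h3).resolve_left two_ne_zero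

theorem compFun_assoc {W X Y Z : S.Obj} (f : ∀ s : Finset K, S.Hom s W X)
    (g : ∀ s : Finset K, S.Hom s X Y) (h : ∀ s : Finset K, S.Hom s Y Z) :
    compFun W Y Z (compFun W X Y f g) h = compFun W X Z f (compFun X Y Z g h) := by
  funext s
  rw [compFun_apply, compFun_apply]
  have h1 : ∀ k ∈ s, S.comp s W Y Z (pull (s.filter (· ≤ k)) s W Y (compFun W X Y f g))
      (pull (s.filter (k ≤ ·)) s Y Z h) = ∑ j ∈ s, if j ≤ k then
        S.comp s W Y Z (S.comp s W X Y (pull (s.filter (· ≤ j)) s W X f)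
          (pull (s.filter (fun i ↦ j ≤ i ∧ i ≤ k)) s X Y g)) (pull (s.filter (k ≤ ·)) s Y Z h)
        else 0 := by
    intro k _
    rw [pull_compFun (Finset.filter_subset _ _), map_sum, LinearMap.sum_apply, ← Finset.sum_filter]
    refine Finset.sum_congr rfl fun j hj ↦ ?_
    have hjk := (Finset.mem_filter.1 hj).2
    have e1 : (s.filter (· ≤ k)).filter (· ≤ j) = s.filter (· ≤ j) := by
      ext i
      simp only [Finset.mem_filter]
      exact ⟨fun h ↦ ⟨h.1.1, h.2⟩, fun h ↦ ⟨⟨h.1, h.2.trans hjk⟩, h.2⟩⟩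
    have e2 : (s.filter (· ≤ k)).filter (j ≤ ·) = s.filter (fun i ↦ j ≤ i ∧ i ≤ k) := by
      ext i
      simp only [Finset.mem_filter]
      tauto
    rw [e1, e2]
  have h2 : ∀ j ∈ s, S.comp s W X Z (pull (s.filter (· ≤ j)) s W X f)
      (pull (s.filter (j ≤ ·)) s X Z (compFun X Y Z g h)) = ∑ k ∈ s, if j ≤ k then
        S.comp s W Y Z (S.comp s W X Y (pull (s.filter (· ≤ j)) s W X f)
          (pull (s.filter (fun i ↦ j ≤ i ∧ i ≤ k)) s X Y g)) (pull (s.filter (k ≤ ·)) s Y Z h)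
        else 0 := by
    intro j _
    rw [pull_compFun (Finset.filter_subset _ _), map_sum, ← Finset.sum_filter]
    refine Finset.sum_congr rfl fun k hk ↦ ?_
    have hjk := (Finset.mem_filter.1 hk).2
    have e1 : (s.filter (j ≤ ·)).filter (k ≤ ·) = s.filter (k ≤ ·) := by
      ext i
      simp only [Finset.mem_filter]
      exact ⟨fun h ↦ ⟨h.1.1, h.2⟩, fun h ↦ ⟨⟨h.1, hjk.trans h.2⟩, h.2⟩⟩
    have e2 : (s.filter (j ≤ ·)).filter (· ≤ k) = s.filter (fun i ↦ j ≤ i ∧ i ≤ k) := by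
      ext i
      simp only [Finset.mem_filter]
      tauto
    rw [e1, e2, S.assoc]
  rw [Finset.sum_congr rfl h1, Finset.sum_congr rfl h2, Finset.sum_comm]

theorem pull_oneFun {t s : Finset K} (h : t ⊆ s) (X : S.Obj) :
    pull t s X X (oneFun X) = if t.card = 1 then S.one s X else 0 := by
  rw [pull_of_subset h, oneFun]
  split_ifs
  · exact S.res_one h X
  · exact map_zero _

theorem oneFun_compFun {X Y : S.Obj} (f : ∀ s : Finset K, S.Hom s X Y) (hf : f ∅ = 0) :
    compFun X X Y (oneFun X) f = f := by
  funext s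
  rw [compFun_apply]
  rcases s.eq_empty_or_nonempty with rfl | hs
  · simp [hf]
  rw [Finset.sum_eq_single_of_mem (s.min' hs) (s.min'_mem hs)]
  · have e1 : s.filter (· ≤ s.min' hs) = {s.min' hs} := by
      ext i
      simp only [Finset.mem_filter, Finset.mem_singleton]
      constructor
      · exact fun h ↦ le_antisymm h.2 (s.min'_le i h.1)
      · rintro rfl
        exact ⟨s.min'_mem hs, le_rfl⟩
    have e2 : s.filter (s.min' hs ≤ ·) = s := Finset.filter_true_of_mem fun i hi ↦ s.min'_le i hi
    rw [pull_oneFun (Finset.filter_subset _ _), e1, e2, if_pos (Finset.card_singleton _),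
      S.one_comp, pull_self]
  · intro j hj hne
    rw [pull_oneFun (Finset.filter_subset _ _), if_neg, map_zero, LinearMap.zero_apply]
    intro hc
    obtain ⟨a, ha⟩ := Finset.card_eq_one.1 hc
    have h1 : j ∈ s.filter (· ≤ j) := Finset.mem_filter.2 ⟨hj, le_rfl⟩
    have h2 : s.min' hs ∈ s.filter (· ≤ j) := Finset.mem_filter.2 ⟨s.min'_mem hs, s.min'_le j hj⟩
    rw [ha, Finset.mem_singleton] at h1 h2
    exact hne (h1.trans h2.symm)

theorem compFun_oneFun {X Y : S.Obj} (f : ∀ s : Finset K, S.Hom s X Y) (hf : f ∅ = 0) :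
    compFun X Y Y f (oneFun Y) = f := by
  funext s
  rw [compFun_apply]
  rcases s.eq_empty_or_nonempty with rfl | hs
  · simp [hf]
  rw [Finset.sum_eq_single_of_mem (s.max' hs) (s.max'_mem hs)]
  · have e1 : s.filter (s.max' hs ≤ ·) = {s.max' hs} := by
      ext i
      simp only [Finset.mem_filter, Finset.mem_singleton]
      constructor
      · exact fun h ↦ le_antisymm (s.le_max' i h.1) h.2
      · rintro rfl
        exact ⟨s.max'_mem hs, le_rfl⟩
    have e2 : s.filter (· ≤ s.max' hs) = s := Finset.filter_true_of_mem fun i hi ↦ s.le_max' i hi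
    rw [pull_oneFun (Finset.filter_subset _ _), e1, e2, if_pos (Finset.card_singleton _),
      S.comp_one, pull_self]
  · intro j hj hne
    rw [pull_oneFun (Finset.filter_subset _ _), if_neg, map_zero]
    intro hc
    obtain ⟨a, ha⟩ := Finset.card_eq_one.1 hc
    have h1 : j ∈ s.filter (j ≤ ·) := Finset.mem_filter.2 ⟨hj, le_rfl⟩
    have h2 : s.max' hs ∈ s.filter (j ≤ ·) := Finset.mem_filter.2 ⟨s.max'_mem hs, s.le_max' j hj⟩
    rw [ha, Finset.mem_singleton] at h1 h2
    exact hne (h1.trans h2.symm)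

theorem sum_lower {M : Type*} [AddCommGroup M] (a : Finset K → M) (s : Finset K) (h0 : a ∅ = 0)
    (hs : a s = 0) : ∑ k ∈ s, a (s.filter (· < k)) = ∑ k ∈ s, a (s.filter (· ≤ k)) := by
  suffices H : ∀ s : Finset K, a ∅ + ∑ k ∈ s, a (s.filter (· ≤ k)) =
      a s + ∑ k ∈ s, a (s.filter (· < k)) by
    have := H s
    rw [h0, hs, zero_add, zero_add] at this
    exact this.symm
  clear hs h0 s
  intro s
  induction s using Finset.induction_on_max with
  | empty => simp
  | insert m s hm ih =>
    have hms : m ∉ s := fun h ↦ lt_irrefl _ (hm m h)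
    rw [Finset.sum_insert hms, Finset.sum_insert hms]
    have e1 : (insert m s).filter (· ≤ m) = insert m s := by
      refine Finset.filter_true_of_mem fun i hi ↦ ?_
      rcases Finset.mem_insert.1 hi with rfl | hi
      · exact le_rfl
      · exact (hm i hi).le
    have e2 : (insert m s).filter (· < m) = s := by
      rw [Finset.filter_insert, if_neg (lt_irrefl _), Finset.filter_true_of_mem hm]
    have e3 : ∀ k ∈ s, a ((insert m s).filter (· ≤ k)) = a (s.filter (· ≤ k)) := fun k hk ↦ by
      rw [Finset.filter_insert, if_neg (hm k hk).not_ge]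
    have e4 : ∀ k ∈ s, a ((insert m s).filter (· < k)) = a (s.filter (· < k)) := fun k hk ↦ by
      rw [Finset.filter_insert, if_neg (hm k hk).not_gt]
    rw [e1, e2, Finset.sum_congr rfl e3, Finset.sum_congr rfl e4, add_left_comm, ih]

theorem leibnizFun {X Y Z : S.Obj} (p : ℤ) (f : ∀ s : Finset K, S.Hom s X Y)
    (g : ∀ s : Finset K, S.Hom s Y Z) (hf0 : f ∅ = 0) (hg0 : g ∅ = 0)
    (hf : ∀ s : Finset K, (s.card : ℤ) ≠ p + 1 → f s = 0) :
    dFun X Z (compFun X Y Z f g) =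
      compFun X Y Z (dFun X Y f) g + p.negOnePow • compFun X Y Z f (dFun Y Z g) := by
  funext s
  have hzero : ∀ t ⊆ s, (t.card : ℤ) ≠ p + 1 → pull t s X Y f = 0 := fun t ht h ↦ by
    rw [pull_of_subset ht, hf t h, map_zero]
  -- `B t r` is the product of the components of `f` on `t` and of `g` on `r`
  set B : Finset K → Finset K → S.Hom s X Z := fun t r ↦
    S.comp s X Y Z (pull t s X Y f) (pull r s Y Z g) with hB
  have hL : dFun X Z (compFun X Y Z f g) s =
      ∑ j ∈ s, ∑ k ∈ s, if k = j then 0 else sign j s •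
        B ((s.erase j).filter (· ≤ k)) ((s.erase j).filter (k ≤ ·)) := by
    rw [dFun_apply]
    refine Finset.sum_congr rfl fun j hj ↦ ?_
    rw [pull_compFun (Finset.erase_subset _ _), Finset.smul_sum,
      ← Finset.sum_erase s (a := j) (by simp)]
    exact Finset.sum_congr rfl fun k hk ↦ by rw [if_neg (Finset.ne_of_mem_erase hk)]
  have hR1 : compFun X Y Z (dFun X Y f) g s =
      ∑ k ∈ s, ∑ j ∈ s, if j ≤ k then sign j s • B ((s.filter (· ≤ k)).erase j) (s.filter (k ≤ ·))
        else 0 := by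
    rw [compFun_apply]
    refine Finset.sum_congr rfl fun k hk ↦ ?_
    rw [pull_dFun (Finset.filter_subset _ _), map_sum, LinearMap.sum_apply, ← Finset.sum_filter]
    refine Finset.sum_congr rfl fun j hj ↦ ?_
    have hjk := (Finset.mem_filter.1 hj).2
    have e : sign j (s.filter (· ≤ k)) = sign j s := by
      rw [sign, sign, Finset.filter_filter]
      congr 2
      ext i
      simp only [Finset.mem_filter]
      exact ⟨fun h ↦ ⟨h.1, h.2.2⟩, fun h ↦ ⟨h.1, (h.2.trans_le hjk).le, h.2⟩⟩
    rw [e, map_zsmul, LinearMap.smul_apply]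
  have hR2 : compFun X Y Z f (dFun Y Z g) s =
      ∑ k ∈ s, ∑ j ∈ s, if k ≤ j then sign j (s.filter (k ≤ ·)) •
        B (s.filter (· ≤ k)) ((s.filter (k ≤ ·)).erase j) else 0 := by
    rw [compFun_apply]
    refine Finset.sum_congr rfl fun k hk ↦ ?_
    rw [pull_dFun (Finset.filter_subset _ _), map_sum, ← Finset.sum_filter]
    exact Finset.sum_congr rfl fun j hj ↦ by rw [map_zsmul]
  -- in nonzero terms the first factor lives on a set with `p + 1` elements
  have hpar : ∀ (t r : Finset K) (c : ℕ), t ⊆ s → (t.card = c + 1) →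
      ((-1 : ℤ) ^ c) • B t r = (p.negOnePow : ℤ) • B t r := by
    intro t r c ht hc
    by_cases h : (t.card : ℤ) = p + 1
    · have : p = (c : ℤ) := by omega
      rw [this, Int.negOnePow_def]
      simp
    · simp [hB, hzero t ht h]
  have hsplit : ∀ k ∈ s, s.filter (· ≤ k) = insert k (s.filter (· < k)) := by
    intro k hk
    ext i
    simp only [Finset.mem_filter, Finset.mem_insert]
    constructor
    · rintro ⟨h, h'⟩
      rcases h'.lt_or_eq with h' | h'
      · exact Or.inr ⟨h, h'⟩
      · exact Or.inl h'
    · rintro (rfl | ⟨h, h'⟩)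
      · exact ⟨hk, le_rfl⟩
      · exact ⟨h, h'.le⟩
  have hcard : ∀ k ∈ s, (s.filter (· ≤ k)).card = (s.filter (· < k)).card + 1 := by
    intro k hk
    rw [hsplit k hk, Finset.card_insert_of_notMem (by simp)]
  have hbdry : ∑ k ∈ s, sign k s • B ((s.filter (· ≤ k)).erase k) (s.filter (k ≤ ·)) +
      (p.negOnePow : ℤ) • ∑ k ∈ s, B (s.filter (· ≤ k)) ((s.filter (k ≤ ·)).erase k) = 0 := by
    let a : Finset K → S.Hom s X Z := fun t ↦ ((-1 : ℤ) ^ t.card) • B t (s \ t)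
    have ha0 : a ∅ = 0 := by
      simp [a, hB, pull_of_subset (Finset.empty_subset s), hf0]
    have has : a s = 0 := by
      simp [a, hB, pull_of_subset (Finset.empty_subset s), hg0]
    have h1 : ∑ k ∈ s, sign k s • B ((s.filter (· ≤ k)).erase k) (s.filter (k ≤ ·)) =
        ∑ k ∈ s, a (s.filter (· < k)) := by
      refine Finset.sum_congr rfl fun k hk ↦ ?_
      have e1 : (s.filter (· ≤ k)).erase k = s.filter (· < k) := by
        rw [hsplit k hk, Finset.erase_insert (by simp)]
      have e2 : s \ s.filter (· < k) = s.filter (k ≤ ·) := by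
        ext i
        simp only [Finset.mem_sdiff, Finset.mem_filter, not_and, not_lt]
        tauto
      simp only [a]
      rw [e1, e2, sign]
    rw [h1, sum_lower a s ha0 has, Finset.smul_sum, ← Finset.sum_add_distrib]
    refine Finset.sum_eq_zero fun k hk ↦ ?_
    have e : s \ s.filter (· ≤ k) = (s.filter (k ≤ ·)).erase k := by
      ext i
      simp only [Finset.mem_sdiff, Finset.mem_filter, not_and, not_le, Finset.mem_erase]
      constructor
      · rintro ⟨h, h'⟩
        exact ⟨(h' h).ne', h, (h' h).le⟩
      · rintro ⟨h, h', h''⟩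
        exact ⟨h', fun _ ↦ lt_of_le_of_ne h'' (Ne.symm h)⟩
    simp only [a]
    rw [e, ← hpar _ _ _ (Finset.filter_subset _ _) (hcard k hk), hcard k hk, pow_succ, mul_neg_one,
      neg_smul, neg_add_cancel]
  have hR1' : compFun X Y Z (dFun X Y f) g s =
      ∑ k ∈ s, ∑ j ∈ s, (if j < k then sign j s •
        B ((s.filter (· ≤ k)).erase j) (s.filter (k ≤ ·)) else 0) +
      ∑ k ∈ s, sign k s • B ((s.filter (· ≤ k)).erase k) (s.filter (k ≤ ·)) := by
    rw [hR1, ← Finset.sum_add_distrib]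
    refine Finset.sum_congr rfl fun k hk ↦ ?_
    rw [← Finset.add_sum_erase s _ hk, ← Finset.add_sum_erase s _ hk, if_pos le_rfl,
      if_neg (lt_irrefl _), zero_add, add_comm]
    congr 1
    refine Finset.sum_congr rfl fun j hj ↦ ?_
    simp only [lt_iff_le_and_ne, Finset.ne_of_mem_erase hj, ne_eq, not_false_eq_true, and_true]
  have hR2' : (p.negOnePow : ℤ) • compFun X Y Z f (dFun Y Z g) s =
      ∑ k ∈ s, ∑ j ∈ s, (if k < j then sign j s •
        B (s.filter (· ≤ k)) ((s.filter (k ≤ ·)).erase j) else 0) +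
      (p.negOnePow : ℤ) • ∑ k ∈ s, B (s.filter (· ≤ k)) ((s.filter (k ≤ ·)).erase k) := by
    rw [hR2, Finset.smul_sum, Finset.smul_sum, ← Finset.sum_add_distrib]
    refine Finset.sum_congr rfl fun k hk ↦ ?_
    rw [← Finset.add_sum_erase s _ hk, ← Finset.add_sum_erase s _ hk, if_pos le_rfl,
      if_neg (lt_irrefl _), zero_add, add_comm, smul_add]
    congr 1
    · rw [Finset.smul_sum]
      refine Finset.sum_congr rfl fun j hj ↦ ?_
      simp only [lt_iff_le_and_ne, (Finset.ne_of_mem_erase hj).symm, ne_eq, not_false_eq_true,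
        and_true]
      split_ifs with hkj
      · have e : sign j s = sign j (s.filter (k ≤ ·)) * (-1) ^ (s.filter (· < k)).card := by
          rw [sign, sign, ← pow_add, ← Finset.card_union_of_disjoint]
          · congr 2
            ext i
            simp only [Finset.mem_filter, Finset.mem_union]
            have hkj' : k < j := lt_of_le_of_ne hkj (Finset.ne_of_mem_erase hj).symm
            rcases lt_or_ge i k with h | h
            · simp [h, h.trans hkj', h.not_ge]
            · simp [h, h.not_gt]
          · rw [Finset.disjoint_left]
            intro i hi hi'
            simp only [Finset.mem_filter] at hi hi'
            exact absurd hi'.2 hi.1.2.not_gt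
        rw [e, mul_smul, hpar _ _ _ (Finset.filter_subset _ _) (hcard k hk), smul_comm]
      · exact smul_zero _
    · have e : sign k (s.filter (k ≤ ·)) = 1 := by
        rw [sign, Finset.filter_filter, Finset.filter_false_of_mem, Finset.card_empty, pow_zero]
        exact fun i _ h ↦ absurd h.2 h.1.not_gt
      rw [e, one_smul]
  have hL' : dFun X Z (compFun X Y Z f g) s =
      ∑ k ∈ s, ∑ j ∈ s, (if j < k then sign j s •
        B ((s.filter (· ≤ k)).erase j) (s.filter (k ≤ ·)) else 0) +
      ∑ k ∈ s, ∑ j ∈ s, (if k < j then sign j s •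
        B (s.filter (· ≤ k)) ((s.filter (k ≤ ·)).erase j) else 0) := by
    rw [hL, Finset.sum_comm, ← Finset.sum_add_distrib]
    refine Finset.sum_congr rfl fun k hk ↦ ?_
    rw [← Finset.sum_add_distrib]
    refine Finset.sum_congr rfl fun j hj ↦ ?_
    rw [Finset.filter_erase, Finset.filter_erase]
    rcases lt_trichotomy j k with h | h | h
    · rw [if_neg h.ne', if_pos h, if_neg h.not_gt, add_zero,
        Finset.erase_eq_of_notMem (a := j) (s := s.filter (k ≤ ·)) (by simp [h])]
    · simp [h]
    · rw [if_neg h.ne, if_neg h.not_gt, if_pos h, zero_add,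
        Finset.erase_eq_of_notMem (a := j) (s := s.filter (· ≤ k)) (by simp [h])]
  change _ = compFun X Y Z (dFun X Y f) g s + p.negOnePow • compFun X Y Z f (dFun Y Z g) s
  rw [Units.smul_def, hL', hR1', hR2', add_add_add_comm, hbdry, add_zero]

variable (S)

/-- The cochains of degree `p`: those supported on the sequences `k_0 < ⋯ < k_p`. -/
def degree (X Y : S.Obj) (p : ℤ) : Submodule ℂ (S.cochains X Y) where
  carrier := {f | ∀ s : Finset K, (s.card : ℤ) ≠ p + 1 → f.1 s = 0}
  add_mem' {f g} hf hg s hs := by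
    change f.1 s + g.1 s = 0
    rw [hf s hs, hg s hs, add_zero]
  zero_mem' _ _ := rfl
  smul_mem' c f hf s hs := by
    change c • f.1 s = 0
    rw [hf s hs, smul_zero]

/-- The projection to the component of degree `p`. -/
def projDegree (X Y : S.Obj) (p : ℤ) : S.cochains X Y →ₗ[ℂ] S.cochains X Y where
  toFun f := ⟨fun s ↦ if (s.card : ℤ) = p + 1 then f.1 s else 0, by
    have := f.2
    change f.1 ∅ = 0 at this
    change (if _ then _ else _) = _
    rw [this, ite_self]⟩
  map_add' f g := by
    ext s
    change (if _ then f.1 s + g.1 s else 0) = (if _ then _ else _) + (if _ then _ else _)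
    split_ifs <;> simp
  map_smul' c f := by
    ext s
    change (if _ then c • f.1 s else 0) = c • (if _ then _ else _)
    split_ifs <;> simp

theorem isInternal_degree [Fintype K] (X Y : S.Obj) : DirectSum.IsInternal (S.degree X Y) := by
  classical
  have hsame : ∀ p, ∀ f ∈ S.degree X Y p, S.projDegree X Y p f = f := by
    intro p f hf
    ext s
    change (if _ then _ else _) = _
    split_ifs with h
    · rfl
    · exact (hf s h).symm
  have hother : ∀ p q, p ≠ q → ∀ f ∈ S.degree X Y q, S.projDegree X Y p f = 0 := by
    intro p q hpq f hf
    ext s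
    change (if _ then _ else _) = _
    split_ifs with h
    · exact hf s (by omega)
    · rfl
  have key : ∀ (p : ℤ) (x : DirectSum ℤ fun q ↦ S.degree X Y q),
      S.projDegree X Y p (DirectSum.coeAddMonoidHom (S.degree X Y) x) = x p := by
    intro p x
    induction x using DirectSum.induction_on with
    | zero => simp
    | of q f =>
      rw [DirectSum.coeAddMonoidHom_of, DirectSum.coe_of_apply]
      split_ifs with h
      · subst h
        exact hsame _ _ f.2
      · exact hother p q (Ne.symm h) _ f.2
    | add x y hx hy => simp [hx, hy]
  constructor
  · intro x y hxy
    refine DFinsupp.ext fun p ↦ Subtype.ext ?_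
    have := congrArg (S.projDegree X Y p) hxy
    rwa [key, key] at this
  · intro f
    have hmem : ∀ p, S.projDegree X Y p f ∈ S.degree X Y p := fun p s hs ↦ if_neg hs
    refine ⟨∑ m ∈ Finset.range (Fintype.card K), DirectSum.of (fun q ↦ S.degree X Y q) (m : ℤ)
      ⟨_, hmem m⟩, ?_⟩
    rw [map_sum]
    simp only [DirectSum.coeAddMonoidHom_of]
    ext s
    rw [Submodule.coe_sum, Finset.sum_apply]
    change ∑ m ∈ Finset.range (Fintype.card K), (if (s.card : ℤ) = (m : ℤ) + 1 then f.1 s else 0) = _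
    rcases s.eq_empty_or_nonempty with rfl | hs
    · have := f.2
      change f.1 ∅ = 0 at this
      simp [this]
    · have hc := hs.card_pos
      have hc' := s.card_le_univ
      rw [Finset.sum_eq_single_of_mem (s.card - 1) (Finset.mem_range.2 (by omega))]
      · rw [if_pos (by omega)]
      · intro m _ hm
        rw [if_neg (by omega)]

/-- The Čech DG category: morphisms are Čech cochains, composition is the cup product. -/
def cech [Fintype K] : DGCategory.{u, v} where
  Obj := S.Obj
  Hom X Y := S.cochains X Y
  deg := S.degree
  isInternal := S.isInternal_degree
  d X Y := (dFun X Y).restrict fun f _ ↦ by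
    change dFun X Y f ∅ = 0
    rw [dFun_apply, Finset.sum_empty]
  d_mem {X Y p f} hf s hs := by
    change dFun X Y f.1 s = 0
    rw [dFun_apply]
    refine Finset.sum_eq_zero fun j hj ↦ ?_
    rw [pull_of_subset (Finset.erase_subset _ _), hf, map_zero, smul_zero]
    have := Finset.card_erase_add_one hj
    omega
  d_d f := Subtype.ext (dFun_dFun f.1)
  one X := ⟨oneFun X, by change (if _ then _ else _) = _; simp⟩
  one_mem X s hs := by
    change (if _ then _ else _) = _
    rw [if_neg (by omega)]
  comp X Y Z := LinearMap.mk₂ ℂ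
    (fun f g ↦ ⟨compFun X Y Z f.1 g.1, by change compFun X Y Z f.1 g.1 ∅ = 0; simp [compFun_apply]⟩)
    (fun f f' g ↦ Subtype.ext (by simp))
    (fun c f g ↦ Subtype.ext (by simp))
    (fun f g g' ↦ Subtype.ext (by simp))
    (fun c f g ↦ Subtype.ext (by simp))
  comp_mem {X Y Z p q f g} hf hg s hs := by
    change compFun X Y Z f.1 g.1 s = 0
    rw [compFun_apply]
    refine Finset.sum_eq_zero fun j hj ↦ ?_
    by_cases h : ((s.filter (· ≤ j)).card : ℤ) = p + 1
    · rw [pull_of_subset (Finset.filter_subset (j ≤ ·) s), hg, map_zero, map_zero]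
      have h1 := Finset.card_union_add_card_inter (s.filter (· ≤ j)) (s.filter (j ≤ ·))
      have e1 : s.filter (· ≤ j) ∪ s.filter (j ≤ ·) = s := by
        ext i
        simp only [Finset.mem_union, Finset.mem_filter]
        have := le_total i j
        tauto
      have e2 : s.filter (· ≤ j) ∩ s.filter (j ≤ ·) = {j} := by
        ext i
        simp only [Finset.mem_inter, Finset.mem_filter, Finset.mem_singleton]
        constructor
        · exact fun h ↦ le_antisymm h.1.2 h.2.2
        · rintro rfl
          exact ⟨⟨hj, le_rfl⟩, hj, le_rfl⟩
      rw [e1, e2, Finset.card_singleton] at h1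
      omega
    · rw [pull_of_subset (Finset.filter_subset (· ≤ j) s), hf _ h, map_zero, map_zero,
        LinearMap.zero_apply]
  one_comp f := Subtype.ext (oneFun_compFun f.1 f.2)
  comp_one f := Subtype.ext (compFun_oneFun f.1 f.2)
  assoc f g h := Subtype.ext (compFun_assoc f.1 g.1 h.1)
  leibniz {X Y Z p f} g hf := Subtype.ext (leibnizFun p f.1 g.1 f.2 g.2 hf)

end CechSystem
/-- Finitely many inequalities `⟪x, ν_i⟫ ≤ a_i` on `ℝⁿ` with integral `ν_i` and `a_i`. -/
structure PolytopeData (n : ℕ) where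
  Facet : Type
  fintypeFacet : Fintype Facet
  normal : Facet → Fin n → ℤ
  offset : Facet → ℤ

namespace PolytopeData

variable {n : ℕ} (P : PolytopeData n)

instance instFintypeFacet : Fintype P.Facet := P.fintypeFacet

/-- The linear functional `⟪x, ν_i⟫` on `ℝⁿ`. -/
def height (i : P.Facet) (x : Fin n → ℝ) : ℝ := ∑ k, x k * (P.normal i k : ℝ)

/-- The polytope `Q`. -/
def body : Set (Fin n → ℝ) := {x | ∀ i, P.height i x ≤ P.offset i}

/-- The closed facet of `Q` with label `i`. -/
def facet (i : P.Facet) : Set (Fin n → ℝ) := {x ∈ P.body | P.height i x = P.offset i}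

open Classical in
/-- The set of the `i` for which the `i`-th inequality is an equality at `x`. -/
def active (x : Fin n → ℝ) : Finset P.Facet := Finset.univ.filter fun i ↦ P.height i x = P.offset i

end PolytopeData

/-- A full-dimensional smooth (Delzant) lattice polytope `Q ⊆ ℝⁿ`, given by its facets, with outward
normals `ν_i`: every label `i` is that of a facet, and the normals of the facets through any point
of `Q` are part of a basis of `ℤⁿ`. These are the moment polytopes of the smooth projective toric
varieties; the cones of the fan are spanned by the inward normals of the facets through a point. -/
structure SmoothPolytope (n : ℕ) extends PolytopeData n where
  bounded : Bornology.IsBounded toPolytopeData.body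
  exists_interior : ∃ x ∈ toPolytopeData.body, toPolytopeData.active x = ∅
  exists_facet : ∀ i, ∃ x ∈ toPolytopeData.body, toPolytopeData.active x = {i}
  smooth : ∀ x ∈ toPolytopeData.body, ∃ (b : Module.Basis (Fin n) ℤ (Fin n → ℤ))
    (e : toPolytopeData.active x ↪ Fin n), ∀ i : toPolytopeData.active x, toPolytopeData.normal i = b (e i)

namespace SmoothPolytope

variable {n : ℕ} (P : SmoothPolytope n)

/-- The cells of `Q`. Two points lie in the same open cell iff they lie on the same facets, and a cell
is represented by this set of facets. So `σ ≤ τ` means that `τ` is contained in the closure of `σ`,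
equivalently that the cone of `σ` in the fan is a face of the cone of `τ`. -/
def Face : Type := {I : Finset P.Facet // ∃ x ∈ P.body, P.active x = I}

instance instPartialOrderFace : PartialOrder P.Face := inferInstanceAs (PartialOrder (Subtype _))

/-- The pairing `⟪u, ν_i⟫` of a lattice vector with an outward normal. -/
def pair (u : Fin n → ℤ) (i : P.Facet) : ℤ := ∑ k, u k * P.normal i k

theorem pair_add (u v : Fin n → ℤ) (i : P.Facet) : P.pair (u + v) i = P.pair u i + P.pair v i := by
  simp [pair, add_mul, Finset.sum_add_distrib]

theorem pair_zero (i : P.Facet) : P.pair 0 i = 0 := by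
  simp [pair]

theorem pair_nsmul (k : ℕ) (u : Fin n → ℤ) (i : P.Facet) :
    P.pair (k • u) i = k * P.pair u i := by
  simp [pair, Finset.mul_sum, mul_assoc]

/-- The lattice points of the dual of the cone of `σ`. -/
def dualMonoid (σ : P.Face) : AddSubmonoid (Fin n → ℤ) where
  carrier := {u | ∀ i ∈ σ.1, P.pair u i ≤ 0}
  add_mem' {u v} hu hv i hi := by
    rw [pair_add]; exact add_nonpos (hu i hi) (hv i hi)
  zero_mem' i _ := (P.pair_zero i).le

theorem dualMonoid_anti {σ τ : P.Face} (h : σ ≤ τ) : P.dualMonoid τ ≤ P.dualMonoid σ :=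
  fun _ hu i hi ↦ hu i (h hi)

/-- The coordinate ring `ℂ[S_σ]` of the affine toric variety of `σ`. -/
abbrev chartRing (σ : P.Face) : Type := AddMonoidAlgebra ℂ (P.dualMonoid σ)

/-- The inclusion `ℂ[S_τ] → ℂ[S_σ]`, for a face `σ` of the cone `τ`. -/
def chartMap {σ τ : P.Face} (h : σ ≤ τ) : P.chartRing τ →ₐ[ℂ] P.chartRing σ :=
  AddMonoidAlgebra.mapDomainAlgHom ℂ ℂ (AddSubmonoid.inclusion (P.dualMonoid_anti h))

/-- The diagram of the affine toric varieties `Spec ℂ[S_σ]`. -/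
def chartFunctor : P.Face ⥤ Scheme.{0} where
  obj σ := Spec (CommRingCat.of (P.chartRing σ))
  map f := Spec.map (CommRingCat.ofHom (P.chartMap f.le).toRingHom)
  map_id σ := by
    rw [← Spec.map_id]
    congr 1
    refine CommRingCat.hom_ext (RingHom.ext fun x ↦ ?_)
    exact DFunLike.congr_fun (AddMonoidAlgebra.mapDomainAlgHom_id (R := ℂ) (A := ℂ)) x
  map_comp f g := by
    rw [← Spec.map_comp]
    congr 1
    refine CommRingCat.hom_ext (RingHom.ext fun x ↦ ?_)
    exact DFunLike.congr_fun (AddMonoidAlgebra.mapDomainAlgHom_comp (R := ℂ) (A := ℂ)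
      (AddSubmonoid.inclusion (P.dualMonoid_anti g.le))
      (AddSubmonoid.inclusion (P.dualMonoid_anti f.le))) x

theorem exists_weight {σ τ : P.Face} (h : σ ≤ τ) : ∃ w : Fin n → ℤ,
    (∀ i ∈ σ.1, P.pair w i = 0) ∧ ∀ i ∈ τ.1, i ∉ σ.1 → P.pair w i < 0 := by
  classical
  obtain ⟨x, hx, hxτ⟩ := τ.2
  obtain ⟨b, e, hb⟩ := P.smooth x hx
  let c : Fin n → ℤ := fun k ↦ if ∃ i : P.active x, e i = k ∧ i.1 ∉ σ.1 then -1 else 0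
  let φ : (Fin n → ℤ) →ₗ[ℤ] ℤ := b.constr ℤ c
  have hφ : ∀ v, φ v = ∑ k, φ (Pi.single k 1) * v k := fun v ↦ by
    rw [LinearMap.pi_apply_eq_sum_univ φ v]
    refine Finset.sum_congr rfl fun k _ ↦ ?_
    rw [smul_eq_mul, mul_comm]
    congr 2
    ext j
    simp [Pi.single_apply, eq_comm]
  have key : ∀ i (hi : i ∈ P.active x), P.pair (fun k ↦ φ (Pi.single k 1)) i = c (e ⟨i, hi⟩) := by
    intro i hi
    have := hφ (P.normal i)
    rw [pair, ← this, hb ⟨i, hi⟩]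
    exact b.constr_basis ℤ c _
  refine ⟨fun k ↦ φ (Pi.single k 1), fun i hi ↦ ?_, fun i hi hiσ ↦ ?_⟩
  · have hi' : i ∈ P.active x := hxτ ▸ h hi
    rw [key i hi']
    refine if_neg ?_
    rintro ⟨j, hj, hjσ⟩
    rw [e.injective hj] at hjσ
    exact hjσ hi
  · have hi' : i ∈ P.active x := hxτ ▸ hi
    rw [key i hi', show c (e ⟨i, hi'⟩) = -1 from if_pos ⟨_, rfl, hiσ⟩]
    norm_num

theorem isLocalization {σ τ : P.Face} (h : σ ≤ τ) (w : P.dualMonoid τ)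
    (hw : ∀ i ∈ σ.1, P.pair w i = 0) (hw' : ∀ i ∈ τ.1, i ∉ σ.1 → P.pair w i < 0) :
    letI := (P.chartMap h).toRingHom.toAlgebra
    IsLocalization.Away (AddMonoidAlgebra.single w (1 : ℂ)) (P.chartRing σ) := by
  let _ := (P.chartMap h).toRingHom.toAlgebra
  have hmap : ∀ a, algebraMap (P.chartRing τ) (P.chartRing σ) a = P.chartMap h a := fun _ ↦ rfl
  have hinj : Function.Injective (P.chartMap h) :=
    AddMonoidAlgebra.mapDomain_injective (AddSubmonoid.inclusion_injective _)
  have hsingle : ∀ (m : P.dualMonoid τ) (c : ℂ),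
      P.chartMap h (AddMonoidAlgebra.single m c) =
        AddMonoidAlgebra.single (AddSubmonoid.inclusion (P.dualMonoid_anti h) m) c := by
    intro m c
    exact AddMonoidAlgebra.mapDomain_single
  have hneg : -w.1 ∈ P.dualMonoid σ := fun i hi ↦ by
    have := P.pair_add w.1 (-w.1) i
    rw [add_neg_cancel, pair_zero, hw i hi] at this
    omega
  have hunit : IsUnit (P.chartMap h (AddMonoidAlgebra.single w (1 : ℂ))) := by
    rw [hsingle]
    refine IsUnit.of_mul_eq_one (AddMonoidAlgebra.single ⟨-w.1, hneg⟩ 1) ?_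
    rw [AddMonoidAlgebra.single_mul_single, AddMonoidAlgebra.one_def]
    congr 1
    · ext1; simp
    · simp
  refine IsLocalization.Away.mk _ hunit (fun s ↦ ?_) fun a b hab ↦ ⟨0, by rw [hinj hab]⟩
  simp only [hmap]
  induction s using AddMonoidAlgebra.induction_linear with
  | zero => exact ⟨0, 0, by simp⟩
  | add s₁ s₂ h₁ h₂ =>
    obtain ⟨n₁, a₁, h₁⟩ := h₁
    obtain ⟨n₂, a₂, h₂⟩ := h₂
    refine ⟨n₁ + n₂, a₁ * AddMonoidAlgebra.single w 1 ^ n₂ +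
      a₂ * AddMonoidAlgebra.single w 1 ^ n₁, ?_⟩
    rw [map_add, map_mul, map_mul, map_pow, map_pow, ← h₁, ← h₂]
    ring
  | single m c =>
    let N : ℕ := ∑ i ∈ τ.1, (P.pair m.1 i).toNat
    have hmem : m.1 + N • w.1 ∈ P.dualMonoid τ := by
      intro i hi
      rw [pair_add, pair_nsmul]
      by_cases hiσ : i ∈ σ.1
      · rw [hw i hiσ]
        have := m.2 i hiσ
        omega
      · have h1 := hw' i hi hiσ
        have h2 : (P.pair m.1 i).toNat ≤ N :=
          Finset.single_le_sum (f := fun i ↦ (P.pair m.1 i).toNat) (fun _ _ ↦ Nat.zero_le _) hi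
        have h3 : P.pair m.1 i ≤ N := by omega
        nlinarith
    refine ⟨N, AddMonoidAlgebra.single ⟨_, hmem⟩ c, ?_⟩
    rw [hsingle, hsingle, AddMonoidAlgebra.single_pow, AddMonoidAlgebra.single_mul_single]
    congr 1
    simp

instance isOpenImmersion_chartFunctor_map {σ τ : P.Face} (f : σ ⟶ τ) : IsOpenImmersion (P.chartFunctor.map f) := by
  obtain ⟨w, hw, hw'⟩ := P.exists_weight f.le
  have hwτ : w ∈ P.dualMonoid τ := fun i hi ↦ by
    by_cases h : i ∈ σ.1
    · exact (hw i h).le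
    · exact (hw' i hi h).le
  let _ := (P.chartMap f.le).toRingHom.toAlgebra
  have := P.isLocalization f.le ⟨w, hwτ⟩ hw hw'
  exact IsOpenImmersion.of_isLocalization (S := P.chartRing σ)
    (AddMonoidAlgebra.single (⟨w, hwτ⟩ : P.dualMonoid τ) (1 : ℂ))

theorem notMem_of_range {σ τ : P.Face} (f : σ ⟶ τ) (w : P.dualMonoid τ)
    (hw : ∀ i ∈ σ.1, P.pair w i = 0) (hw' : ∀ i ∈ τ.1, i ∉ σ.1 → P.pair w i < 0)
    (x : PrimeSpectrum (P.chartRing σ)) :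
    AddMonoidAlgebra.single w (1 : ℂ) ∉ (PrimeSpectrum.comap (P.chartMap f.le).toRingHom x).asIdeal := by
  intro hmem
  let _ := (P.chartMap f.le).toRingHom.toAlgebra
  have := P.isLocalization f.le w hw hw'
  exact x.2.ne_top (Ideal.eq_top_of_isUnit_mem _ hmem
    (IsLocalization.Away.algebraMap_isUnit (S := P.chartRing σ)
      (AddMonoidAlgebra.single w (1 : ℂ))))

theorem exists_inter (σ τ : P.Face) : ∃ ρ : P.Face, ∀ i, i ∈ ρ.1 ↔ i ∈ σ.1 ∧ i ∈ τ.1 := by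
  obtain ⟨x, hx, hxσ⟩ := σ.2
  obtain ⟨y, hy, hyτ⟩ := τ.2
  have hmid : ∀ i, P.height i (fun k ↦ (x k + y k) / 2) = (P.height i x + P.height i y) / 2 := by
    intro i
    simp only [PolytopeData.height]
    rw [← Finset.sum_add_distrib, Finset.sum_div]
    exact Finset.sum_congr rfl fun k _ ↦ by ring
  refine ⟨⟨P.active fun k ↦ (x k + y k) / 2, _, fun i ↦ ?_, rfl⟩, fun i ↦ ?_⟩
  · rw [hmid]
    linarith [hx i, hy i]
  · rw [← hxσ, ← hyτ]
    simp only [PolytopeData.active, Finset.mem_filter, Finset.mem_univ, true_and, hmid]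
    have h1 := hx i
    have h2 := hy i
    constructor
    · intro h
      constructor <;> linarith
    · rintro ⟨h, h'⟩
      linarith

instance isLocallyDirected_chartFunctor : (P.chartFunctor ⋙ Scheme.forget).IsLocallyDirected where
  cond {σ τ κ} f g x y hxy := by
    obtain ⟨ρ, hρ⟩ := P.exists_inter σ τ
    have hρσ : ρ ≤ σ := fun i hi ↦ ((hρ i).1 hi).1
    have hρτ : ρ ≤ τ := fun i hi ↦ ((hρ i).1 hi).2
    obtain ⟨v, hv, hv'⟩ := P.exists_weight f.le
    obtain ⟨w, hw, hw'⟩ := P.exists_weight g.le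
    have hvκ : v ∈ P.dualMonoid κ := fun i hi ↦ by
      by_cases h : i ∈ σ.1
      · exact (hv i h).le
      · exact (hv' i hi h).le
    have hwκ : w ∈ P.dualMonoid κ := fun i hi ↦ by
      by_cases h : i ∈ τ.1
      · exact (hw i h).le
      · exact (hw' i hi h).le
    let z : PrimeSpectrum (P.chartRing κ) := PrimeSpectrum.comap (P.chartMap f.le).toRingHom x
    have hz : z = PrimeSpectrum.comap (P.chartMap g.le).toRingHom y := hxy
    have hvz := P.notMem_of_range f ⟨v, hvκ⟩ hv hv' x
    have hwz := P.notMem_of_range g ⟨w, hwκ⟩ hw hw' y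
    rw [← hz] at hwz
    have hloc := P.isLocalization (hρσ.trans f.le) (⟨v, hvκ⟩ + ⟨w, hwκ⟩)
      (fun i hi ↦ by
        have h := (hρ i).1 hi
        exact (P.pair_add v w i).trans (by rw [hv i h.1, hw i h.2, add_zero]))
      (fun i hi hi' ↦ by
        refine (P.pair_add v w i).trans_lt ?_
        have h1 : P.pair v i ≤ 0 := hvκ i hi
        have h2 : P.pair w i ≤ 0 := hwκ i hi
        by_cases h : i ∈ σ.1
        · have := hw' i hi fun h' ↦ hi' ((hρ i).2 ⟨h, h'⟩)
          omega
        · have := hv' i hi h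
          omega)
    let _ := (P.chartMap (hρσ.trans f.le)).toRingHom.toAlgebra
    have hrange := PrimeSpectrum.localization_away_comap_range (P.chartRing ρ)
      (AddMonoidAlgebra.single ((⟨v, hvκ⟩ : P.dualMonoid κ) + ⟨w, hwκ⟩) (1 : ℂ))
    have hmem : z ∈ (PrimeSpectrum.basicOpen
        (AddMonoidAlgebra.single ((⟨v, hvκ⟩ : P.dualMonoid κ) + ⟨w, hwκ⟩) (1 : ℂ)) : Set _) := by
      change _ ∉ z.asIdeal
      rw [show AddMonoidAlgebra.single ((⟨v, hvκ⟩ : P.dualMonoid κ) + ⟨w, hwκ⟩) (1 : ℂ) =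
        AddMonoidAlgebra.single ⟨v, hvκ⟩ 1 * AddMonoidAlgebra.single ⟨w, hwκ⟩ 1 by
          rw [AddMonoidAlgebra.single_mul_single, one_mul]]
      exact fun h ↦ (z.2.mem_or_mem h).elim hvz hwz
    rw [← hrange] at hmem
    obtain ⟨t, ht⟩ := hmem
    refine ⟨ρ, homOfLE hρσ, homOfLE hρτ, t, ?_, ?_⟩
    · refine (P.chartFunctor.map f).isOpenEmbedding.injective ?_
      change (P.chartFunctor.map (homOfLE hρσ) ≫ P.chartFunctor.map f) t = _
      rw [← P.chartFunctor.map_comp]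
      exact ht
    · refine (P.chartFunctor.map g).isOpenEmbedding.injective ?_
      change (P.chartFunctor.map (homOfLE hρτ) ≫ P.chartFunctor.map g) t = _
      rw [← P.chartFunctor.map_comp]
      exact ht.trans hz

/-- The toric variety of `Q`: the gluing of the affine toric varieties `Spec ℂ[S_σ]`. -/
def X : Scheme.{0} := colimit P.chartFunctor

/-- The open immersion of the affine toric variety of `σ`. -/
def chart (σ : P.Face) : P.chartFunctor.obj σ ⟶ P.X := colimit.ι P.chartFunctor σ

instance isOpenImmersion_chart (σ : P.Face) : IsOpenImmersion (P.chart σ) :=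
  inferInstanceAs (IsOpenImmersion (colimit.ι P.chartFunctor σ))

end SmoothPolytope

/-- DG functors. -/
structure DGFunctor (A : DGCategory.{u, v}) (B : DGCategory.{w, z}) where
  obj : A.Obj → B.Obj
  map : ∀ X Y, A.Hom X Y →ₗ[ℂ] B.Hom (obj X) (obj Y)
  map_mem : ∀ {X Y} {p : ℤ} {f : A.Hom X Y}, f ∈ A.deg X Y p →
    map X Y f ∈ B.deg (obj X) (obj Y) p
  map_d : ∀ {X Y} (f : A.Hom X Y), map X Y (A.d X Y f) = B.d (obj X) (obj Y) (map X Y f)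
  map_one : ∀ X, map X X (A.one X) = B.one (obj X)
  map_comp : ∀ {X Y Z} (f : A.Hom X Y) (g : A.Hom Y Z),
    map X Z (A.comp X Y Z f g) = B.comp (obj X) (obj Y) (obj Z) (map X Y f) (map Y Z g)

namespace DGCategory

/-- The (total) cohomology of a morphism complex. -/
abbrev Cohomology (A : DGCategory.{u, v}) (X Y : A.Obj) : Type v :=
  LinearMap.ker (A.d X Y) ⧸ (LinearMap.range (A.d X Y)).submoduleOf (LinearMap.ker (A.d X Y))

/-- Two objects are isomorphic in the category with morphisms the cohomology in degree zero. -/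
def HIso (A : DGCategory.{u, v}) (X Y : A.Obj) : Prop :=
  ∃ (f : A.Hom X Y) (g : A.Hom Y X), f ∈ A.deg X Y 0 ∧ g ∈ A.deg Y X 0 ∧
    A.d X Y f = 0 ∧ A.d Y X g = 0 ∧
    A.comp X Y X f g - A.one X ∈ LinearMap.range (A.d X X) ∧
    A.comp Y X Y g f - A.one Y ∈ LinearMap.range (A.d Y Y)

end DGCategory

namespace DGFunctor

variable {A : DGCategory.{u, v}} {B : DGCategory.{w, z}} (F : DGFunctor A B)

/-- The map induced by a DG functor on the cohomology of morphism complexes. -/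
def cohomologyMap (X Y : A.Obj) :
    A.Cohomology X Y →ₗ[ℂ] B.Cohomology (F.obj X) (F.obj Y) :=
  Submodule.mapQ _ _
    ((F.map X Y).restrict fun f hf ↦ by
      rw [LinearMap.mem_ker] at hf ⊢
      rw [← F.map_d, hf, map_zero])
    (by
      rintro f ⟨g, hg⟩
      exact ⟨F.map X Y g, by rw [← F.map_d, hg]; rfl⟩)

/-- The functor induces an equivalence of cohomology categories. -/
structure IsQuasiEquivalence : Prop where
  bijective : ∀ X Y, Function.Bijective (F.cohomologyMap X Y)
  essSurj : ∀ Z, ∃ X, B.HIso (F.obj X) Z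

end DGFunctor

namespace AlgebraicGeometry.Scheme.Modules

variable {X : Scheme.{0}}

/-- The restriction of a section. -/
def resSec (L : X.Modules) {V V' : X.Opens} (h : V' ≤ V) (e : Γ(L, V)) : Γ(L, V') :=
  L.presheaf.map (homOfLE h).op e

theorem resSec_smul (L : X.Modules) {V V' : X.Opens} (h : V' ≤ V) (f : Γ(X, V)) (e : Γ(L, V)) :
    L.resSec h (f • e) = X.presheaf.map (homOfLE h).op f • L.resSec h e :=
  L.map_smul _ _ _

theorem resSec_add (L : X.Modules) {V V' : X.Opens} (h : V' ≤ V) (e e' : Γ(L, V)) :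
    L.resSec h (e + e') = L.resSec h e + L.resSec h e' :=
  map_add (L.presheaf.map (homOfLE h).op).hom e e'

/-- The section `e` of `L` over `V` is a frame: `f ↦ f e` is an isomorphism `𝒪_V ≅ L|_V`. -/
def IsGenerator (L : X.Modules) {V : X.Opens} (e : Γ(L, V)) : Prop :=
  ∀ (V' : X.Opens) (h : V' ≤ V),
    Function.Bijective fun f : Γ(X, V') ↦ f • L.resSec h e

/-- Line bundles: the `𝒪_X`-modules that are locally isomorphic to `𝒪_X`. -/
def IsInvertible (L : X.Modules) : Prop :=
  ∀ x : X, ∃ (V : X.Opens) (e : Γ(L, V)), x ∈ V ∧ L.IsGenerator e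

/-- The section `s` of the line bundle `L` over the open set `T` has order `m` at the point `η`, of
which the local ring is a discrete valuation ring: near `η` one has `s = w ϖ^m e` on `T`, for a frame
`e` of `L`, an invertible function `w` and a uniformizer `ϖ` at `η`. To allow for negative `m = b - a`,
this is written as `ϖ^a s = w ϖ^b e`. -/
def HasOrderAt (L : X.Modules) {T : X.Opens} (s : Γ(L, T)) (η : X) (m : ℤ) : Prop :=
  ∃ (V : X.Opens) (hη : η ∈ V) (e : Γ(L, V)) (ϖ w : Γ(X, V)) (a b : ℕ),
    L.IsGenerator e ∧ IsUnit w ∧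
    IsLocalRing.maximalIdeal (X.presheaf.stalk η) = Ideal.span {X.presheaf.germ V η hη ϖ} ∧
    m = (b : ℤ) - a ∧
    X.presheaf.map (homOfLE (inf_le_left : V ⊓ T ≤ V)).op (ϖ ^ a) •
        L.resSec (inf_le_right : V ⊓ T ≤ T) s =
      X.presheaf.map (homOfLE (inf_le_left : V ⊓ T ≤ V)).op (w * ϖ ^ b) •
        L.resSec (inf_le_left : V ⊓ T ≤ V) e

end AlgebraicGeometry.Scheme.Modules

namespace SmoothPolytope

variable {n : ℕ} (P : SmoothPolytope n)

/-- The structure morphism of the toric variety. -/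
def toSpec : P.X ⟶ Spec (CommRingCat.of ℂ) :=
  colimit.desc P.chartFunctor
    { pt := Spec (CommRingCat.of ℂ)
      ι :=
        { app := fun σ ↦ Spec.map (CommRingCat.ofHom (algebraMap ℂ (P.chartRing σ)))
          naturality := fun σ τ f ↦ by
            refine Eq.trans ?_ (Category.comp_id _).symm
            refine (Spec.map_comp _ _).symm.trans ?_
            congr 1
            exact CommRingCat.hom_ext (RingHom.ext fun c ↦ (P.chartMap f.le).commutes c) } }

/-- The constant functions on an open subset of the toric variety. -/
def scalar (V : P.X.Opens) : ℂ →+* Γ(P.X, V) :=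
  (P.X.presheaf.map (homOfLE (le_top : V ≤ ⊤)).op).hom.comp
    (P.toSpec.appTop.hom.comp (Scheme.ΓSpecIso (CommRingCat.of ℂ)).inv.hom)

theorem map_scalar {V V' : P.X.Opens} (h : V' ≤ V) (c : ℂ) :
    P.X.presheaf.map (homOfLE h).op (P.scalar V c) = P.scalar V' c := by
  have := P.X.presheaf.map_comp (homOfLE (le_top : V ≤ ⊤)).op (homOfLE h).op
  exact (ConcreteCategory.congr_hom this
    (P.toSpec.appTop.hom ((Scheme.ΓSpecIso (CommRingCat.of ℂ)).inv.hom c))).symm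

instance instModuleSections (L : P.X.Modules) (V : P.X.Opens) : Module ℂ Γ(L, V) :=
  Module.compHom _ (P.scalar V)

theorem smul_def (L : P.X.Modules) (V : P.X.Opens) (c : ℂ) (x : Γ(L, V)) :
    c • x = P.scalar V c • x := rfl

theorem resSec_smul (L : P.X.Modules) {V V' : P.X.Opens} (h : V' ≤ V) (c : ℂ) (x : Γ(L, V)) :
    L.resSec h (c • x) = c • L.resSec h x := by
  rw [smul_def, smul_def, Scheme.Modules.resSec_smul, map_scalar]

/-- The open subset `U_σ` of the toric variety, for a cell `σ`. -/
def affineOpen (σ : P.Face) : P.X.Opens := (P.chart σ).opensRange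

/-- The interior of `Q` as a cell. -/
def interiorCell : P.Face := ⟨∅, P.exists_interior⟩

/-- The dense torus. -/
def torus : P.X.Opens := P.affineOpen P.interiorCell

theorem torus_le (σ : P.Face) : P.torus ≤ P.affineOpen σ := by
  have h : P.interiorCell ≤ σ := Finset.empty_subset _
  rintro _ ⟨x, rfl⟩
  refine ⟨P.chartFunctor.map (homOfLE h) x, ?_⟩
  have := colimit.w P.chartFunctor (homOfLE h)
  exact congrArg (fun g : P.chartFunctor.obj P.interiorCell ⟶ P.X ↦ g x) this

/-- Laurent polynomials as functions on the torus. -/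
def laurent : AddMonoidAlgebra ℂ (Fin n → ℤ) →+* Γ(P.X, P.torus) :=
  ((Scheme.ΓSpecIso (CommRingCat.of (P.chartRing P.interiorCell))).inv ≫
      (IsOpenImmersion.ΓIsoTop (P.chart P.interiorCell)).hom).hom.comp
    (AddMonoidAlgebra.mapDomainRingHom ℂ
      ({ toFun := fun u ↦ ⟨u, fun _ h ↦ absurd h (Finset.notMem_empty _)⟩
         map_zero' := rfl
         map_add' := fun _ _ ↦ rfl } : (Fin n → ℤ) →+ P.dualMonoid P.interiorCell))

/-- The monomial `χ^u`. -/
def monomial (u : Fin n → ℤ) : Γ(P.X, P.torus) := P.laurent (AddMonoidAlgebra.single u 1)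

/-- The toric divisor of a facet: the union of the torus orbits of the cells in this facet. -/
def divisor (i : P.Facet) : Set P.X := {x | ∀ σ : P.Face, i ∉ σ.1 → x ∉ P.affineOpen σ}

/-- The section `s` of the line bundle `L` over the torus has order `m` (of zero if `m ≥ 0`, of pole
`-m` otherwise) along the toric divisor of the facet `i`. -/
def HasOrderAlong (L : P.X.Modules) (s : Γ(L, P.torus)) (i : P.Facet) (m : ℤ) : Prop :=
  ∃ η : P.X, IsGenericPoint η (P.divisor i) ∧ L.HasOrderAt s η m

/-- Line bundles on the toric variety. -/
def LineBundle : Type 1 := {L : P.X.Modules // L.IsInvertible}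

/-- The sections over `U` of the sheaf `ℋom(L, M)`, which is `M ⊗ L⁻¹` for line bundles: these are
the morphisms `L|_U → M|_U` of `𝒪_U`-modules. -/
def homSections (L M : P.X.Modules) (U : P.X.Opens) :
    Submodule ℂ (∀ V : {V : P.X.Opens // V ≤ U}, Γ(L, V.1) →ₗ[ℂ] Γ(M, V.1)) where
  carrier := {φ | (∀ (V) (f : Γ(P.X, V.1)) (x : Γ(L, V.1)), φ V (f • x) = f • φ V x) ∧
    ∀ (V V') (h : V'.1 ≤ V.1) (x : Γ(L, V.1)), φ V' (L.resSec h x) = M.resSec h (φ V x)}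
  add_mem' {φ ψ} hφ hψ := by
    refine ⟨fun V f x ↦ ?_, fun V V' h x ↦ ?_⟩
    · simp [hφ.1, hψ.1]
    · simp [hφ.2 V V' h, hψ.2 V V' h, Scheme.Modules.resSec_add]
  zero_mem' := by
    refine ⟨fun V f x ↦ ?_, fun V V' h x ↦ ?_⟩
    · simp
    · simp [Scheme.Modules.resSec]
  smul_mem' c φ hφ := by
    refine ⟨fun V f x ↦ ?_, fun V V' h x ↦ ?_⟩
    · simp [hφ.1, smul_def, smul_smul, mul_comm]
    · simp [hφ.2 V V' h, resSec_smul]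

variable {N : ℕ} (σ : Fin N ≃ P.Face)

/-- The intersection `U_s = ⋂_{k ∈ s} U_k`, where `U_k` is the open set of the cell `σ_k`. -/
def affineInter (s : Finset (Fin N)) : P.X.Opens := s.inf fun k ↦ P.affineOpen (σ k)

theorem affineInter_anti {s t : Finset (Fin N)} (h : s ⊆ t) :
    P.affineInter σ t ≤ P.affineInter σ s := Finset.inf_mono h

theorem torus_le_affineInter (s : Finset (Fin N)) : P.torus ≤ P.affineInter σ s :=
  Finset.le_inf fun _ _ ↦ P.torus_le _

variable {P} in
/-- The restriction of morphisms of `𝒪`-modules to a smaller open set. -/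
def homRes {L M : P.X.Modules} {U U' : P.X.Opens} (h : U' ≤ U) :
    P.homSections L M U →ₗ[ℂ] P.homSections L M U' where
  toFun φ := ⟨fun V ↦ φ.1 ⟨V.1, V.2.trans h⟩, fun V f x ↦ φ.2.1 ⟨V.1, V.2.trans h⟩ f x,
    fun V V' h' x ↦ φ.2.2 ⟨V.1, V.2.trans h⟩ ⟨V'.1, V'.2.trans h⟩ h' x⟩
  map_add' _ _ := rfl
  map_smul' _ _ := rfl

variable {P} in
/-- The composition of morphisms of `𝒪`-modules, first `φ`, then `ψ`. -/
def homCompFun {L M K : P.X.Modules} {U : P.X.Opens} (φ : P.homSections L M U)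
    (ψ : P.homSections M K U) : P.homSections L K U :=
  ⟨fun V ↦ (ψ.1 V).comp (φ.1 V), fun V f x ↦ by
    change ψ.1 V (φ.1 V _) = f • ψ.1 V (φ.1 V x)
    rw [φ.2.1, ψ.2.1], fun V V' h x ↦ by
    change ψ.1 V' (φ.1 V' _) = K.resSec h (ψ.1 V (φ.1 V x))
    rw [φ.2.2 V V' h, ψ.2.2 V V' h]⟩

variable {P} in
/-- The composition of morphisms of `𝒪`-modules as a bilinear map. -/
def homComp (L M K : P.X.Modules) (U : P.X.Opens) :
    P.homSections L M U →ₗ[ℂ] P.homSections M K U →ₗ[ℂ] P.homSections L K U where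
  toFun φ :=
    { toFun := homCompFun φ
      map_add' := fun _ _ ↦ rfl
      map_smul' := fun _ _ ↦ rfl }
  map_add' φ φ' := LinearMap.ext fun ψ ↦ Subtype.ext <| funext fun V ↦ LinearMap.ext fun x ↦
    (ψ.1 V).map_add (φ.1 V x) (φ'.1 V x)
  map_smul' c φ := LinearMap.ext fun ψ ↦ Subtype.ext <| funext fun V ↦ LinearMap.ext fun x ↦
    (ψ.1 V).map_smul c (φ.1 V x)

/-- The coefficients for `Čech(X)`: the presheaf of categories of line bundles on the affine toric
cover `(U_k)`. -/
def lineBundleSystem : CechSystem.{1, 0} (Fin N) where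
  Obj := P.LineBundle
  Hom s L M := P.homSections L.1 M.1 (P.affineInter σ s)
  res h _ _ := homRes (P.affineInter_anti σ h)
  one _ _ := ⟨fun _ ↦ LinearMap.id, fun _ _ _ ↦ rfl, fun _ _ _ _ ↦ rfl⟩
  comp s L M K := homComp L.1 M.1 K.1 (P.affineInter σ s)
  res_refl _ := rfl
  res_res _ _ _ _ _ := rfl
  res_one _ _ := rfl
  res_comp _ _ _ _ _ _ := rfl
  one_comp _ := rfl
  comp_one _ := rfl
  assoc _ _ _ := rfl

/-- The DG category `Čech(X)`. -/
def cechX : DGCategory.{1, 0} := (P.lineBundleSystem σ).cech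

/-- The set `∂⁺_H Q`: the union of the closed facets on which `H` is positive. -/
def positivePart (H : P.Facet → ℤ) : Set (Fin n → ℝ) := {x | ∃ i, 0 < H i ∧ x ∈ P.facet i}

/-- The open star of a cell: the union of the open cells that have it in their closure. -/
def openStar (τ : P.Face) : Set (Fin n → ℝ) := {x ∈ P.body | P.active x ⊆ τ.1}

/-- The open covers of `Q` dual to its barycentric subdivision: `W_τ` is contained in the open star of
`τ`, the intersection of some of these sets is nonempty if and only if their cells are nested,
it is connected then, and it meets every facet that contains all these cells. -/
structure IsCellularCover (W : P.Face → Set (Fin n → ℝ)) : Prop where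
  isOpen : ∀ τ, ∃ O : Set (Fin n → ℝ), IsOpen O ∧ W τ = O ∩ P.body
  covers : ∀ x ∈ P.body, ∃ τ, x ∈ W τ
  subset_openStar : ∀ τ, W τ ⊆ P.openStar τ
  nonempty_iff : ∀ s : Finset P.Face, s.Nonempty →
    ((⋂ τ ∈ s, W τ).Nonempty ↔ IsChain (· ≤ ·) (s : Set P.Face))
  isPreconnected : ∀ s : Finset P.Face, s.Nonempty → _root_.IsPreconnected (⋂ τ ∈ s, W τ)
  meets_facet : ∀ s : Finset P.Face, s.Nonempty → IsChain (· ≤ ·) (s : Set P.Face) →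
    ∀ i, (∀ τ ∈ s, i ∈ τ.1) → ((⋂ τ ∈ s, W τ) ∩ P.facet i).Nonempty

/-- The sections over `R ⊆ Q` of the sheaf `𝒮(H)`: the locally constant functions that vanish on
`∂⁺_H Q`. On a connected nonempty `R` these are the constants if `R` is disjoint from `∂⁺_H Q`, and
zero otherwise. -/
def constSections (H : P.Facet → ℤ) (R : Set (Fin n → ℝ)) : Submodule ℂ (R → ℂ) where
  carrier := {f | IsLocallyConstant f ∧ ∀ x : R, x.1 ∈ P.positivePart H → f x = 0}
  add_mem' {f g} hf hg := ⟨hf.1.add hg.1, fun x hx ↦ by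
    rw [Pi.add_apply, hf.2 x hx, hg.2 x hx, add_zero]⟩
  zero_mem' := ⟨IsLocallyConstant.const 0, fun _ _ ↦ rfl⟩
  smul_mem' c f hf := ⟨hf.1.comp (c • ·), fun x hx ↦ by
    rw [Pi.smul_apply, hf.2 x hx, smul_zero]⟩

theorem mul_mem_constSections {H H' : P.Facet → ℤ} {R : Set (Fin n → ℝ)} {f g : R → ℂ}
    (hf : f ∈ P.constSections H R) (hg : g ∈ P.constSections H' R) :
    f * g ∈ P.constSections (H + H') R := by
  refine ⟨hf.1.mul hg.1, ?_⟩
  rintro x ⟨i, hi, hx⟩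
  rw [Pi.mul_apply]
  rcases lt_or_ge 0 (H i) with h | h
  · rw [hf.2 x ⟨i, h, hx⟩, zero_mul]
  · rw [hg.2 x ⟨i, ?_, hx⟩, mul_zero]
    rw [Pi.add_apply] at hi
    omega

/-- The sections over `R` of the direct sum `⨁_u 𝒮(H + u)`, where the lattice vector `u` is also the
function on the facets with values `⟪u, ν_i⟫`. The summand of `u` is recorded as the coefficient
of `u`. -/
def gradedSections (H : P.Facet → ℤ) (R : Set (Fin n → ℝ)) :
    Submodule ℂ (AddMonoidAlgebra (R → ℂ) (Fin n → ℤ)) where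
  carrier := {p | ∀ u, p.coeff u ∈ P.constSections (H + P.pair u) R}
  add_mem' hp hq u := (P.constSections _ R).add_mem (hp u) (hq u)
  zero_mem' _ := (P.constSections _ R).zero_mem
  smul_mem' c _ hp u := (P.constSections _ R).smul_mem c (hp u)

theorem single_mem_gradedSections {H : P.Facet → ℤ} {R : Set (Fin n → ℝ)} {u : Fin n → ℤ} {f : R → ℂ}
    (hf : f ∈ P.constSections (H + P.pair u) R) :
    AddMonoidAlgebra.single u f ∈ P.gradedSections H R := by
  intro v
  by_cases h : v = u
  · subst h
    simpa using hf
  · simp [AddMonoidAlgebra.coeff_single, Ne.symm h]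

theorem mul_mem_gradedSections {H H' : P.Facet → ℤ} {R : Set (Fin n → ℝ)}
    {p q : AddMonoidAlgebra (R → ℂ) (Fin n → ℤ)} (hp : p ∈ P.gradedSections H R)
    (hq : q ∈ P.gradedSections H' R) : p * q ∈ P.gradedSections (H + H') R := by
  rw [AddMonoidAlgebra.mul_def]
  refine Submodule.sum_mem _ fun u _ ↦ Submodule.sum_mem _ fun v _ ↦ ?_
  refine P.single_mem_gradedSections ?_
  have h : H + H' + P.pair (u + v) = (H + P.pair u) + (H' + P.pair v) := by
    funext i
    simp only [Pi.add_apply, pair_add]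
    ring
  rw [h]
  exact P.mul_mem_constSections (hp u) (hq v)

/-- The restriction of functions with values in `ℂ` from `R` to a subset. -/
def restrictFun {R R' : Set (Fin n → ℝ)} (h : R' ⊆ R) : (R → ℂ) →ₐ[ℂ] (R' → ℂ) where
  toFun f := f ∘ Set.inclusion h
  map_one' := rfl
  map_mul' _ _ := rfl
  map_zero' := rfl
  map_add' _ _ := rfl
  commutes' _ := rfl

/-- The intersection `W_s = ⋂_{k ∈ s} W_k`, where `W_k` is the open set of the cell `σ_k`. -/
def region (W : P.Face → Set (Fin n → ℝ)) (s : Finset (Fin N)) : Set (Fin n → ℝ) :=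
  {x ∈ P.body | ∀ k ∈ s, x ∈ W (σ k)}

theorem region_anti (W : P.Face → Set (Fin n → ℝ)) {s t : Finset (Fin N)} (h : s ⊆ t) :
    P.region σ W t ⊆ P.region σ W s := fun _ hx ↦ ⟨hx.1, fun k hk ↦ hx.2 k (h hk)⟩

/-- The restriction of sections of `⨁_u 𝒮(H + u)`. -/
def gradedRes (H : P.Facet → ℤ) {R R' : Set (Fin n → ℝ)} (h : R' ⊆ R) :
    P.gradedSections H R →ₗ[ℂ] P.gradedSections H R' where
  toFun p := ⟨AddMonoidAlgebra.mapAlgHom (Fin n → ℤ) (restrictFun h) p.1, fun u ↦ by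
    have := p.2 u
    rw [AddMonoidAlgebra.coeff_mapAlgHom]
    exact ⟨this.1.comp_continuous (continuous_inclusion h),
      fun x hx ↦ this.2 (Set.inclusion h x) hx⟩⟩
  map_add' p q := Subtype.ext (map_add _ p.1 q.1)
  map_smul' c p := Subtype.ext (map_smul _ c p.1)

theorem coeff_gradedRes {H : P.Facet → ℤ} {R R' : Set (Fin n → ℝ)} (h : R' ⊆ R)
    (p : P.gradedSections H R) (u : Fin n → ℤ) :
    (P.gradedRes H h p).1.coeff u = p.1.coeff u ∘ Set.inclusion h := by
  change (AddMonoidAlgebra.mapAlgHom (Fin n → ℤ) (restrictFun h) p.1).coeff u = _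
  rw [AddMonoidAlgebra.coeff_mapAlgHom]
  rfl

/-- The unit section of `⨁_u 𝒮(H - H + u)`, in the summand of `u = 0`. -/
def gradedOne (H : P.Facet → ℤ) (R : Set (Fin n → ℝ)) : P.gradedSections (H - H) R :=
  ⟨1, by
    rw [AddMonoidAlgebra.one_def]
    refine P.single_mem_gradedSections ⟨IsLocallyConstant.const 1, ?_⟩
    rintro x ⟨i, hi, -⟩
    simp [pair_zero] at hi⟩

/-- The multiplication of sections of `⨁_u 𝒮(H₁ - H₀ + u)` and of `⨁_u 𝒮(H₂ - H₁ + u)`. -/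
def gradedMulFun {H₀ H₁ H₂ : P.Facet → ℤ} {R : Set (Fin n → ℝ)} (p : P.gradedSections (H₁ - H₀) R)
    (q : P.gradedSections (H₂ - H₁) R) : P.gradedSections (H₂ - H₀) R :=
  ⟨p.1 * q.1, by
    have h : H₂ - H₀ = (H₁ - H₀) + (H₂ - H₁) := by abel
    rw [h]
    exact P.mul_mem_gradedSections p.2 q.2⟩

/-- This multiplication as a bilinear map. -/
def gradedMul (H₀ H₁ H₂ : P.Facet → ℤ) (R : Set (Fin n → ℝ)) :
    P.gradedSections (H₁ - H₀) R →ₗ[ℂ] P.gradedSections (H₂ - H₁) R →ₗ[ℂ]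
      P.gradedSections (H₂ - H₀) R where
  toFun p :=
    { toFun := P.gradedMulFun p
      map_add' := fun q q' ↦ Subtype.ext (mul_add p.1 q.1 q'.1)
      map_smul' := fun c q ↦ Subtype.ext (mul_smul_comm c p.1 q.1) }
  map_add' p p' := LinearMap.ext fun q ↦ Subtype.ext (add_mul p.1 p'.1 q.1)
  map_smul' c p := LinearMap.ext fun q ↦ Subtype.ext (smul_mul_assoc c p.1 q.1)

/-- The coefficients for `Čech^{ℤⁿ}(Q)`: objects are the functions `∂Q → ℤ` that are constant on the
facets, given by their values there; morphisms from `H₀` to `H₁` are sections of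
`⨁_u 𝒮(H₁ - H₀ + u)`. -/
def functionSystem (W : P.Face → Set (Fin n → ℝ)) : CechSystem.{0, 0} (Fin N) where
  Obj := P.Facet → ℤ
  Hom s H₀ H₁ := P.gradedSections (H₁ - H₀) (P.region σ W s)
  res h H₀ H₁ := P.gradedRes (H₁ - H₀) (P.region_anti σ W h)
  one s H := P.gradedOne H (P.region σ W s)
  comp s H₀ H₁ H₂ := P.gradedMul H₀ H₁ H₂ (P.region σ W s)
  res_refl p := Subtype.ext <| AddMonoidAlgebra.ext <| Finsupp.ext fun u ↦ P.coeff_gradedRes _ p u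
  res_res h h' H₀ H₁ p := Subtype.ext <| AddMonoidAlgebra.ext <| Finsupp.ext fun u ↦ by
    rw [coeff_gradedRes, coeff_gradedRes, coeff_gradedRes]
    rfl
  res_one h _ := Subtype.ext (map_one (AddMonoidAlgebra.mapAlgHom _ (restrictFun _)))
  res_comp h _ _ _ p q := Subtype.ext (map_mul (AddMonoidAlgebra.mapAlgHom _ (restrictFun _)) p.1 q.1)
  one_comp p := Subtype.ext (one_mul p.1)
  comp_one p := Subtype.ext (mul_one p.1)
  assoc p q r := Subtype.ext (mul_assoc p.1 q.1 r.1)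

/-- The DG category `Čech^{ℤⁿ}(Q)` of the cover `W`. -/
def cechQ (W : P.Face → Set (Fin n → ℝ)) : DGCategory.{0, 0} := (P.functionSystem σ W).cech

variable {P σ}

/-- The component of a morphism of `Čech(X)` on `U_s`. -/
def cechX.component {L M : P.LineBundle} (φ : (P.cechX σ).Hom L M) (s : Finset (Fin N)) :
    P.homSections L.1 M.1 (P.affineInter σ s) := φ.1 s

/-- The component on `W_s` of a morphism of `Čech^{ℤⁿ}(Q)`, as a function on `W_s` with values in the
Laurent polynomials. -/
def cechQ.value {W : P.Face → Set (Fin n → ℝ)} {H₀ H₁ : P.Facet → ℤ}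
    (φ : (P.cechQ σ W).Hom H₀ H₁) (s : Finset (Fin N)) (x : P.region σ W s) :
    AddMonoidAlgebra ℂ (Fin n → ℤ) :=
  AddMonoidAlgebra.mapAlgHom (Fin n → ℤ) (Pi.evalAlgHom ℂ (fun _ : P.region σ W s ↦ ℂ) x) (φ.1 s).1

variable (P σ)

/-- A morphism of line bundles over `U_s`, evaluated on a section over the torus. -/
def onTorus {L M : P.X.Modules} {s : Finset (Fin N)}
    (φ : P.homSections L M (P.affineInter σ s)) (e : Γ(L, P.torus)) : Γ(M, P.torus) :=
  φ.1 ⟨P.torus, P.torus_le_affineInter σ s⟩ e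

end SmoothPolytope

end

/-! Over the torus the frames $e_L$ turn morphisms of line bundles into Laurent polynomials. Both
Čech systems then become bookkeeping of which monomials $\chi^u$ are allowed on which intersection.

Local frames control the allowed monomials. Every cell has a vertex in its closure
(`exists_vertex`), the chart of a vertex is an affine space because $Q$ is smooth, and line bundles
are trivial on the spectrum of a factorial ring (`IsInvertible.exists_isGenerator`). The units of
the Laurent ring are scalar multiples of monomials. Hence on each chart $e_L=\chi^m f$ with a frame
$f$ (`exists_frame`), and $\langle m,\nu_i\rangle$ depends only on the facet $i$, not on the chart
(`pair_eq_of_frame`). The prime of $D_i$ in its chart is generated by a monomial with pairing $-1$,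
so $\langle m,\nu_i\rangle$ is the negative of the order of $e_L$ along $D_i$ (`hasOrderAlong_iff`).
A morphism over a chart is multiplication by a regular function in local frames, and regular
functions are spanned by the monomials of the dual cone. This gives the inequalities of part 1, for
all $U_s$, since $U_s$ is the chart of the meet of the cells of $s$.

The functor regards the coefficients as constant functions on $W_s$. If the cells of $s$ form a
chain, then $W_s$ is connected and meets exactly the facets that contain all of them, so this is
bijective on sections. Otherwise $W_s=\emptyset$ and the target is zero. So $F$ is surjective on
cochains, and its kernel consists of the cochains that vanish on chains.

It remains to see that the kernel is acyclic (`exists_coboundary_eq`). Call the core of $s$ the set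
of its members that lie above a member not comparable to all of $s$; it is empty exactly for chains.
The other members form a chain below the core. Hence the meet $v$ of a nonempty core is comparable
to everything in $s$, and adjoining $v$ to $s$ or removing it changes neither the core nor $U_s$.
Toggling $v$ pairs off the sets that are not chains and gives a contraction, one core size at a
time.

For essential surjectivity, smoothness provides for any $H$ lattice vectors $m_\sigma$ with $\langle
m_\sigma,\nu_i\rangle=H_i$ for $i\supseteq\sigma$. The functions $f$ on the torus for which all
$\chi^{m_\sigma}f$ extend to $U_\sigma$ form a line bundle in which the section $1$ has the
invariant $H$ (`exists_lineBundle`). Another frame over the torus changes $H$ by a lattice vector,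
and functions that differ by a lattice vector are isomorphic objects (`hIso_of_eq_add_pair`). -/

noncomputable section

/-! ### Cochains on the nonempty subsets of a finite poset with meets -/

namespace CechSystem

/-! ### The core of a finite set: the part above an incomparability -/

section Core

variable {K L : Type} [PartialOrder L]

open Classical in
/-- The elements of `s` that lie above an element of `s` which is not comparable to all of `s`. -/
def core (r : K → L) (s : Finset K) : Finset K :=
  s.filter fun x ↦ ∃ y ∈ s, r y ≤ r x ∧ ∃ z ∈ s, ¬ r y ≤ r z ∧ ¬ r z ≤ r y

theorem mem_core {r : K → L} {s : Finset K} {x : K} : x ∈ core r s ↔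
    x ∈ s ∧ ∃ y ∈ s, r y ≤ r x ∧ ∃ z ∈ s, ¬ r y ≤ r z ∧ ¬ r z ≤ r y := by
  classical
  simp [core]

theorem core_subset (r : K → L) (s : Finset K) : core r s ⊆ s := fun _ hx ↦ (mem_core.1 hx).1

theorem core_mono (r : K → L) {s t : Finset K} (h : s ⊆ t) : core r s ⊆ core r t := by
  intro x hx
  obtain ⟨hx, y, hy, hyx, z, hz, hyz⟩ := mem_core.1 hx
  exact mem_core.2 ⟨h hx, y, h hy, hyx, z, h hz, hyz⟩

theorem core_nonempty {r : K → L} {s : Finset K} {y z : K} (hy : y ∈ s) (hz : z ∈ s)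
    (h : ¬ r y ≤ r z) (h' : ¬ r z ≤ r y) : (core r s).Nonempty :=
  ⟨y, mem_core.2 ⟨hy, y, hy, le_rfl, z, hz, h, h'⟩⟩

/-- If $x\not\le y$, then either $y\le x$, and $x$ inherits from $y$ the incomparable pair below it,
or $x$ and $y$ are themselves incomparable. Both put $x$ into the core. -/
theorem le_core {r : K → L} {s : Finset K} {x y : K} (hx : x ∈ s) (hxc : x ∉ core r s)
    (hy : y ∈ core r s) : r x ≤ r y := by
  by_contra hxy
  by_cases hyx : r y ≤ r x
  · obtain ⟨-, a, ha, hay, b, hb, hab⟩ := mem_core.1 hy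
    exact hxc (mem_core.2 ⟨hx, a, ha, hay.trans hyx, b, hb, hab⟩)
  · exact hxc (mem_core.2 ⟨hx, x, hx, le_rfl, y, (core_subset r s hy), hxy, hyx⟩)

variable [DecidableEq K]

/-- Both members of an incomparable pair belong to the core, so no witness is lost when an element
outside of the core is removed. -/
theorem core_erase {r : K → L} {s : Finset K} {x : K} (hxc : x ∉ core r s) :
    core r (s.erase x) = core r s := by
  refine (core_mono r (Finset.erase_subset _ _)).antisymm fun w hw ↦ ?_
  have hwx : w ≠ x := fun h ↦ hxc (h ▸ hw)
  obtain ⟨hw, y, hy, hyw, z, hz, hyz, hzy⟩ := mem_core.1 hw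
  have hyx : y ≠ x := by
    rintro rfl
    exact hxc (mem_core.2 ⟨hy, y, hy, le_rfl, z, hz, hyz, hzy⟩)
  have hzx : z ≠ x := by
    rintro rfl
    exact hxc (mem_core.2 ⟨hz, z, hz, le_rfl, y, hy, hzy, hyz⟩)
  exact mem_core.2 ⟨Finset.mem_erase.2 ⟨hwx, hw⟩, y, Finset.mem_erase.2 ⟨hyx, hy⟩, hyw, z,
    Finset.mem_erase.2 ⟨hzx, hz⟩, hyz, hzy⟩

/-- The meet lies below the core and, by `le_core`, above the rest of $s$, so it is comparable to
all of $s$. A member $y\le x$ of an incomparable pair would then be a core element, hence $x\le y$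
and $y=x$, which is impossible. -/
theorem notMem_core_insert {r : K → L} {s : Finset K} (hr : Function.Injective r) {x : K}
    (hx : IsGLB (r '' core r s) (r x)) : x ∉ core r (insert x s) := by
  intro h
  obtain ⟨-, y, hy, hyx, z, hz, hyz, hzy⟩ := mem_core.1 h
  have hcomp : ∀ a ∈ s, r a ≤ r x ∨ r x ≤ r a := by
    intro a ha
    by_cases hac : a ∈ core r s
    · exact Or.inr (hx.1 ⟨a, hac, rfl⟩)
    · exact Or.inl (hx.2 (by rintro _ ⟨b, hb, rfl⟩; exact le_core ha hac hb))
  have hyx' : y ≠ x := by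
    rintro rfl
    rcases Finset.mem_insert.1 hz with rfl | hz
    · exact hyz le_rfl
    · exact (hcomp z hz).elim hzy hyz
  have hzx' : z ≠ x := fun h ↦ hyz (h ▸ hyx)
  have hys := Finset.mem_of_mem_insert_of_ne hy hyx'
  have hzs := Finset.mem_of_mem_insert_of_ne hz hzx'
  have : y ∈ core r s := mem_core.2 ⟨hys, y, hys, le_rfl, z, hzs, hyz, hzy⟩
  exact hyx' (hr (le_antisymm hyx (hx.1 ⟨y, this, rfl⟩)))

theorem core_insert {r : K → L} {s : Finset K} (hr : Function.Injective r) {x : K}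
    (hx : IsGLB (r '' core r s) (r x)) : core r (insert x s) = core r s := by
  have h := notMem_core_insert hr hx
  by_cases hxs : x ∈ s
  · rw [Finset.insert_eq_of_mem hxs]
  · rw [← core_erase h, Finset.erase_insert hxs]

end Core

/-! ### Acyclicity of the cochains that vanish on chains -/

section Acyclic

variable {K L : Type} [LinearOrder K] [PartialOrder L] {M : Type*} [AddCommGroup M]

/-- The coboundary of a function on finite subsets with values in a fixed group. -/
def coboundary (f : Finset K → M) (s : Finset K) : M := ∑ j ∈ s, sign j s • f (s.erase j)

theorem coboundary_add (f g : Finset K → M) : coboundary (f + g) = coboundary f + coboundary g := by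
  funext s
  simp [coboundary, Finset.sum_add_distrib]

theorem coboundary_sub (f g : Finset K → M) : coboundary (f - g) = coboundary f - coboundary g := by
  funext s
  simp [coboundary, Finset.sum_sub_distrib, smul_sub]

theorem sign_mul_sign (j : K) (s : Finset K) : sign j s * sign j s = 1 := by
  rw [sign, ← mul_pow]
  simp

theorem sign_erase_mul_sign {i j : K} {s : Finset K} (hi : i ∈ s) (hj : j ∈ s) (h : i ≠ j) :
    sign i (s.erase j) * sign j s = - (sign j (s.erase i) * sign i s) := by
  rcases lt_or_gt_of_ne h with h | h
  · rw [sign_erase_of_lt h, sign_erase_of_gt hi h]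
    ring
  · rw [sign_erase_of_lt h, sign_erase_of_gt hj h]
    ring

theorem coboundary_coboundary (f : Finset K → M) : coboundary (coboundary f) = 0 := by
  funext s
  simp only [coboundary, Finset.smul_sum, smul_smul]
  rw [Finset.sum_sigma']
  refine Finset.sum_involution (fun x _ ↦ ⟨x.2, x.1⟩) ?_ ?_ ?_ ?_
  · rintro ⟨j, i⟩ h
    simp only [Finset.mem_sigma, Finset.mem_erase] at h
    rw [Finset.erase_right_comm (a := i), ← add_smul, mul_comm, mul_comm (sign i s),
      sign_erase_mul_sign h.2.2 h.1 h.2.1, neg_add_cancel, zero_smul]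
  · rintro ⟨j, i⟩ h - heq
    simp only [Finset.mem_sigma, Finset.mem_erase] at h
    exact h.2.1 (Sigma.mk.inj_iff.1 heq).1
  · rintro ⟨j, i⟩ h
    simp only [Finset.mem_sigma, Finset.mem_erase] at h ⊢
    exact ⟨h.2.2, h.2.1.symm, h.1⟩
  · rintro ⟨j, i⟩ h
    rfl

/-- A cocycle on the finite subsets of a finite poset with meets that vanishes on the chains is the
coboundary of a cochain that vanishes on the chains. The values may be constrained to subgroups
`A s`, as long as these depend only on lower bounds of `s`. -/
theorem exists_coboundary_eq [Fintype K] {r : K → L} (hr : Function.Injective r)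
    (hinf : ∀ c : Finset K, c.Nonempty → ∃ v, IsGLB (r '' c) (r v))
    (A : Finset K → AddSubgroup M) (hA : Monotone A)
    (hA' : ∀ (s c : Finset K) (v : K), c ⊆ s → IsGLB (r '' c) (r v) → A (insert v s) ≤ A s)
    (f : Finset K → M) (hf : ∀ s, f s ∈ A s) (hf' : ∀ s, core r s = ∅ → f s = 0)
    (hdf : coboundary f = 0) :
    ∃ g : Finset K → M, (∀ s, g s ∈ A s) ∧ (∀ s, core r s = ∅ → g s = 0) ∧ coboundary g = f := by
  rcases isEmpty_or_nonempty K with _ | _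
  · refine ⟨0, fun s ↦ (A s).zero_mem, fun _ _ ↦ rfl, funext fun s ↦ ?_⟩
    rw [hf' s (Finset.eq_empty_of_isEmpty _)]
    simp [coboundary]
  -- The primitive is corrected one core size at a time. Core size zero means a chain, where the
  -- cocycle vanishes already.
  suffices H : ∀ m : ℕ, ∃ g : Finset K → M, (∀ s, g s ∈ A s) ∧ (∀ s, core r s = ∅ → g s = 0) ∧
      ∀ s, (core r s).card ≤ m → coboundary g s = f s by
    obtain ⟨g, h1, h2, h3⟩ := H (Fintype.card K)
    exact ⟨g, h1, h2, funext fun s ↦ h3 s (Finset.card_le_univ _)⟩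
  intro m
  induction m with
  | zero =>
    refine ⟨0, fun s ↦ (A s).zero_mem, fun _ _ ↦ rfl, fun s hs ↦ ?_⟩
    rw [hf' s (Finset.card_eq_zero.1 (Nat.le_zero.1 hs))]
    simp [coboundary]
  | succ m ih =>
    obtain ⟨g, hg, hg', hgf⟩ := ih
    choose! v hv using hinf
    -- the part of the cocycle that is not yet a coboundary
    set f' := f - coboundary g with hf'_def
    have hcob : ∀ s, coboundary g s ∈ A s := fun s ↦ (A s).sum_mem fun j _ ↦
      (A s).zsmul_mem (hA (Finset.erase_subset _ _) (hg _)) _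
    have hf'A : ∀ s, f' s ∈ A s := fun s ↦ (A s).sub_mem (hf s) (hcob s)
    have hf'0 : ∀ s, (core r s).card ≤ m → f' s = 0 := fun s hs ↦ by
      simp [hf'_def, hgf s hs]
    have hdf' : coboundary f' = 0 := by
      rw [hf'_def, coboundary_sub, hdf, coboundary_coboundary, sub_zero]
    classical
    -- The contraction adjoins the meet of the core. Its value stays in `A s`, since the meet of a
    -- subset of `s` does not enlarge the constraint.
    let h : Finset K → M := fun s ↦ if (core r s).card = m + 1 ∧ v (core r s) ∉ s then
      sign (v (core r s)) (insert (v (core r s)) s) • f' (insert (v (core r s)) s) else 0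
    have hglb : ∀ s, (core r s).card = m + 1 → IsGLB (r '' core r s) (r (v (core r s))) :=
      fun s hs ↦ hv _ (Finset.card_pos.1 (by omega))
    have hsmall : ∀ s, (core r s).card ≠ m + 1 → h s = 0 := fun s hs ↦ if_neg fun h ↦ hs h.1
    have hcoreErase : ∀ s, ∀ j ∈ core r s, (core r (s.erase j)).card < (core r s).card := by
      intro s j hj
      refine Finset.card_lt_card ⟨core_mono r (Finset.erase_subset _ _), fun hsub ↦ ?_⟩
      exact Finset.notMem_erase j s (core_subset _ _ (hsub hj))
    refine ⟨g + h, fun s ↦ (A s).add_mem (hg s) ?_, fun s hs ↦ ?_, fun s hs ↦ ?_⟩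
    · by_cases hc : (core r s).card = m + 1 ∧ v (core r s) ∉ s
      · simp only [h, if_pos hc]
        exact (A s).zsmul_mem (hA' s _ _ (core_subset r s) (hglb s hc.1) (hf'A _)) _
      · simp only [h, if_neg hc]
        exact (A s).zero_mem
    · rw [Pi.add_apply, hg' s hs, hsmall s (by rw [hs]; simp), add_zero]
    · rw [coboundary_add, Pi.add_apply]
      suffices hh : coboundary h s = f' s by
        rw [hh, hf'_def]
        simp
      rcases Nat.le_succ_iff.1 hs with hs | hs
      · rw [hf'0 s hs]
        refine Finset.sum_eq_zero fun j _ ↦ ?_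
        have := Finset.card_le_card (core_mono r (Finset.erase_subset j s))
        rw [hsmall _ (by omega), smul_zero]
      set x := v (core r s) with hx
      have hxglb := hglb s hs
      have hxc : x ∉ core r s := fun hc ↦ notMem_core_insert hr hxglb
        (core_mono r (Finset.subset_insert _ _) hc)
      -- If the meet lies in `s`, only its deletion contributes: deleting a core element makes the
      -- core smaller, and deleting any other element leaves the meet in the set, where `h` is zero.
      by_cases hxs : x ∈ s
      · rw [coboundary, Finset.sum_eq_single_of_mem x hxs]
        · have hce := core_erase hxc
          simp only [h]
          rw [if_pos ⟨by rw [hce, hs], by rw [hce]; exact Finset.notMem_erase _ _⟩, hce,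
            ← hx, Finset.insert_erase hxs, smul_smul, sign_mul_sign, one_smul]
        · intro j hj hjx
          by_cases hjc : j ∈ core r s
          · rw [hsmall _ (by have := hcoreErase s j hjc; omega), smul_zero]
          · simp only [h]
            rw [core_erase hjc, ← hx, if_neg, smul_zero]
            exact fun h ↦ h.2 (Finset.mem_erase.2 ⟨hjx.symm, hxs⟩)
      -- If the meet is not in `s`, the cocycle condition on `insert x s` expresses `f' s` through
      -- the other faces. Those obtained by deleting a core element vanish by induction, and the
      -- remaining ones are the values of `h`.
      · have hci := core_insert hr hxglb
        have hcl := congrFun hdf' (insert x s)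
        rw [coboundary, Finset.sum_insert hxs, Finset.erase_insert hxs, Pi.zero_apply] at hcl
        have hfs : f' s = - ∑ j ∈ s, (sign x (insert x s) * sign j (insert x s)) •
            f' ((insert x s).erase j) := by
          rw [eq_neg_iff_add_eq_zero]
          have := congrArg (sign x (insert x s) • ·) hcl
          simpa only [smul_add, smul_smul, sign_mul_sign, one_smul, Finset.smul_sum, smul_zero]
            using this
        rw [hfs, coboundary, ← Finset.sum_neg_distrib]
        refine Finset.sum_congr rfl fun j hj ↦ ?_
        have hjx : j ≠ x := fun h ↦ hxs (h ▸ hj)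
        by_cases hjc : j ∈ core r s
        · have h1 := hcoreErase s j hjc
          have h2 := hcoreErase (insert x s) j (hci.symm ▸ hjc)
          rw [hsmall _ (by omega), hf'0 _ (by rw [hci] at h2; omega), smul_zero, smul_zero, neg_zero]
        · simp only [h]
          rw [core_erase hjc, ← hx, if_pos ⟨hs, fun h ↦ hxs (Finset.mem_of_mem_erase h)⟩,
            ← Finset.erase_insert_of_ne hjx.symm, smul_smul, ← neg_smul]
          congr 1
          -- Deleting `x` and `j` in the two possible orders gives opposite signs.
          have := sign_erase_mul_sign (Finset.mem_insert_self x s) (Finset.mem_insert_of_mem hj)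
            hjx.symm
          rw [Finset.erase_insert hxs] at this
          have h1 := sign_mul_sign j (insert x s)
          have h2 := sign_mul_sign j s
          linear_combination sign j s * sign j (insert x s) * this -
            sign j s * sign x ((insert x s).erase j) * h1 -
            sign j (insert x s) * sign x (insert x s) * h2

end Acyclic

end CechSystem

/-! ### DG functors between Čech categories -/

theorem DGCategory.hIso_of_comp_eq_one (A : DGCategory.{u, v}) {X Y : A.Obj} {f : A.Hom X Y}
    {g : A.Hom Y X} (hf : f ∈ A.deg X Y 0) (hg : g ∈ A.deg Y X 0) (hdf : A.d X Y f = 0)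
    (hdg : A.d Y X g = 0) (hfg : A.comp X Y X f g = A.one X) (hgf : A.comp Y X Y g f = A.one Y) :
    A.HIso X Y := by
  refine ⟨f, g, hf, hg, hdf, hdg, ?_, ?_⟩
  · rw [hfg, sub_self]
    exact Submodule.zero_mem _
  · rw [hgf, sub_self]
    exact Submodule.zero_mem _

namespace DGFunctor

variable {A : DGCategory.{u, v}} {B : DGCategory.{w, z}} (F : DGFunctor A B)

/-- A DG functor that is surjective on morphisms, with acyclic kernel, is bijective on cohomology. -/
theorem bijective_cohomologyMap {X Y : A.Obj} (hsurj : Function.Surjective (F.map X Y))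
    (hker : ∀ f, F.map X Y f = 0 → A.d X Y f = 0 → ∃ g, F.map X Y g = 0 ∧ A.d X Y g = f) :
    Function.Bijective (F.cohomologyMap X Y) := by
  constructor
  · rw [injective_iff_map_eq_zero]
    intro c hc
    obtain ⟨⟨f, hf⟩, rfl⟩ := Submodule.Quotient.mk_surjective _ c
    rw [LinearMap.mem_ker] at hf
    have hc' := (Submodule.Quotient.mk_eq_zero _).1 hc
    obtain ⟨g', hg'⟩ : F.map X Y f ∈ LinearMap.range (B.d (F.obj X) (F.obj Y)) := hc'
    obtain ⟨g, rfl⟩ := hsurj g'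
    -- Lifting the primitive of the image leaves a cocycle in the kernel, which is exact.
    obtain ⟨k, -, hk⟩ := hker (f - A.d X Y g) (by rw [map_sub, F.map_d, hg', sub_self])
      (by rw [map_sub, hf, A.d_d, sub_zero])
    refine (Submodule.Quotient.mk_eq_zero _).2 ⟨g + k, ?_⟩
    rw [map_add, hk]
    exact add_sub_cancel _ _
  · intro c
    obtain ⟨⟨g', hg'⟩, rfl⟩ := Submodule.Quotient.mk_surjective _ c
    rw [LinearMap.mem_ker] at hg'
    obtain ⟨g, rfl⟩ := hsurj g'
    -- A lift of a cocycle need not be closed, but its differential is a cocycle of the kernel;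
    -- subtracting a primitive inside the kernel closes the lift without changing its image.
    obtain ⟨k, hk, hk'⟩ := hker (A.d X Y g) (by rw [F.map_d, hg']) (A.d_d g)
    refine ⟨Submodule.Quotient.mk ⟨g - k, ?_⟩, ?_⟩
    · rw [LinearMap.mem_ker, map_sub, hk', sub_self]
    · refine congrArg Submodule.Quotient.mk (Subtype.ext ?_)
      change F.map X Y (g - k) = F.map X Y g
      rw [map_sub, hk, sub_zero]

end DGFunctor

/-! ### Morphisms of coefficient systems and isomorphisms in Čech categories -/

namespace CechSystem

variable {K : Type}

/-- A morphism of coefficient systems for Čech complexes. -/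
structure Morphism (S : CechSystem.{u, v} K) (S' : CechSystem.{w, z} K) where
  obj : S.Obj → S'.Obj
  map : ∀ s X Y, S.Hom s X Y →ₗ[ℂ] S'.Hom s (obj X) (obj Y)
  map_res : ∀ {s t : Finset K} (h : s ⊆ t) {X Y} (f : S.Hom s X Y),
    map t X Y (S.res h X Y f) = S'.res h (obj X) (obj Y) (map s X Y f)
  map_one : ∀ s X, map s X X (S.one s X) = S'.one s (obj X)
  map_comp : ∀ {s X Y Z} (f : S.Hom s X Y) (g : S.Hom s Y Z),
    map s X Z (S.comp s X Y Z f g) = S'.comp s _ _ _ (map s X Y f) (map s Y Z g)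

variable [LinearOrder K] {S : CechSystem.{u, v} K} {S' : CechSystem.{w, z} K}

theorem Morphism.map_pull (Φ : Morphism S S') (t s : Finset K) {X Y : S.Obj}
    (f : ∀ s : Finset K, S.Hom s X Y) :
    Φ.map s X Y (pull t s X Y f) = pull t s (Φ.obj X) (Φ.obj Y) fun s ↦ Φ.map s X Y (f s) := by
  by_cases h : t ⊆ s
  · rw [pull_of_subset h, pull_of_subset h, Φ.map_res]
  · simp [pull, h]

/-- The map of Čech cochains induced by a morphism of coefficient systems. -/
def Morphism.cochainMap (Φ : Morphism S S') (X Y : S.Obj) :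
    S.cochains X Y →ₗ[ℂ] S'.cochains (Φ.obj X) (Φ.obj Y) :=
  (LinearMap.pi fun s ↦ Φ.map s X Y ∘ₗ LinearMap.proj s).restrict fun f hf ↦ by
    change Φ.map ∅ X Y (f ∅) = 0
    rw [show f ∅ = 0 from hf, map_zero]

theorem Morphism.map_dFun (Φ : Morphism S S') {X Y : S.Obj} (f : ∀ s : Finset K, S.Hom s X Y)
    (s : Finset K) : Φ.map s X Y (dFun X Y f s) = dFun _ _ (fun s ↦ Φ.map s X Y (f s)) s := by
  rw [dFun_apply, dFun_apply, map_sum]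
  exact Finset.sum_congr rfl fun j _ ↦ by rw [map_zsmul, Φ.map_pull]

theorem Morphism.map_oneFun (Φ : Morphism S S') (X : S.Obj) (s : Finset K) :
    Φ.map s X X (oneFun X s) = oneFun (Φ.obj X) s := by
  rw [oneFun, oneFun]
  split_ifs
  · exact Φ.map_one s X
  · exact map_zero _

theorem Morphism.map_compFun (Φ : Morphism S S') {X Y Z : S.Obj} (f : ∀ s : Finset K, S.Hom s X Y)
    (g : ∀ s : Finset K, S.Hom s Y Z) (s : Finset K) : Φ.map s X Z (compFun X Y Z f g s) =
      compFun _ _ _ (fun s ↦ Φ.map s X Y (f s)) (fun s ↦ Φ.map s Y Z (g s)) s := by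
  rw [compFun_apply, compFun_apply, map_sum]
  exact Finset.sum_congr rfl fun j _ ↦ by rw [Φ.map_comp, Φ.map_pull, Φ.map_pull]

theorem Morphism.cochainMap_mem (Φ : Morphism S S') {X Y : S.Obj} {p : ℤ} {f : S.cochains X Y}
    (hf : f ∈ S.degree X Y p) : Φ.cochainMap X Y f ∈ S'.degree (Φ.obj X) (Φ.obj Y) p := by
  intro s hs
  change Φ.map s X Y (f.1 s) = 0
  rw [hf s hs, map_zero]

/-- The DG functor induced by a morphism of coefficient systems. -/
def Morphism.toDGFunctor [Fintype K] (Φ : Morphism S S') : DGFunctor S.cech S'.cech where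
  obj := Φ.obj
  map X Y := Φ.cochainMap X Y
  map_mem hf := Φ.cochainMap_mem hf
  map_d f := Subtype.ext <| funext fun s ↦ Φ.map_dFun f.1 s
  map_one X := Subtype.ext <| funext fun s ↦ Φ.map_oneFun X s
  map_comp f g := Subtype.ext <| funext fun s ↦ Φ.map_compFun f.1 g.1 s

/-- The Leibniz rule for $1\cdot1=1$ in degree zero reads $d1=d1+d1$. -/
theorem dFun_oneFun (X : S.Obj) : dFun X X (oneFun (S := S) X) = 0 := by
  have h0 : oneFun (S := S) X ∅ = 0 := if_neg (by simp)
  have := leibnizFun (S := S) (X := X) (Y := X) (Z := X) 0 (oneFun X) (oneFun X) h0 h0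
    (fun s hs ↦ if_neg (by omega))
  rw [oneFun_compFun _ h0, oneFun_compFun _ (by simp [dFun_apply]),
    compFun_oneFun _ (by simp [dFun_apply])] at this
  simpa using this

/-- Compatible isomorphisms over all `O_s` give an isomorphism in the cohomology category. -/
theorem hIso_of_inverse [Fintype K] {X Y : S.Obj} (a : ∀ s, S.Hom s X Y) (b : ∀ s, S.Hom s Y X)
    (ha : ∀ {s t : Finset K} (h : s ⊆ t), S.res h X Y (a s) = a t)
    (hb : ∀ {s t : Finset K} (h : s ⊆ t), S.res h Y X (b s) = b t)
    (hab : ∀ s, S.comp s X Y X (a s) (b s) = S.one s X)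
    (hba : ∀ s, S.comp s Y X Y (b s) (a s) = S.one s Y) : S.cech.HIso X Y := by
  -- the cochain with components `a` on the members of the cover
  let R : ∀ {X Y : S.Obj} (_ : ∀ s, S.Hom s X Y), ∀ s : Finset K, S.Hom s X Y :=
    fun a s ↦ if s.card = 1 then a s else 0
  -- Each such cochain is the unit cochain followed by a globally compatible family. Closedness and
  -- the composition law then reduce to those of the unit cochain.
  have hR : ∀ {X Y : S.Obj} (a : ∀ s, S.Hom s X Y) s, R a s = S.comp s X X Y (oneFun X s) (a s) := by
    intro X Y a s
    by_cases h : s.card = 1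
    · simp [R, oneFun, h, S.one_comp]
    · simp [R, oneFun, h]
  have hpull : ∀ {X Y : S.Obj} (a : ∀ s, S.Hom s X Y)
      (_ : ∀ {s t : Finset K} (h : s ⊆ t), S.res h X Y (a s) = a t) {t s : Finset K} (_ : t ⊆ s),
      pull t s X Y (R a) = S.comp s X X Y (pull t s X X (oneFun X)) (a s) := by
    intro X Y a ha t s h
    rw [pull_of_subset h, pull_of_subset h, hR, S.res_comp, ha]
  have hd : ∀ {X Y : S.Obj} (a : ∀ s, S.Hom s X Y)
      (_ : ∀ {s t : Finset K} (h : s ⊆ t), S.res h X Y (a s) = a t), dFun X Y (R a) = 0 := by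
    intro X Y a ha
    funext s
    have h1 := congrArg (fun x ↦ S.comp s X X Y x (a s)) (congrFun (dFun_oneFun (S := S) X) s)
    simp only [dFun_apply, map_sum, LinearMap.sum_apply, map_zsmul, LinearMap.smul_apply,
      Pi.zero_apply, map_zero, LinearMap.zero_apply] at h1
    rw [dFun_apply, Pi.zero_apply, ← h1]
    exact Finset.sum_congr rfl fun j _ ↦ by rw [hpull a ha (Finset.erase_subset _ _)]
  have hcomp : ∀ {X Y : S.Obj} (a : ∀ s, S.Hom s X Y) (b : ∀ s, S.Hom s Y X)
      (_ : ∀ {s t : Finset K} (h : s ⊆ t), S.res h X Y (a s) = a t)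
      (_ : ∀ {s t : Finset K} (h : s ⊆ t), S.res h Y X (b s) = b t)
      (_ : ∀ s, S.comp s X Y X (a s) (b s) = S.one s X),
      compFun X Y X (R a) (R b) = oneFun X := by
    intro X Y a b ha hb hab
    have h0 : oneFun (S := S) X ∅ = 0 := if_neg (by simp)
    rw [← oneFun_compFun (S := S) (oneFun X) h0]
    funext s
    rw [compFun_apply, compFun_apply]
    refine Finset.sum_congr rfl fun j _ ↦ ?_
    rw [hpull a ha (Finset.filter_subset _ _), S.assoc, hpull b hb (Finset.filter_subset _ _),
      pull_oneFun (Finset.filter_subset _ _), pull_oneFun (Finset.filter_subset _ _),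
      pull_oneFun (Finset.filter_subset _ _)]
    congr 1
    split_ifs
    · rw [S.one_comp, hab]
    · simp
  have h0 : ∀ {X Y : S.Obj} (a : ∀ s, S.Hom s X Y), R a ∅ = 0 := fun a ↦ if_neg (by simp)
  exact S.cech.hIso_of_comp_eq_one (X := X) (Y := Y) (f := ⟨R a, h0 a⟩) (g := ⟨R b, h0 b⟩)
    (fun s hs ↦ if_neg (by omega)) (fun s hs ↦ if_neg (by omega)) (Subtype.ext (hd a ha))
    (Subtype.ext (hd b hb)) (Subtype.ext (hcomp a b ha hb hab)) (Subtype.ext (hcomp b a hb ha hba))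

end CechSystem

/-! ### Geometry of smooth polytopes -/

namespace PolytopeData

variable {n : ℕ} (P : PolytopeData n)

theorem height_add (i : P.Facet) (x y : Fin n → ℝ) :
    P.height i (x + y) = P.height i x + P.height i y := by
  simp [height, add_mul, Finset.sum_add_distrib]

theorem height_smul (i : P.Facet) (c : ℝ) (x : Fin n → ℝ) :
    P.height i (c • x) = c * P.height i x := by
  simp [height, Finset.mul_sum, mul_assoc]

theorem continuous_height (i : P.Facet) : Continuous (P.height i) := by
  unfold height
  fun_prop

theorem height_sum {ι : Type*} (s : Finset ι) (i : P.Facet) (x : ι → Fin n → ℝ) :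
    P.height i (∑ j ∈ s, x j) = ∑ j ∈ s, P.height i (x j) := by
  classical
  induction s using Finset.induction_on with
  | empty => simp [height]
  | insert j s hj ih => rw [Finset.sum_insert hj, Finset.sum_insert hj, height_add, ih]

/-- The lattice distance `a_i - ⟪x, ν_i⟫` from the hyperplane of the facet `i`. -/
def slack (i : P.Facet) (x : Fin n → ℝ) : ℝ := P.offset i - P.height i x

theorem mem_body {x : Fin n → ℝ} : x ∈ P.body ↔ ∀ i, 0 ≤ P.slack i x := by
  simp [body, slack]

theorem mem_active {x : Fin n → ℝ} {i : P.Facet} : i ∈ P.active x ↔ P.slack i x = 0 := by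
  simp only [active, slack, Finset.mem_filter, Finset.mem_univ, true_and]
  constructor <;> intro h <;> linarith

theorem mem_facet {x : Fin n → ℝ} {i : P.Facet} : x ∈ P.facet i ↔ x ∈ P.body ∧ P.slack i x = 0 := by
  refine and_congr_right fun _ ↦ ?_
  rw [slack]
  constructor <;> intro h <;> linarith

theorem slack_add_smul (i : P.Facet) (x v : Fin n → ℝ) (c : ℝ) :
    P.slack i (x + c • v) = P.slack i x - c * P.height i v := by
  rw [slack, slack, height_add, height_smul]
  ring

theorem slack_combo (i : P.Facet) (x y : Fin n → ℝ) {a b : ℝ} (h : a + b = 1) :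
    P.slack i (a • x + b • y) = a • P.slack i x + b • P.slack i y := by
  rw [slack, slack, slack, height_add, height_smul, height_smul, smul_eq_mul, smul_eq_mul]
  linear_combination (-(P.offset i : ℝ)) * h

theorem continuous_slack (i : P.Facet) : Continuous (P.slack i) :=
  continuous_const.sub (P.continuous_height i)

end PolytopeData

namespace SmoothPolytope

variable {n : ℕ} (P : SmoothPolytope n)

/-- The normals through a cell are part of a basis of $\mathbb Z^n$. A linear form with prescribed
values on them, and zero on the other basis vectors, is the pairing with a lattice vector. -/
theorem exists_pair_eq (σ : P.Face) (c : P.Facet → ℤ) :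
    ∃ u : Fin n → ℤ, ∀ i ∈ σ.1, P.pair u i = c i := by
  classical
  obtain ⟨x, hx, hxσ⟩ := σ.2
  obtain ⟨b, e, hb⟩ := P.smooth x hx
  let φ : (Fin n → ℤ) →ₗ[ℤ] ℤ := b.constr ℤ fun k ↦
    if h : ∃ i : P.active x, e i = k then c h.choose else 0
  refine ⟨fun k ↦ φ (Pi.single k 1), fun i hi ↦ ?_⟩
  have hi' : i ∈ P.active x := hxσ ▸ hi
  have h1 : P.pair (fun k ↦ φ (Pi.single k 1)) i = φ (P.normal i) := by
    rw [LinearMap.pi_apply_eq_sum_univ φ (P.normal i), pair]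
    refine Finset.sum_congr rfl fun k _ ↦ ?_
    rw [smul_eq_mul, mul_comm]
    congr 2
    ext j
    simp [Pi.single_apply, eq_comm]
  have hex : ∃ j : P.active x, e j = e ⟨i, hi'⟩ := ⟨_, rfl⟩
  rw [h1, hb ⟨i, hi'⟩, Module.Basis.constr_basis, dif_pos hex, e.injective hex.choose_spec]

theorem height_intCast (u : Fin n → ℤ) (i : P.Facet) :
    P.height i (fun k ↦ (u k : ℝ)) = P.pair u i := by
  simp [PolytopeData.height, pair]

theorem exists_height_eq (σ : P.Face) (c : P.Facet → ℝ) :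
    ∃ v : Fin n → ℝ, ∀ i ∈ σ.1, P.height i v = c i := by
  classical
  choose u hu using fun j : P.Facet ↦ P.exists_pair_eq σ (Pi.single j 1)
  refine ⟨∑ j ∈ σ.1, c j • (fun k ↦ (u j k : ℝ)), fun i hi ↦ ?_⟩
  rw [PolytopeData.height_sum, Finset.sum_eq_single_of_mem i hi]
  · rw [PolytopeData.height_smul, height_intCast, hu i i hi]
    simp
  · intro j _ hj
    rw [PolytopeData.height_smul, height_intCast, hu j i hi, Pi.single_eq_of_ne hj.symm]
    simp

theorem active_mem_face {x : Fin n → ℝ} (hx : x ∈ P.body) : ∃ τ : P.Face, τ.1 = P.active x :=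
  ⟨⟨P.active x, x, hx, rfl⟩, rfl⟩

/-- A point of the cell `τ` can be moved so that the distances from the facets through it have given
ratios, and the distances from the other facets are much larger. -/
theorem exists_slack_eq (τ : P.Face) (c : P.Facet → ℝ) (C : ℝ) :
    ∃ ε > 0, ∃ y, (∀ i ∈ τ.1, P.slack i y = ε * c i) ∧ ∀ i ∉ τ.1, ε * C < P.slack i y := by
  obtain ⟨x, hx, hxτ⟩ := τ.2
  -- Moving by $\varepsilon v$ raises the distance from facet $i$ through the cell from $0$ to
  -- $\varepsilon c_i$. The other distances start positive, so they exceed $\varepsilon C$ for small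
  -- $\varepsilon$.
  obtain ⟨v, hv⟩ := P.exists_height_eq τ fun i ↦ - c i
  have hev : ∀ᶠ ε in nhdsWithin (0 : ℝ) (Set.Ioi 0), ∀ i : P.Facet, i ∉ τ.1 →
      ε * C < P.slack i (x + ε • v) := by
    rw [Filter.eventually_all]
    intro i
    by_cases hi : i ∈ τ.1
    · exact Filter.Eventually.of_forall fun _ h ↦ absurd hi h
    · have hpos : 0 < P.slack i x := by
        refine lt_of_le_of_ne (P.mem_body.1 hx i) fun h ↦ hi ?_
        rw [← hxτ]
        exact P.mem_active.2 h.symm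
      have hcont : Continuous fun ε : ℝ ↦ P.slack i (x + ε • v) - ε * C :=
        ((P.continuous_slack i).comp (by fun_prop)).sub (by fun_prop)
      have := (hcont.tendsto 0).eventually (lt_mem_nhds (a := 0) (by simpa using hpos))
      filter_upwards [nhdsWithin_le_nhds this] with ε hε _
      linarith
  obtain ⟨ε, hε, hε0⟩ := (hev.and self_mem_nhdsWithin).exists
  refine ⟨ε, hε0, x + ε • v, fun i hi ↦ ?_, hε⟩
  have : P.slack i x = 0 := by
    rw [← P.mem_active, hxτ]
    exact hi
  rw [PolytopeData.slack_add_smul, hv i hi, this]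
  ring

/-- Independence of the normals allows one to leave any chosen facets through a cell while staying
on the others: distances $0$ on `I` and $\varepsilon$ on the rest of the facets of `τ`. -/
theorem exists_face_of_subset (τ : P.Face) {I : Finset P.Facet} (h : I ⊆ τ.1) :
    ∃ ρ : P.Face, ρ.1 = I := by
  classical
  obtain ⟨ε, hε, y, hy, hy'⟩ := P.exists_slack_eq τ (fun i ↦ if i ∈ I then 0 else 1) 0
  refine ⟨⟨I, y, P.mem_body.2 fun i ↦ ?_, ?_⟩, rfl⟩
  · by_cases hi : i ∈ τ.1
    · rw [hy i hi]
      split_ifs <;> simp [hε.le]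
    · have := hy' i hi
      rw [mul_zero] at this
      exact this.le
  · ext i
    rw [P.mem_active]
    by_cases hi : i ∈ τ.1
    · rw [hy i hi]
      by_cases hI : i ∈ I <;> simp [hI, hε.ne']
    · have := hy' i hi
      rw [mul_zero] at this
      exact ⟨fun h ↦ absurd h this.ne', fun hI ↦ absurd (h hI) hi⟩

/-- The meet of two cells, whose closure is the smallest closed cell containing both. -/
instance instSemilatticeInfFace : SemilatticeInf P.Face where
  inf σ τ := (P.exists_inter σ τ).choose
  inf_le_left σ τ _ hi := (((P.exists_inter σ τ).choose_spec _).1 hi).1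
  inf_le_right σ τ _ hi := (((P.exists_inter σ τ).choose_spec _).1 hi).2
  le_inf _ τ κ h h' _ hi := ((P.exists_inter τ κ).choose_spec _).2 ⟨h hi, h' hi⟩

theorem mem_inf {σ τ : P.Face} {i : P.Facet} : i ∈ (σ ⊓ τ).1 ↔ i ∈ σ.1 ∧ i ∈ τ.1 :=
  (P.exists_inter σ τ).choose_spec i

instance instFiniteFace : Finite P.Face :=
  inferInstanceAs (Finite {I : Finset P.Facet // ∃ x ∈ P.body, P.active x = I})

/-- The closest facets of points in this set are those through the cell `τ`. -/
def dualCover (τ : P.Face) : Set (Fin n → ℝ) :=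
  {x ∈ P.body | ∀ j ∉ τ.1, 0 < P.slack j x ∧ ∀ i ∈ τ.1, P.slack i x < P.slack j x}

theorem convex_dualCover (τ : P.Face) : Convex ℝ (P.dualCover τ) := by
  intro x hx y hy a b ha hb hab
  refine ⟨P.mem_body.2 fun i ↦ ?_, fun j hj ↦ ⟨?_, fun i hi ↦ ?_⟩⟩
  · rw [P.slack_combo i x y hab]
    exact convex_Ici (0 : ℝ) (Set.mem_Ici.2 <| P.mem_body.1 hx.1 i) (P.mem_body.1 hy.1 i) ha hb hab
  · rw [P.slack_combo j x y hab]
    exact convex_Ioi (0 : ℝ) (Set.mem_Ioi.2 (hx.2 j hj).1) (hy.2 j hj).1 ha hb hab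
  · have h := convex_Ioi (0 : ℝ) (sub_pos.2 ((hx.2 j hj).2 i hi)) (sub_pos.2 ((hy.2 j hj).2 i hi))
      ha hb hab
    rw [P.slack_combo j x y hab, P.slack_combo i x y hab, ← sub_pos]
    refine (Set.mem_Ioi.1 h).trans_eq ?_
    simp only [smul_eq_mul]
    ring

-- Near a point of the largest `κ` in the chain, the distance from facet $i$ is taken proportional
-- to the number of $\tau\in s$ that $i$ does not contain. For $i\in\tau$ and $j\notin\tau$, the
-- members of the chain that miss $i$ are strictly fewer than those that miss $j$, as $\tau$ itself
-- misses only $j$. A facet that contains all the cells gets distance zero.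
open Classical in
theorem exists_mem_dualCover (s : Finset P.Face) (hs : s.Nonempty)
    (hc : IsChain (· ≤ ·) (s : Set P.Face)) :
    ∃ x ∈ ⋂ τ ∈ s, P.dualCover τ, x ∈ P.body ∧ ∀ i, (∀ τ ∈ s, i ∈ τ.1) → P.slack i x = 0 := by
  obtain ⟨κ, hκ, hmax⟩ : ∃ κ ∈ s, ∀ τ ∈ s, τ ≤ κ := by
    obtain ⟨κ, hκ⟩ := s.exists_maximal hs
    exact ⟨κ, hκ.1, fun τ hτ ↦ (hc.total hτ hκ.1).elim id (hκ.2 hτ)⟩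
  obtain ⟨ε, hε, x, hx, hx'⟩ := P.exists_slack_eq κ
    (fun i ↦ ((s.filter fun τ : P.Face ↦ i ∉ τ.1).card : ℝ)) s.card
  have hbody : x ∈ P.body := P.mem_body.2 fun i ↦ by
    by_cases hi : i ∈ κ.1
    · rw [hx i hi]
      positivity
    · exact (by positivity : (0 : ℝ) ≤ ε * s.card).trans (hx' i hi).le
  refine ⟨x, ?_, hbody, fun i hi ↦ ?_⟩
  · simp only [Set.mem_iInter]
    refine fun τ hτ ↦ ⟨hbody, fun j hj ↦ ?_⟩
    have key : ∀ i ∈ τ.1, P.slack i x < P.slack j x := by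
      intro i hi
      rw [hx i (hmax τ hτ hi)]
      by_cases hjκ : j ∈ κ.1
      · rw [hx j hjκ]
        refine mul_lt_mul_of_pos_left (Nat.cast_lt.2 (Finset.card_lt_card ⟨fun ρ hρ ↦ ?_, fun h ↦ ?_⟩)) hε
        · rw [Finset.mem_filter] at hρ ⊢
          refine ⟨hρ.1, fun hjρ ↦ ?_⟩
          rcases hc.total hτ hρ.1 with h | h
          · exact hρ.2 (h hi)
          · exact hj (h hjρ)
        · exact (Finset.mem_filter.1 (h (Finset.mem_filter.2 ⟨hτ, hj⟩))).2 hi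
      · refine lt_of_le_of_lt ?_ (hx' j hjκ)
        exact mul_le_mul_of_nonneg_left (Nat.cast_le.2 (Finset.card_filter_le _ _)) hε.le
    refine ⟨?_, key⟩
    by_cases hjκ : j ∈ κ.1
    · rw [hx j hjκ]
      exact mul_pos hε (Nat.cast_pos.2 (Finset.card_pos.2 ⟨τ, Finset.mem_filter.2 ⟨hτ, hj⟩⟩))
    · exact (by positivity : (0 : ℝ) ≤ ε * s.card).trans_lt (hx' j hjκ)
  · rw [hx i (hi κ hκ), Finset.filter_false_of_mem fun τ hτ h ↦ h (hi τ hτ)]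
    simp

/-- A point lies in the member of its own cell. Two incomparable cells would give facets with both
slack $i$ < slack $j$ and slack $j$ < slack $i$, so only chains have nonempty intersections; these
are convex, hence connected. -/
theorem isCellularCover_dualCover : P.IsCellularCover P.dualCover where
  isOpen τ := by
    refine ⟨⋂ j ∈ (Set.toFinite {j | j ∉ τ.1}).toFinset, ({x | 0 < P.slack j x} ∩
      ⋂ i ∈ τ.1, {x | P.slack i x < P.slack j x}), ?_, ?_⟩
    · refine isOpen_biInter_finset fun j _ ↦ IsOpen.inter ?_ (isOpen_biInter_finset fun i _ ↦ ?_)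
      · exact isOpen_lt continuous_const (P.continuous_slack j)
      · exact isOpen_lt (P.continuous_slack i) (P.continuous_slack j)
    · ext x
      simp [dualCover, and_comm]
  covers x hx := by
    obtain ⟨τ, hτ⟩ := P.active_mem_face hx
    refine ⟨τ, hx, fun j hj ↦ ?_⟩
    have hpos : 0 < P.slack j x := by
      refine lt_of_le_of_ne (P.mem_body.1 hx j) fun h ↦ hj ?_
      rw [hτ]
      exact P.mem_active.2 h.symm
    refine ⟨hpos, fun i hi ↦ ?_⟩
    rw [hτ] at hi
    rwa [P.mem_active.1 hi]
  subset_openStar τ x hx := by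
    refine ⟨hx.1, fun i hi ↦ ?_⟩
    by_contra h
    exact (hx.2 i h).1.ne' (P.mem_active.1 hi)
  nonempty_iff s hs := by
    refine ⟨?_, fun hc ↦ ?_⟩
    · rintro ⟨x, hx⟩ σ hσ τ hτ -
      simp only [Set.mem_iInter] at hx
      by_contra h
      rw [not_or] at h
      obtain ⟨i, hi, hi'⟩ := Finset.not_subset.1 (show ¬ σ.1 ⊆ τ.1 from h.1)
      obtain ⟨j, hj, hj'⟩ := Finset.not_subset.1 (show ¬ τ.1 ⊆ σ.1 from h.2)
      exact lt_asymm (((hx σ hσ).2 j hj').2 i hi) (((hx τ hτ).2 i hi').2 j hj)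
    · obtain ⟨x, hx, -⟩ := P.exists_mem_dualCover s hs hc
      exact ⟨x, hx⟩
  isPreconnected s _ := (convex_iInter₂ fun τ _ ↦ P.convex_dualCover τ).isPreconnected
  meets_facet s hs hc i hi := by
    obtain ⟨x, hx, hb, hx'⟩ := P.exists_mem_dualCover s hs hc
    exact ⟨x, hx, P.mem_facet.2 ⟨hb, hx' i hi⟩⟩

/-- Every cell has a vertex in its closure: a cell that lies on `n` facets. -/
theorem exists_vertex (σ : P.Face) : ∃ τ : P.Face, σ ≤ τ ∧
    ∃ (b : Module.Basis (Fin n) ℤ (Fin n → ℤ)) (e : τ.1 ≃ Fin n), ∀ i : τ.1, P.normal i = b (e i) := by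
  obtain ⟨τ, hστ, hτ⟩ := Finite.exists_le_maximal (p := fun _ : P.Face ↦ True) (a := σ) trivial
  refine ⟨τ, hστ, ?_⟩
  obtain ⟨x, hx, hxτ⟩ := τ.2
  obtain ⟨b, e, hb⟩ := P.smooth x hx
  suffices hsurj : Function.Surjective e by
    have hτx : τ.1 = P.active x := hxτ.symm
    rw [hτx]
    exact ⟨b, Equiv.ofBijective e ⟨e.injective, hsurj⟩, hb⟩
  -- A missed basis vector leaves a nonzero direction along which no facet through the cell is left.
  -- The linear form that grows in this direction would have no maximum on the closed cell, which is
  -- compact.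
  by_contra hsurj
  obtain ⟨k, hk⟩ := not_forall.1 hsurj
  -- a lattice vector parallel to the cell
  obtain ⟨u, hu, hu0⟩ : ∃ u : Fin n → ℤ, (∀ i ∈ P.active x, P.pair u i = 0) ∧ u ≠ 0 := by
    have hsum : ∀ v, b.coord k v = ∑ l, b.coord k (Pi.single l 1) * v l := fun v ↦ by
      rw [LinearMap.pi_apply_eq_sum_univ (b.coord k) v]
      refine Finset.sum_congr rfl fun l _ ↦ ?_
      rw [smul_eq_mul, mul_comm]
      congr 2
      ext j
      simp [Pi.single_apply, eq_comm]
    refine ⟨fun l ↦ b.coord k (Pi.single l 1), fun i hi ↦ ?_, fun h ↦ ?_⟩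
    · rw [pair, ← hsum, hb ⟨i, hi⟩]
      have : e ⟨i, hi⟩ ≠ k := fun h ↦ hk ⟨_, h⟩
      simp [this]
    · have h1 := hsum (b k)
      simp [funext_iff] at h
      simp [h] at h1
  set v : Fin n → ℝ := fun l ↦ (u l : ℝ) with hv
  have hvh : ∀ i ∈ τ.1, P.height i v = 0 := fun i hi ↦ by
    rw [hv, height_intCast, hu i (hxτ ▸ hi), Int.cast_zero]
  have hcomp : IsCompact ({y ∈ P.body | ∀ i ∈ τ.1, P.slack i y = 0}) := by
    refine Metric.isCompact_of_isClosed_isBounded ?_ (P.bounded.subset fun y hy ↦ hy.1)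
    have h1 : IsClosed P.body := by
      have : P.body = ⋂ i, {y | P.height i y ≤ P.offset i} := by
        ext y
        simp [PolytopeData.body]
      rw [this]
      exact isClosed_iInter fun i ↦ isClosed_le (P.continuous_height i) continuous_const
    refine h1.inter ?_
    have : {y | ∀ i ∈ τ.1, P.slack i y = 0} = ⋂ i ∈ τ.1, {y | P.slack i y = 0} := by
      ext y
      simp
    rw [show ((fun y ↦ ∀ i ∈ τ.1, P.slack i y = 0) : Set (Fin n → ℝ)) = _ from this]
    exact isClosed_biInter fun i _ ↦ isClosed_eq (P.continuous_slack i) continuous_const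
  have hne : ({y ∈ P.body | ∀ i ∈ τ.1, P.slack i y = 0}).Nonempty :=
    ⟨x, hx, fun i hi ↦ P.mem_active.1 (hxτ ▸ hi)⟩
  obtain ⟨y, ⟨hy, hyτ⟩, hmax⟩ := hcomp.exists_isMaxOn hne
    (f := fun y ↦ ∑ l, v l * y l) (by fun_prop)
  -- the maximum is attained in the open cell, where one can move further
  have hyact : ∀ i, P.slack i y = 0 → i ∈ τ.1 := by
    obtain ⟨ρ, hρ⟩ := P.active_mem_face hy
    have hle : τ ≤ ρ := fun i hi ↦ by
      rw [hρ]
      exact P.mem_active.2 (hyτ i hi)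
    intro i hi
    refine hτ.2 trivial hle ?_
    rw [hρ]
    exact P.mem_active.2 hi
  have hev : ∀ᶠ ε in nhdsWithin (0 : ℝ) (Set.Ioi 0), ∀ i : P.Facet, 0 ≤ P.slack i (y + ε • v) := by
    rw [Filter.eventually_all]
    intro i
    by_cases hi : i ∈ τ.1
    · refine Filter.Eventually.of_forall fun ε ↦ ?_
      rw [PolytopeData.slack_add_smul, hvh i hi, hyτ i hi]
      simp
    · have hpos : 0 < P.slack i y :=
        lt_of_le_of_ne (P.mem_body.1 hy i) fun h ↦ hi (hyact i h.symm)
      have hcont : Continuous fun ε : ℝ ↦ P.slack i (y + ε • v) :=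
        (P.continuous_slack i).comp (by fun_prop)
      have := (hcont.tendsto 0).eventually (lt_mem_nhds (a := 0) (by simpa using hpos))
      filter_upwards [nhdsWithin_le_nhds this] with ε hε using hε.le
  obtain ⟨ε, hε, hε0⟩ := (hev.and self_mem_nhdsWithin).exists
  have hle : ∑ l, v l * (y + ε • v) l ≤ ∑ l, v l * y l := by
    refine hmax ⟨P.mem_body.2 hε, fun i hi ↦ ?_⟩
    rw [PolytopeData.slack_add_smul, hvh i hi, hyτ i hi]
    simp
  have hexp : ∑ l, v l * (y + ε • v) l = ∑ l, v l * y l + ε * ∑ l, v l ^ 2 := by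
    rw [Finset.mul_sum, ← Finset.sum_add_distrib]
    refine Finset.sum_congr rfl fun l _ ↦ ?_
    simp only [Pi.add_apply, Pi.smul_apply, smul_eq_mul]
    ring
  obtain ⟨l, hl⟩ := Function.ne_iff.1 hu0
  have hpos : 0 < ∑ l, v l ^ 2 := Finset.sum_pos' (fun _ _ ↦ sq_nonneg _)
    ⟨l, Finset.mem_univ _, by have : v l ≠ 0 := Int.cast_ne_zero.2 hl; positivity⟩
  have := mul_pos (Set.mem_Ioi.1 hε0) hpos
  linarith

end SmoothPolytope

/-! ### Frames of line bundles on schemes -/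

namespace AlgebraicGeometry.Scheme

variable {X : Scheme.{0}}

variable (X) in
/-- The restriction of functions to a smaller open set. -/
def resFun {V V' : X.Opens} (h : V' ≤ V) : Γ(X, V) →+* Γ(X, V') :=
  (X.presheaf.map (homOfLE h).op).hom

theorem resFun_resFun {V V' V'' : X.Opens} (h : V' ≤ V) (h' : V'' ≤ V') (f : Γ(X, V)) :
    X.resFun h' (X.resFun h f) = X.resFun (h'.trans h) f := by
  have := X.presheaf.map_comp (homOfLE h).op (homOfLE h').op
  exact (ConcreteCategory.congr_hom this f).symm

theorem resFun_refl {V : X.Opens} (f : Γ(X, V)) : X.resFun le_rfl f = f := by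
  have := X.presheaf.map_id (Opposite.op V)
  exact ConcreteCategory.congr_hom this f

theorem eq_of_resFun_eq {ι : Type*} {V : X.Opens} (U : ι → X.Opens) (hU : ∀ i, U i ≤ V)
    (hV : V ≤ ⨆ i, U i) {f g : Γ(X, V)} (h : ∀ i, X.resFun (hU i) f = X.resFun (hU i) g) : f = g :=
  X.sheaf.eq_of_locally_eq' U V (fun i ↦ homOfLE (hU i)) hV f g h

theorem exists_resFun_eq {ι : Type*} {V : X.Opens} (U : ι → X.Opens) (hU : ∀ i, U i ≤ V)
    (hV : V ≤ ⨆ i, U i) (f : ∀ i, Γ(X, U i))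
    (h : ∀ i j, X.resFun (inf_le_left : U i ⊓ U j ≤ U i) (f i) =
      X.resFun (inf_le_right : U i ⊓ U j ≤ U j) (f j)) :
    ∃ g : Γ(X, V), ∀ i, X.resFun (hU i) g = f i :=
  (X.sheaf.existsUnique_gluing' U V (fun i ↦ homOfLE (hU i)) hV f h).exists

namespace Modules

variable (L : X.Modules)

theorem resSec_smul_resFun {V V' : X.Opens} (h : V' ≤ V) (f : Γ(X, V)) (e : Γ(L, V)) :
    L.resSec h (f • e) = X.resFun h f • L.resSec h e :=
  L.resSec_smul h f e

theorem resSec_resSec {V V' V'' : X.Opens} (h : V' ≤ V) (h' : V'' ≤ V') (e : Γ(L, V)) :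
    L.resSec h' (L.resSec h e) = L.resSec (h'.trans h) e := by
  have := L.presheaf.map_comp (homOfLE h).op (homOfLE h').op
  exact (ConcreteCategory.congr_hom this e).symm

theorem resSec_refl {V : X.Opens} (e : Γ(L, V)) : L.resSec le_rfl e = e := by
  have := L.presheaf.map_id (Opposite.op V)
  exact ConcreteCategory.congr_hom this e

theorem eq_of_resSec_eq {ι : Type*} {V : X.Opens} (U : ι → X.Opens) (hU : ∀ i, U i ≤ V)
    (hV : V ≤ ⨆ i, U i) {e e' : Γ(L, V)} (h : ∀ i, L.resSec (hU i) e = L.resSec (hU i) e') :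
    e = e' :=
  TopCat.Sheaf.eq_of_locally_eq' ⟨L.presheaf, L.isSheaf⟩ U V (fun i ↦ homOfLE (hU i)) hV e e' h

theorem exists_resSec_eq {ι : Type*} {V : X.Opens} (U : ι → X.Opens) (hU : ∀ i, U i ≤ V)
    (hV : V ≤ ⨆ i, U i) (e : ∀ i, Γ(L, U i))
    (h : ∀ i j, L.resSec (inf_le_left : U i ⊓ U j ≤ U i) (e i) =
      L.resSec (inf_le_right : U i ⊓ U j ≤ U j) (e j)) :
    ∃ g : Γ(L, V), ∀ i, L.resSec (hU i) g = e i :=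
  (TopCat.Sheaf.existsUnique_gluing' ⟨L.presheaf, L.isSheaf⟩ U V (fun i ↦ homOfLE (hU i)) hV
    e h).exists

variable {L}

namespace IsGenerator

theorem resSec {V V' : X.Opens} {e : Γ(L, V)} (he : L.IsGenerator e) (h : V' ≤ V) :
    L.IsGenerator (L.resSec h e) := by
  intro V'' h'
  have := he V'' (h'.trans h)
  simpa only [resSec_resSec] using this

theorem bijective {V : X.Opens} {e : Γ(L, V)} (he : L.IsGenerator e) :
    Function.Bijective fun f : Γ(X, V) ↦ f • e := by
  simpa only [resSec_refl] using he V le_rfl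

theorem smul_cancel {V : X.Opens} {e : Γ(L, V)} (he : L.IsGenerator e) {f g : Γ(X, V)}
    (h : f • e = g • e) : f = g := he.bijective.1 h

theorem exists_smul_eq {V : X.Opens} {e : Γ(L, V)} (he : L.IsGenerator e) (s : Γ(L, V)) :
    ∃ f : Γ(X, V), s = f • e := by
  obtain ⟨f, hf⟩ := he.bijective.2 s
  exact ⟨f, hf.symm⟩

theorem unit_smul {V : X.Opens} {e : Γ(L, V)} (he : L.IsGenerator e) {f : Γ(X, V)} (hf : IsUnit f) :
    L.IsGenerator (f • e) := by
  intro V' h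
  have hf' : IsUnit (X.resFun h f) := hf.map _
  have : (fun g : Γ(X, V') ↦ g • L.resSec h (f • e)) =
      (fun g : Γ(X, V') ↦ g • L.resSec h e) ∘ fun g ↦ g * X.resFun h f := by
    funext g
    rw [resSec_smul_resFun, smul_smul]
    rfl
  rw [this]
  refine (he V' h).comp ?_
  obtain ⟨w, hw⟩ := hf'
  rw [← hw]
  exact (Units.mulRight_bijective w)

theorem exists_unit_smul_eq {V : X.Opens} {e e' : Γ(L, V)} (he : L.IsGenerator e)
    (he' : L.IsGenerator e') : ∃ f : Γ(X, V), IsUnit f ∧ e' = f • e := by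
  obtain ⟨f, hf⟩ := he.exists_smul_eq e'
  obtain ⟨g, hg⟩ := he'.exists_smul_eq e
  refine ⟨f, IsUnit.of_mul_eq_one g (he'.smul_cancel ?_), hf⟩
  rw [one_smul, mul_smul, ← hg, ← hf]

/-- Functions and sections of `L` both form sheaves, so coefficients with respect to `e` exist and
are unique as soon as they do so locally. -/
theorem of_locally {ι : Type*} {V : X.Opens} {e : Γ(L, V)} (U : ι → X.Opens) (hU : ∀ i, U i ≤ V)
    (hV : V ≤ ⨆ i, U i) (h : ∀ i, L.IsGenerator (L.resSec (hU i) e)) : L.IsGenerator e := by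
  intro V' hV'
  have hcov : V' ≤ ⨆ i, U i ⊓ V' := by
    rw [← iSup_inf_eq]
    exact le_inf (hV'.trans hV) le_rfl
  have hgen : ∀ (W : X.Opens) (hW : W ≤ V) (i : ι), W ≤ U i → L.IsGenerator (L.resSec hW e) := by
    intro W hW i hi
    have := (h i).resSec hi
    rwa [resSec_resSec] at this
  constructor
  · intro f g hfg
    refine eq_of_resFun_eq (fun i ↦ U i ⊓ V') (fun i ↦ inf_le_right) hcov fun i ↦ ?_
    refine (hgen (U i ⊓ V') (inf_le_right.trans hV') i inf_le_left).smul_cancel ?_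
    have := congrArg (L.resSec (inf_le_right : U i ⊓ V' ≤ V')) hfg
    simpa only [resSec_smul_resFun, resSec_resSec] using this
  · intro s
    choose f hf using fun i ↦ (hgen (U i ⊓ V') (inf_le_right.trans hV') i
      inf_le_left).exists_smul_eq (L.resSec (inf_le_right : U i ⊓ V' ≤ V') s)
    obtain ⟨g, hg⟩ := exists_resFun_eq (fun i ↦ U i ⊓ V') (fun i ↦ inf_le_right) hcov f
      fun i j ↦ by
        refine (hgen (U i ⊓ V' ⊓ (U j ⊓ V')) (inf_le_left.trans (inf_le_right.trans hV')) i
          (inf_le_left.trans inf_le_left)).smul_cancel ?_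
        have h1 := congrArg (L.resSec (inf_le_left : U i ⊓ V' ⊓ (U j ⊓ V') ≤ _)) (hf i)
        have h2 := congrArg (L.resSec (inf_le_right : U i ⊓ V' ⊓ (U j ⊓ V') ≤ _)) (hf j)
        simp only [resSec_smul_resFun, resSec_resSec] at h1 h2
        rw [← h1, ← h2]
    refine ⟨g, L.eq_of_resSec_eq (fun i ↦ U i ⊓ V') (fun i ↦ inf_le_right) hcov fun i ↦ ?_⟩
    rw [resSec_smul_resFun, hg i, resSec_resSec, hf i]

end IsGenerator

end Modules

/-! ### Functions as rational functions on an integral scheme -/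

section Integral

variable [IsIntegral X]

theorem genericPoint_mem {V : X.Opens} {x : X} (hx : x ∈ V) : genericPoint X ∈ V :=
  ((genericPoint_spec X).mem_open_set_iff V.isOpen).2 ⟨x, trivial, hx⟩

variable (X) in
/-- The rational function defined by a function on a nonempty open set. -/
def rat {V : X.Opens} (hV : genericPoint X ∈ V) : Γ(X, V) →+* X.functionField :=
  (X.presheaf.germ V (genericPoint X) hV).hom

theorem rat_injective {V : X.Opens} (hV : genericPoint X ∈ V) : Function.Injective (X.rat hV) :=
  germ_injective_of_isIntegral _ _ hV

theorem rat_resFun {V V' : X.Opens} (hV' : genericPoint X ∈ V') (h : V' ≤ V) (f : Γ(X, V)) :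
    X.rat hV' (X.resFun h f) = X.rat (h hV') f :=
  X.presheaf.germ_res_apply (homOfLE h) _ hV' f

theorem resFun_injective {V V' : X.Opens} (hV' : genericPoint X ∈ V') (h : V' ≤ V) :
    Function.Injective (X.resFun h) := by
  intro f g hfg
  refine rat_injective (h hV') ?_
  rw [← rat_resFun hV' h, hfg, rat_resFun]

theorem exists_pow_mul_rat {V V' : X.Opens} (hV : IsAffineOpen V) (f : Γ(X, V)) (h : V' ≤ V)
    (hV' : genericPoint X ∈ V') (hf : V' = X.basicOpen f) (w : Γ(X, V')) :
    ∃ (k : ℕ) (r : Γ(X, V)), X.rat (h hV') r = X.rat (h hV') f ^ k * X.rat hV' w := by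
  let _ := (X.resFun h).toAlgebra
  have : IsLocalization.Away f Γ(X, V') := hV.isLocalization_of_eq_basicOpen f (homOfLE h) hf
  obtain ⟨k, r, hr⟩ := IsLocalization.Away.surj f w
  refine ⟨k, r, ?_⟩
  have := congrArg (X.rat hV') hr
  rw [map_mul, map_pow] at this
  change X.rat hV' w * X.rat hV' (X.resFun h f) ^ k = X.rat hV' (X.resFun h r) at this
  rw [rat_resFun, rat_resFun] at this
  rw [← this, mul_comm]

end Integral

end AlgebraicGeometry.Scheme

/-! ### Triviality of line bundles on the spectrum of a factorial ring, and orders -/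

/-- Used for local-to-global arguments: the ring elements that make a statement true form an ideal,
and it suffices that a power of every $f$ in the cover lies in it. -/
theorem Ideal.eq_top_of_forall_pow_mem {R : Type*} [CommRing R] {I : Ideal R} {t : Set R}
    (ht : Ideal.span t = ⊤) (h : ∀ f ∈ t, ∃ k : ℕ, f ^ k ∈ I) : I = ⊤ := by
  rw [← Ideal.radical_eq_top, eq_top_iff, ← ht, Ideal.span_le]
  exact h

/-- Cocycles of units on a finite affine cover are coboundaries if the class group is trivial. Here
`O f` stands for the functions on the basic open set of `f`. -/
theorem exists_common_generator {R K : Type*} [CommRing R] [IsDomain R] [Field K] [Algebra R K]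
    [IsFractionRing R K] [Subsingleton (ClassGroup R)] (t : Finset R)
    (ht : Ideal.span (t : Set R) = ⊤) (O : R → Subring K)
    (hO : ∀ f ∈ t, ∀ r : R, algebraMap R K r ∈ O f)
    (hO' : ∀ f ∈ t, ∀ x ∈ O f, ∃ (k : ℕ) (r : R), algebraMap R K r = algebraMap R K f ^ k * x)
    (hinv : ∀ f ∈ t, (algebraMap R K f)⁻¹ ∈ O f) (hne : ∀ f ∈ t, f ≠ 0)
    (g : R → K) (hg : ∀ f ∈ t, g f ≠ 0)
    (htrans : ∀ f ∈ t, ∀ f' ∈ t, ∃ k : ℕ, algebraMap R K f ^ k * (g f / g f') ∈ O f')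
    (htrans' : ∀ f ∈ t, ∀ f' ∈ t, ∃ k : ℕ, algebraMap R K f ^ k * (g f' / g f) ∈ O f') :
    ∃ γ : K, γ ≠ 0 ∧ ∀ f ∈ t, γ / g f ∈ O f ∧ g f / γ ∈ O f := by
  classical
  -- If `g f` is the frame over the basic open set of `f` divided by a reference section, then `M`
  -- consists of the global sections as multiples of that reference, and `N` plays the same role for
  -- the dual bundle.
  let M : Submodule R K :=
    { carrier := {a | ∀ f ∈ t, a / g f ∈ O f}
      add_mem' := fun ha hb f hf ↦ by rw [add_div]; exact (O f).add_mem (ha f hf) (hb f hf)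
      zero_mem' := fun f _ ↦ by rw [zero_div]; exact (O f).zero_mem
      smul_mem' := fun r a ha f hf ↦ by
        rw [Algebra.smul_def, mul_div_assoc]
        exact (O f).mul_mem (hO f hf r) (ha f hf) }
  let N : Submodule R K :=
    { carrier := {a | ∀ f ∈ t, a * g f ∈ O f}
      add_mem' := fun ha hb f hf ↦ by rw [add_mul]; exact (O f).add_mem (ha f hf) (hb f hf)
      zero_mem' := fun f _ ↦ by rw [zero_mul]; exact (O f).zero_mem
      smul_mem' := fun r a ha f hf ↦ by
        rw [Algebra.smul_def, mul_assoc]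
        exact (O f).mul_mem (hO f hf r) (ha f hf) }
  have hpowmono : ∀ f' ∈ t, ∀ (f : R) (x : K) (k l : ℕ), k ≤ l → algebraMap R K f ^ k * x ∈ O f' →
      algebraMap R K f ^ l * x ∈ O f' := by
    intro f' hf' f x k l hkl h
    rw [← Nat.sub_add_cancel hkl, pow_add, mul_assoc, ← map_pow]
    exact (O f').mul_mem (hO f' hf' _) h
  -- A local frame becomes a global section after multiplication by a power of `f` that works
  -- against all the finitely many other members of the cover.
  have hM : ∀ f ∈ t, ∃ k : ℕ, algebraMap R K f ^ k * g f ∈ M := by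
    intro f hf
    choose! k hk using htrans f hf
    refine ⟨t.sup k, fun f' hf' ↦ ?_⟩
    rw [mul_div_assoc]
    exact hpowmono f' hf' f _ (k f') _ (Finset.le_sup hf') (hk f' hf')
  have hN : ∀ f ∈ t, ∃ k : ℕ, algebraMap R K f ^ k * (g f)⁻¹ ∈ N := by
    intro f hf
    choose! k hk using htrans' f hf
    refine ⟨t.sup k, fun f' hf' ↦ ?_⟩
    rw [mul_assoc, inv_mul_eq_div]
    exact hpowmono f' hf' f _ (k f') _ (Finset.le_sup hf') (hk f' hf')
  -- Both inclusions are checked locally, by exhibiting a power of each `f` in the ideal of elements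
  -- for which they hold.
  have hMN : M * N = 1 := by
    apply le_antisymm
    · rw [Submodule.mul_le]
      intro a ha b hb
      let I : Ideal R := (1 : Submodule R K).comap (LinearMap.toSpanSingleton R K (a * b))
      have hI : I = ⊤ := by
        refine Ideal.eq_top_of_forall_pow_mem ht fun f hf ↦ ?_
        have hab : a * b ∈ O f := by
          have := (O f).mul_mem (ha f hf) (hb f hf)
          rwa [show a / g f * (b * g f) = a * b by field_simp [hg f hf]] at this
        obtain ⟨k, r, hr⟩ := hO' f hf _ hab
        refine ⟨k, Submodule.mem_one.2 ⟨r, ?_⟩⟩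
        rw [LinearMap.toSpanSingleton_apply, Algebra.smul_def, map_pow, hr]
      have h1 : (1 : R) ∈ I := hI ▸ Submodule.mem_top
      have h2 : (1 : R) • (a * b) ∈ (1 : Submodule R K) := h1
      rwa [one_smul] at h2
    · let I : Ideal R := (M * N).comap (Algebra.linearMap R K)
      have hI : I = ⊤ := by
        refine Ideal.eq_top_of_forall_pow_mem ht fun f hf ↦ ?_
        obtain ⟨k, hk⟩ := hM f hf
        obtain ⟨l, hl⟩ := hN f hf
        refine ⟨k + l, ?_⟩
        change algebraMap R K (f ^ (k + l)) ∈ M * N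
        rw [show algebraMap R K (f ^ (k + l)) =
          (algebraMap R K f ^ k * g f) * (algebraMap R K f ^ l * (g f)⁻¹) by
            rw [map_pow, pow_add]
            field_simp [hg f hf]]
        exact Submodule.mul_mem_mul hk hl
      rw [Submodule.one_le]
      have h1 : (1 : R) ∈ I := hI ▸ Submodule.mem_top
      have h2 : algebraMap R K 1 ∈ M * N := h1
      rwa [map_one] at h2
  -- So `M` is an invertible fractional ideal, and principal as the class group is trivial; its
  -- generator is the global frame.
  let Mu : (Submodule R K)ˣ := ⟨M, N, hMN, by rw [mul_comm, hMN]⟩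
  let J : (FractionalIdeal (nonZeroDivisors R) K)ˣ :=
    FractionalIdeal.unitsMulEquivSubmodule.symm Mu
  have hJ : M.IsPrincipal := ClassGroup.isPrincipal_coeSubmodule_of_isUnit (R := R) (K := K) J.1
    J.isUnit
  obtain ⟨γ, hγ⟩ := hJ.principal
  have hγ0 : γ ≠ 0 := by
    rintro rfl
    rw [hγ, Submodule.span_zero_singleton, Submodule.bot_mul] at hMN
    have h1 : (1 : K) ∈ (1 : Submodule R K) := Submodule.one_le.1 le_rfl
    rw [← hMN] at h1
    exact one_ne_zero ((Submodule.mem_bot R).1 h1)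
  refine ⟨γ, hγ0, fun f hf ↦ ⟨(hγ ▸ Submodule.mem_span_singleton_self γ : γ ∈ M) f hf, ?_⟩⟩
  -- Some $f^k g_f$ is in `M`, hence a multiple of $\gamma$; since $f$ is invertible in `O f`, the
  -- quotient $g_f/\gamma$ lies there too.
  obtain ⟨k, hk⟩ := hM f hf
  rw [hγ, Submodule.mem_span_singleton] at hk
  obtain ⟨r, hr⟩ := hk
  have hf0 : algebraMap R K f ≠ 0 := by
    rw [Ne, IsFractionRing.to_map_eq_zero_iff]
    exact hne f hf
  rw [Algebra.smul_def] at hr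
  have : g f / γ = algebraMap R K r * ((algebraMap R K f)⁻¹) ^ k := by
    rw [inv_pow]
    field_simp
    linear_combination -hr
  rw [this]
  exact (O f).mul_mem (hO f hf r) ((O f).pow_mem (hinv f hf) k)

/-! ### Frames on factorial affine open sets, and uniqueness of orders -/

namespace AlgebraicGeometry.Scheme

variable {X : Scheme.{0}} [IsIntegral X]

theorem isUnit_of_rat_mul_eq_one {V : X.Opens} (hV : genericPoint X ∈ V) {f g : Γ(X, V)}
    (h : X.rat hV f * X.rat hV g = 1) : IsUnit f :=
  IsUnit.of_mul_eq_one g (rat_injective hV (by rw [map_mul, h, map_one]))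

namespace Modules

variable {L : X.Modules}

/-- Line bundles are trivial on an affine open subset for which the class group of the coordinate ring
is trivial. -/
theorem IsInvertible.exists_isGenerator (hL : L.IsInvertible) {U : X.Opens} (hU : IsAffineOpen U)
    [Nonempty U] [Subsingleton (ClassGroup Γ(X, U))] : ∃ e : Γ(L, U), L.IsGenerator e := by
  classical
  obtain ⟨x₀⟩ := id ‹Nonempty U›
  have hη : genericPoint X ∈ U := genericPoint_mem x₀.2
  -- a finite cover by basic open sets with frames
  let S : Set Γ(X, U) := {f | ∃ e : Γ(L, X.basicOpen f), L.IsGenerator e}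
  have hS : Ideal.span S = ⊤ := by
    rw [← hU.self_le_iSup_basicOpen_iff]
    intro x hx
    obtain ⟨V, e, hxV, he⟩ := hL x
    obtain ⟨f, hfV, hxf⟩ := hU.exists_basicOpen_le ⟨x, hxV⟩ hx
    exact Opens.mem_iSup.2 ⟨⟨f, L.resSec hfV e, he.resSec hfV⟩, hxf⟩
  obtain ⟨t', ht'S, ht'⟩ := (Ideal.span_eq_top_iff_finite S).1 hS
  -- Discarding zero keeps the cover and puts the generic point into each basic open set.
  let t := t'.erase 0
  have ht : Ideal.span (t : Set Γ(X, U)) = ⊤ := by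
    rw [← ht', Finset.coe_erase, Ideal.span_sdiff_singleton_zero]
  have hne : ∀ f ∈ t, f ≠ 0 := fun f hf ↦ Finset.ne_of_mem_erase hf
  have hmem : ∀ f ∈ t, genericPoint X ∈ X.basicOpen f := by
    intro f hf
    rw [X.mem_basicOpen _ _ hη]
    have h0 : X.rat hη f ≠ 0 := fun h ↦ hne f hf (rat_injective hη (h.trans (map_zero _).symm))
    exact (Ne.isUnit h0 :)
  have hgen : ∀ f ∈ t, ∃ e : Γ(L, X.basicOpen f), L.IsGenerator e :=
    fun f hf ↦ ht'S (Finset.mem_of_mem_erase hf)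
  choose! e he using hgen
  -- the frames as rational multiples of a fixed one
  obtain ⟨f₀, hf₀⟩ : t.Nonempty := by
    rw [Finset.nonempty_iff_ne_empty]
    intro h
    rw [h, Finset.coe_empty, Ideal.span_empty] at ht
    exact bot_ne_top ht
  have hw : ∀ f ∈ t, ∃ w : Γ(X, X.basicOpen f ⊓ X.basicOpen f₀), IsUnit w ∧
      L.resSec inf_le_left (e f) = w • L.resSec inf_le_right (e f₀) := fun f hf ↦
    ((he f₀ hf₀).resSec inf_le_right).exists_unit_smul_eq ((he f hf).resSec inf_le_left)
  choose! w hwu hw using hw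
  let g : Γ(X, U) → X.functionField := fun f ↦
    if hf : f ∈ t then X.rat (show _ ∈ X.basicOpen f ⊓ X.basicOpen f₀ from
      ⟨hmem f hf, hmem f₀ hf₀⟩) (w f) else 1
  have hgw : ∀ f (hf : f ∈ t), g f = X.rat (show _ ∈ X.basicOpen f ⊓ X.basicOpen f₀ from
      ⟨hmem f hf, hmem f₀ hf₀⟩) (w f) := fun f hf ↦ dif_pos hf
  have hg : ∀ f ∈ t, g f ≠ 0 := fun f hf ↦ by
    rw [hgw f hf]
    exact ((hwu f hf).map _).ne_zero
  -- The transition functions are quotients of the `g f`, as seen by comparing both frames with the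
  -- reference frame on the triple intersection.
  have htr : ∀ f (hf : f ∈ t), ∀ f' (hf' : f' ∈ t),
      ∃ v : Γ(X, X.basicOpen f ⊓ X.basicOpen f'),
        L.resSec inf_le_left (e f) = v • L.resSec inf_le_right (e f') ∧
        X.rat (show _ ∈ X.basicOpen f ⊓ X.basicOpen f' from ⟨hmem f hf, hmem f' hf'⟩) v =
          g f / g f' := by
    intro f hf f' hf'
    obtain ⟨v, -, hv⟩ := ((he f' hf').resSec
      (inf_le_right : X.basicOpen f ⊓ X.basicOpen f' ≤ _)).exists_unit_smul_eq
      ((he f hf).resSec inf_le_left)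
    refine ⟨v, hv, ?_⟩
    rw [eq_div_iff (hg f' hf'), hgw f hf, hgw f' hf']
    let W := X.basicOpen f ⊓ X.basicOpen f' ⊓ X.basicOpen f₀
    have hW : genericPoint X ∈ W := ⟨⟨hmem f hf, hmem f' hf'⟩, hmem f₀ hf₀⟩
    have h1 : W ≤ X.basicOpen f ⊓ X.basicOpen f₀ := inf_le_inf_right _ inf_le_left
    have h2 : W ≤ X.basicOpen f' ⊓ X.basicOpen f₀ := inf_le_inf_right _ inf_le_right
    have h3 : W ≤ X.basicOpen f ⊓ X.basicOpen f' := inf_le_left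
    rw [← rat_resFun hW h1, ← rat_resFun hW h2, ← rat_resFun hW h3, ← map_mul]
    congr 1
    refine ((he f₀ hf₀).resSec (inf_le_right : W ≤ _)).smul_cancel ?_
    have e1 := congrArg (L.resSec h1) (hw f hf)
    have e2 := congrArg (L.resSec h2) (hw f' hf')
    have e3 := congrArg (L.resSec h3) hv
    simp only [resSec_smul_resFun, resSec_resSec] at e1 e2 e3
    rw [mul_smul, ← e2, ← e3, ← e1]
  -- solve the cocycle condition
  have : IsFractionRing Γ(X, U) X.functionField :=
    functionField_isFractionRing_of_isAffineOpen X U hU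
  have halg : ∀ r, algebraMap Γ(X, U) X.functionField r = X.rat hη r := fun _ ↦ rfl
  -- The functions on the basic open set, viewed as rational functions. The value off `t` plays no
  -- role.
  let O : Γ(X, U) → Subring X.functionField := fun f ↦
    if hf : f ∈ t then (X.rat (hmem f hf)).range else ⊤
  have hO : ∀ f (hf : f ∈ t), O f = (X.rat (hmem f hf)).range := fun f hf ↦ dif_pos hf
  obtain ⟨γ, hγ0, hγ⟩ := exists_common_generator (K := X.functionField) t ht O
    (fun f hf r ↦ by
      rw [hO f hf, halg]
      exact ⟨X.resFun (X.basicOpen_le f) r, rat_resFun _ _ _⟩)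
    (fun f hf x hx ↦ by
      rw [hO f hf] at hx
      obtain ⟨w, rfl⟩ := hx
      exact exists_pow_mul_rat hU f (X.basicOpen_le f) (hmem f hf) rfl w)
    (fun f hf ↦ by
      rw [hO f hf, halg]
      have hu : IsUnit (X.resFun (X.basicOpen_le f) f) :=
        RingedSpace.isUnit_res_basicOpen X.toLocallyRingedSpace.toRingedSpace f
      obtain ⟨v, hv⟩ := hu.exists_right_inv
      refine ⟨v, ?_⟩
      have := congrArg (X.rat (hmem f hf)) hv
      rw [map_mul, map_one, rat_resFun] at this
      exact eq_inv_of_mul_eq_one_right this)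
    hne g hg
    (fun f hf f' hf' ↦ by
      obtain ⟨v, -, hv⟩ := htr f hf f' hf'
      obtain ⟨k, r, hr⟩ := exists_pow_mul_rat (hU.basicOpen f')
        (X.resFun (X.basicOpen_le f') f) inf_le_right
        (show _ ∈ X.basicOpen f ⊓ X.basicOpen f' from ⟨hmem f hf, hmem f' hf'⟩)
        ((inf_comm _ _).trans (X.basicOpen_res _ _).symm) v
      refine ⟨k, ?_⟩
      rw [hO f' hf', halg, ← hv]
      refine ⟨r, hr.trans ?_⟩
      rw [rat_resFun])
    (fun f hf f' hf' ↦ by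
      obtain ⟨v, -, hv⟩ := htr f' hf' f hf
      obtain ⟨k, r, hr⟩ := exists_pow_mul_rat (hU.basicOpen f')
        (X.resFun (X.basicOpen_le f') f) inf_le_left
        (show _ ∈ X.basicOpen f' ⊓ X.basicOpen f from ⟨hmem f' hf', hmem f hf⟩)
        (X.basicOpen_res _ _).symm v
      refine ⟨k, ?_⟩
      rw [hO f' hf', halg, ← hv]
      refine ⟨r, hr.trans ?_⟩
      rw [rat_resFun])
  -- glue the modified frames
  have hc : ∀ f : t, ∃ c : Γ(X, X.basicOpen f.1), IsUnit c ∧ X.rat (hmem f f.2) c = γ / g f := by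
    rintro ⟨f, hf⟩
    obtain ⟨h1, h2⟩ := hγ f hf
    rw [hO f hf] at h1 h2
    obtain ⟨c, hc⟩ := h1
    obtain ⟨d, hd⟩ := h2
    refine ⟨c, isUnit_of_rat_mul_eq_one (hmem f hf) (g := d) ?_, hc⟩
    rw [hc, hd]
    field_simp [hg f hf]
  choose c hcu hc using hc
  have hcover : U ≤ ⨆ f : t, X.basicOpen f.1 := hU.self_le_iSup_basicOpen_iff.2 ht
  obtain ⟨s, hs⟩ := L.exists_resSec_eq (fun f : t ↦ X.basicOpen f.1) (fun f ↦ X.basicOpen_le f.1)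
    hcover (fun f ↦ c f • e f) fun f f' ↦ by
      obtain ⟨v, hv, hv'⟩ := htr f f.2 f' f'.2
      rw [resSec_smul_resFun, resSec_smul_resFun, hv, smul_smul]
      congr 1
      refine rat_injective (show _ ∈ X.basicOpen f.1 ⊓ X.basicOpen f'.1 from
        ⟨hmem f f.2, hmem f' f'.2⟩) ?_
      rw [map_mul, rat_resFun, rat_resFun, hv', hc, hc]
      have := hg f f.2
      field_simp
  refine ⟨s, IsGenerator.of_locally (fun f : t ↦ X.basicOpen f.1) (fun f ↦ X.basicOpen_le f.1)
    hcover fun f ↦ ?_⟩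
  rw [hs]
  exact (he f f.2).unit_smul (hcu f)

/-- The order of a section along a point of codimension one is unique. -/
theorem HasOrderAt.unique {T : X.Opens} (hT : genericPoint X ∈ T) {s : Γ(L, T)} {η : X} {m m' : ℤ}
    (hη : IsLocalRing.maximalIdeal (X.presheaf.stalk η) ≠ ⊥) (h : L.HasOrderAt s η m)
    (h' : L.HasOrderAt s η m') : m = m' := by
  obtain ⟨V, hV, e, ϖ, w, a, b, he, hw, hϖ, rfl, heq⟩ := h
  obtain ⟨V', hV', e', ϖ', w', a', b', he', hw', hϖ', rfl, heq'⟩ := h'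
  have hWη : η ∈ V ⊓ V' := ⟨hV, hV'⟩
  obtain ⟨u, hu, hue⟩ := (he.resSec (inf_le_left : V ⊓ V' ≤ V)).exists_unit_smul_eq
    (he'.resSec inf_le_right)
  let W := V ⊓ V' ⊓ T
  have hW : genericPoint X ∈ W := ⟨genericPoint_mem hWη, hT⟩
  have hWV : W ≤ V := inf_le_left.trans inf_le_left
  have hWV' : W ≤ V' := inf_le_left.trans inf_le_right
  obtain ⟨f, hf⟩ := (he.resSec hWV).exists_smul_eq (L.resSec (inf_le_right : W ≤ T) s)
  change X.resFun inf_le_left (ϖ ^ a) • _ = X.resFun inf_le_left (w * ϖ ^ b) • _ at heq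
  change X.resFun inf_le_left (ϖ' ^ a') • _ = X.resFun inf_le_left (w' * ϖ' ^ b') • _ at heq'
  have h1 := congrArg (L.resSec (inf_le_inf_right T inf_le_left : W ≤ V ⊓ T)) heq
  have h2 := congrArg (L.resSec (inf_le_inf_right T inf_le_right : W ≤ V' ⊓ T)) heq'
  have h3 := congrArg (L.resSec (inf_le_left : W ≤ V ⊓ V')) hue
  simp only [resSec_smul_resFun, resSec_resSec, resFun_resFun] at h1 h2 h3
  rw [hf, smul_smul] at h1 h2
  rw [h3, smul_smul] at h2
  replace h1 := (he.resSec hWV).smul_cancel h1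
  replace h2 := (he.resSec hWV).smul_cancel h2
  -- Cross multiplication removes the coefficient `f` of the section, which is only regular on the
  -- part inside `T`. What is left is an identity of functions on all of `V ⊓ V'`, so it can be read
  -- in the stalk at `η`.
  have key : X.resFun (inf_le_left : V ⊓ V' ≤ V) (w * ϖ ^ b) *
      X.resFun (inf_le_right : V ⊓ V' ≤ V') (ϖ' ^ a') =
      X.resFun (inf_le_left : V ⊓ V' ≤ V) (ϖ ^ a) *
        (X.resFun (inf_le_right : V ⊓ V' ≤ V') (w' * ϖ' ^ b') * u) := by
    refine resFun_injective hW inf_le_left ?_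
    simp only [map_mul (X.resFun (inf_le_left : W ≤ V ⊓ V')), resFun_resFun]
    rw [← h1, ← h2]
    ring
  have hgerm := congrArg (X.presheaf.germ (V ⊓ V') η hWη).hom key
  have hgV : ∀ x : Γ(X, V), (X.presheaf.germ (V ⊓ V') η hWη).hom (X.resFun inf_le_left x) =
      (X.presheaf.germ V η hV).hom x := fun x ↦
    X.presheaf.germ_res_apply (homOfLE inf_le_left) _ hWη x
  have hgV' : ∀ x : Γ(X, V'), (X.presheaf.germ (V ⊓ V') η hWη).hom (X.resFun inf_le_right x) =
      (X.presheaf.germ V' η hV').hom x := fun x ↦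
    X.presheaf.germ_res_apply (homOfLE inf_le_right) _ hWη x
  simp only [map_mul, map_pow, hgV, hgV'] at hgerm
  set p := (X.presheaf.germ V η hV).hom ϖ with hp
  set p' := (X.presheaf.germ V' η hV').hom ϖ' with hp'
  have hspan : Ideal.span {p} = Ideal.span {p'} := hϖ.symm.trans hϖ'
  have hass : Associated p p' := Ideal.span_singleton_eq_span_singleton.1 hspan
  have hp0 : p ≠ 0 := fun h ↦ hη (hϖ.trans (by rw [← Ideal.span_singleton_eq_bot.2 h]))
  have hpu : ¬ IsUnit p := fun h ↦ (IsLocalRing.maximalIdeal.isMaximal _).ne_top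
    (hϖ.trans (Ideal.span_singleton_eq_top.2 h))
  -- The uniformizers are associated and the other factors are units, so $p^{b+a'}$ and $p^{a+b'}$
  -- are associated; as $p$ is neither zero nor a unit, the exponents agree.
  have hA : Associated (p ^ (b + a')) (p ^ (a + b')) := by
    have e1 : Associated (p ^ (b + a')) (p ^ b * p' ^ a') := by
      rw [pow_add]
      exact (Associated.refl _).mul_mul (hass.pow_pow)
    have e2 : Associated (p ^ (a + b')) (p ^ a * p' ^ b') := by
      rw [pow_add]
      exact (Associated.refl _).mul_mul (hass.pow_pow)
    have e3 : Associated (p ^ b * p' ^ a') (p ^ a * p' ^ b') := by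
      have hwg := hw.map (X.presheaf.germ V η hV).hom
      have hwg' := hw'.map (X.presheaf.germ V' η hV').hom
      have hug := hu.map (X.presheaf.germ (V ⊓ V') η hWη).hom
      have l1 := associated_unit_mul_left (p ^ b * p' ^ a') _ hwg
      have l2 := associated_unit_mul_left (p ^ a * p' ^ b') _ (hwg'.mul hug)
      refine l1.symm.trans (Associated.trans (Associated.of_eq ?_) l2)
      rw [← mul_assoc, hgerm]
      ring
    exact e1.trans (e3.trans e2.symm)
  have hle1 := (pow_dvd_pow_iff hp0 hpu).1 hA.dvd
  have hle2 := (pow_dvd_pow_iff hp0 hpu).1 hA.symm.dvd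
  omega

end Modules

end AlgebraicGeometry.Scheme

/-! ### Charts of the toric variety -/

namespace AddMonoidAlgebra

variable {k G : Type*} [Field k] [AddCommGroup G] [TwoUniqueSums G]

/-- The units of a group algebra of a torsion-free group are the monomials. -/
theorem exists_eq_single_of_isUnit {p : AddMonoidAlgebra k G} (hp : IsUnit p) :
    ∃ (u : G) (c : k), c ≠ 0 ∧ p = single u c := by
  obtain ⟨q, hpq⟩ := hp.exists_right_inv
  have hp0 : p ≠ 0 := by
    rintro rfl
    rw [zero_mul] at hpq
    exact zero_ne_one hpq
  have hq0 : q ≠ 0 := by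
    rintro rfl
    rw [mul_zero] at hpq
    exact zero_ne_one hpq
  have hcp : 0 < p.coeff.support.card := by
    rw [Finset.card_pos, Finsupp.support_nonempty_iff]
    simpa using hp0
  have hcq : 0 < q.coeff.support.card := by
    rw [Finset.card_pos, Finsupp.support_nonempty_iff]
    simpa using hq0
  -- If one factor had two terms, two different exponents would arise from unique pairs of terms.
  -- Both would then occur in $pq=1$ with nonzero coefficient.
  have hcard : p.coeff.support.card * q.coeff.support.card ≤ 1 := by
    by_contra hlt
    obtain ⟨a, ha, b, hb, hab, hua, hub⟩ :=
      TwoUniqueSums.uniqueAdd_of_one_lt_card (not_le.1 hlt)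
    rw [Finset.mem_product] at ha hb
    have hca : (p * q).coeff (a.1 + a.2) ≠ 0 := by
      rw [coeff_mul_add_of_uniqueAdd hua]
      exact mul_ne_zero (Finsupp.mem_support_iff.1 ha.1) (Finsupp.mem_support_iff.1 ha.2)
    have hcb : (p * q).coeff (b.1 + b.2) ≠ 0 := by
      rw [coeff_mul_add_of_uniqueAdd hub]
      exact mul_ne_zero (Finsupp.mem_support_iff.1 hb.1) (Finsupp.mem_support_iff.1 hb.2)
    have h0 : ∀ g, (p * q).coeff g ≠ 0 → g = 0 := by
      intro g hg
      by_contra hne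
      rw [hpq, one_def, coeff_single, Finsupp.single_eq_of_ne hne] at hg
      exact hg rfl
    have hsum : b.1 + b.2 = a.1 + a.2 := (h0 _ hcb).trans (h0 _ hca).symm
    obtain ⟨h1, h2⟩ := hua hb.1 hb.2 hsum
    exact hab (Prod.ext h1 h2).symm
  have hone : p.coeff.support.card = 1 := by
    have := Nat.le_mul_of_pos_right p.coeff.support.card hcq
    omega
  obtain ⟨u, c, hc, h⟩ := Finsupp.card_support_eq_one'.1 hone
  exact ⟨u, c, hc, AddMonoidAlgebra.ext h⟩

end AddMonoidAlgebra

namespace SmoothPolytope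

variable {n : ℕ} (P : SmoothPolytope n)

/-- The inclusion of the coordinate ring of a chart into the Laurent polynomials. -/
def toLaurent (σ : P.Face) : P.chartRing σ →+* AddMonoidAlgebra ℂ (Fin n → ℤ) :=
  AddMonoidAlgebra.mapDomainRingHom ℂ (P.dualMonoid σ).subtype

theorem toLaurent_single (σ : P.Face) (u : P.dualMonoid σ) (c : ℂ) :
    P.toLaurent σ (AddMonoidAlgebra.single u c) = AddMonoidAlgebra.single u.1 c :=
  AddMonoidAlgebra.mapDomain_single

theorem toLaurent_injective (σ : P.Face) : Function.Injective (P.toLaurent σ) :=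
  AddMonoidAlgebra.mapDomain_injective Subtype.val_injective

theorem exists_toLaurent_eq_iff {σ : P.Face} {p : AddMonoidAlgebra ℂ (Fin n → ℤ)} :
    (∃ a, P.toLaurent σ a = p) ↔ ∀ u, p.coeff u ≠ 0 → u ∈ P.dualMonoid σ := by
  constructor
  · rintro ⟨a, rfl⟩ u hu
    by_contra h
    refine hu ?_
    change (AddMonoidAlgebra.mapDomain _ a).coeff u = 0
    rw [AddMonoidAlgebra.coeff_mapDomain]
    refine Finsupp.mapDomain_of_notMem_range _ _ ?_
    rintro ⟨v, rfl⟩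
    exact h v.2
  · intro h
    have hp : p = ∑ u ∈ p.coeff.support, AddMonoidAlgebra.single u (p.coeff u) :=
      (AddMonoidAlgebra.sum_coeff_single p).symm
    rw [hp]
    change _ ∈ (P.toLaurent σ).range
    refine Subring.sum_mem _ fun u hu ↦ ?_
    exact ⟨AddMonoidAlgebra.single ⟨u, h u (Finsupp.mem_support_iff.1 hu)⟩ (p.coeff u),
      P.toLaurent_single _ _ _⟩

instance instIsDomainChartRing (σ : P.Face) : IsDomain (P.chartRing σ) :=
  (P.toLaurent_injective σ).isDomain (P.toLaurent σ)

theorem toLaurent_chartMap {σ τ : P.Face} (h : σ ≤ τ) (a : P.chartRing τ) :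
    P.toLaurent σ (P.chartMap h a) = P.toLaurent τ a := by
  induction a using AddMonoidAlgebra.induction_linear with
  | zero => simp
  | add a b ha hb => simp [ha, hb]
  | single u c =>
    rw [toLaurent_single]
    exact (congrArg (P.toLaurent σ) AddMonoidAlgebra.mapDomain_single).trans
      (P.toLaurent_single _ _ _)

theorem chart_comp {σ τ : P.Face} (h : σ ≤ τ) :
    P.chartFunctor.map (homOfLE h) ≫ P.chart τ = P.chart σ := colimit.w P.chartFunctor (homOfLE h)

theorem affineOpen_mono {σ τ : P.Face} (h : σ ≤ τ) : P.affineOpen σ ≤ P.affineOpen τ := by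
  rintro _ ⟨x, rfl⟩
  refine ⟨P.chartFunctor.map (homOfLE h) x, ?_⟩
  exact congrArg (fun g : P.chartFunctor.obj σ ⟶ P.X ↦ g x) (P.chart_comp h)

theorem exists_mem_affineOpen (x : P.X) : ∃ σ : P.Face, x ∈ P.affineOpen σ := by
  obtain ⟨σ, y, hy⟩ := Scheme.IsLocallyDirected.ι_jointly_surjective P.chartFunctor x
  exact ⟨σ, y, hy⟩

/-- The gluing identifies points of two charts only when they come from a common subchart, and the
cell of this subchart is below both cells, hence below their meet. -/
theorem affineOpen_inf (σ τ : P.Face) :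
    P.affineOpen σ ⊓ P.affineOpen τ = P.affineOpen (σ ⊓ τ) := by
  apply le_antisymm
  · rintro _ ⟨⟨y, rfl⟩, ⟨z, hz⟩⟩
    obtain ⟨ρ, f, g, x, rfl, rfl⟩ := (Scheme.IsLocallyDirected.ι_eq_ι_iff P.chartFunctor).1 hz
    refine P.affineOpen_mono (le_inf g.le f.le) ⟨x, ?_⟩
    exact congrArg (fun k : P.chartFunctor.obj ρ ⟶ P.X ↦ k x) (P.chart_comp g.le).symm
  · exact le_inf (P.affineOpen_mono inf_le_left) (P.affineOpen_mono inf_le_right)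

theorem isAffineOpen_affineOpen (σ : P.Face) : IsAffineOpen (P.affineOpen σ) :=
  haveI : IsAffine (P.chartFunctor.obj σ) :=
    inferInstanceAs (IsAffine (Spec (CommRingCat.of (P.chartRing σ))))
  isAffineOpen_opensRange (P.chart σ)

instance instIsIntegralChart (σ : P.Face) : IsIntegral (P.chartFunctor.obj σ) :=
  inferInstanceAs (IsIntegral (Spec (CommRingCat.of (P.chartRing σ))))

instance instNonemptyAffineOpen (σ : P.Face) : Nonempty (P.affineOpen σ) :=
  ⟨⟨P.chart σ (genericPoint _), _, rfl⟩⟩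

theorem isPreirreducible_affineOpen (σ : P.Face) : IsPreirreducible (P.affineOpen σ : Set P.X) := by
  have := (PreirreducibleSpace.isPreirreducible_univ (X := P.chartFunctor.obj σ)).image
    (P.chart σ) (P.chart σ).continuous.continuousOn
  rwa [Set.image_univ] at this

/-- Every nonempty open set meets some chart, and the chart is irreducible and contains the torus.
So every nonempty open set meets the torus, which is irreducible. -/
instance instIrreducibleSpaceX : IrreducibleSpace P.X where
  toNonempty := ⟨P.chart P.interiorCell (genericPoint _)⟩
  isPreirreducible_univ := by
    have hT : ∀ O : Set P.X, IsOpen O → O.Nonempty → ((P.torus : Set P.X) ∩ O).Nonempty := by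
      rintro O hO ⟨x, hx⟩
      obtain ⟨σ, hσ⟩ := P.exists_mem_affineOpen x
      obtain ⟨y, hy⟩ := P.instNonemptyAffineOpen P.interiorCell
      obtain ⟨z, -, hz, hz'⟩ := P.isPreirreducible_affineOpen σ O P.torus hO P.torus.isOpen
        ⟨x, hσ, hx⟩ ⟨y, P.torus_le σ hy, hy⟩
      exact ⟨z, hz', hz⟩
    rintro O O' hO hO' ⟨x, -, hx⟩ ⟨x', -, hx'⟩
    obtain ⟨z, -, hz⟩ := P.isPreirreducible_affineOpen P.interiorCell O O' hO hO'
      (hT O hO ⟨x, hx⟩) (hT O' hO' ⟨x', hx'⟩)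
    exact ⟨z, trivial, hz⟩

instance instIsReducedX : AlgebraicGeometry.IsReduced P.X := by
  have : ∀ x : P.X, _root_.IsReduced (P.X.presheaf.stalk x) := by
    intro x
    obtain ⟨σ, y, rfl⟩ := P.exists_mem_affineOpen x
    have : IsIso ((P.chart σ).stalkMap y) := inferInstance
    exact isReduced_of_injective ((P.chart σ).stalkMap y).hom
      (asIso ((P.chart σ).stalkMap y)).commRingCatIsoToRingEquiv.injective
  exact isReduced_of_isReduced_stalk P.X

instance instIsIntegralX : IsIntegral P.X := isIntegral_of_irreducibleSpace_of_isReduced P.X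

theorem genericPoint_mem_affineOpen (σ : P.Face) : genericPoint P.X ∈ P.affineOpen σ := by
  obtain ⟨x⟩ := P.instNonemptyAffineOpen σ
  exact Scheme.genericPoint_mem x.2

theorem genericPoint_mem_torus : genericPoint P.X ∈ P.torus :=
  P.genericPoint_mem_affineOpen P.interiorCell

/-- The coordinate ring of a chart as the ring of functions on the open set of the chart. -/
def chartSections (σ : P.Face) : P.chartRing σ ≃+* Γ(P.X, P.affineOpen σ) :=
  ((Scheme.ΓSpecIso (CommRingCat.of (P.chartRing σ))).symm ≪≫
    IsOpenImmersion.ΓIsoTop (P.chart σ)).commRingCatIsoToRingEquiv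

theorem top_le_preimage_chart (σ : P.Face) {V : P.X.Opens} (h : P.affineOpen σ ≤ V) :
    ⊤ ≤ P.chart σ ⁻¹ᵁ V := fun x _ ↦ h ⟨x, rfl⟩

/-- The pullback of functions to a chart. -/
def pullChart (σ : P.Face) {V : P.X.Opens} (h : P.affineOpen σ ≤ V) :
    Γ(P.X, V) ⟶ Γ(P.chartFunctor.obj σ, ⊤) :=
  (P.chart σ).appLE V ⊤ (P.top_le_preimage_chart σ h)

theorem pullChart_chartSections (σ : P.Face) (a : P.chartRing σ) :
    P.pullChart σ le_rfl (P.chartSections σ a) =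
      (Scheme.ΓSpecIso (CommRingCat.of (P.chartRing σ))).inv a := by
  have h : (IsOpenImmersion.ΓIsoTop (P.chart σ)).inv = P.pullChart σ le_rfl := by
    simp only [IsOpenImmersion.ΓIsoTop, Iso.trans_inv, Functor.mapIso_inv, Iso.op_inv, eqToIso.inv,
      eqToHom_op, Iso.symm_inv, Scheme.Hom.appIso_hom', Scheme.Hom.map_appLE]
    rfl
  rw [← h]
  exact ConcreteCategory.congr_hom (IsOpenImmersion.ΓIsoTop (P.chart σ)).hom_inv_id
    ((Scheme.ΓSpecIso (CommRingCat.of (P.chartRing σ))).inv a)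

theorem pullChart_injective (σ : P.Face) : Function.Injective (P.pullChart σ le_rfl) := by
  intro x y hxy
  obtain ⟨a, rfl⟩ := (P.chartSections σ).surjective x
  obtain ⟨b, rfl⟩ := (P.chartSections σ).surjective y
  rw [pullChart_chartSections, pullChart_chartSections] at hxy
  rw [(Scheme.ΓSpecIso (CommRingCat.of (P.chartRing σ))).symm.commRingCatIsoToRingEquiv.injective
    hxy]

/-- This identifies restriction between charts with the inclusion of monoid algebras, so that
questions about functions can be decided inside the Laurent polynomials. The identity is checked
after pullback to the smaller chart, where it is naturality of `ΓSpecIso`. -/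
theorem resFun_chartSections {σ τ : P.Face} (h : σ ≤ τ) (a : P.chartRing τ) :
    P.X.resFun (P.affineOpen_mono h) (P.chartSections τ a) =
      P.chartSections σ (P.chartMap h a) := by
  refine P.pullChart_injective σ ?_
  rw [pullChart_chartSections]
  have hle : ⊤ ≤ P.chartFunctor.map (homOfLE h) ⁻¹ᵁ ⊤ := fun _ _ ↦ trivial
  have h1 : P.X.presheaf.map (homOfLE (P.affineOpen_mono h)).op ≫ P.pullChart σ le_rfl =
      P.pullChart τ le_rfl ≫ (P.chartFunctor.map (homOfLE h)).appLE ⊤ ⊤ hle := by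
    rw [pullChart, Scheme.Hom.map_appLE, pullChart, Scheme.Hom.appLE_comp_appLE]
    simp only [P.chart_comp h]
  have h2 := ConcreteCategory.congr_hom h1 (P.chartSections τ a)
  refine h2.trans ?_
  change (P.chartFunctor.map (homOfLE h)).appLE ⊤ ⊤ hle
    (P.pullChart τ le_rfl (P.chartSections τ a)) = _
  rw [pullChart_chartSections]
  have h3 := Scheme.ΓSpecIso_inv_naturality (CommRingCat.ofHom (P.chartMap h).toRingHom)
  have h4 := (ConcreteCategory.congr_hom h3 a).symm
  refine Eq.trans ?_ h4
  rw [Scheme.Hom.appTop, Scheme.Hom.app_eq_appLE]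
  rfl

end SmoothPolytope

/-! ### Laurent polynomials and monomial frames -/

namespace SmoothPolytope

variable {n : ℕ} (P : SmoothPolytope n)

theorem interiorCell_le (σ : P.Face) : P.interiorCell ≤ σ := Finset.empty_subset _

theorem pair_neg (u : Fin n → ℤ) (i : P.Facet) : P.pair (-u) i = - P.pair u i := by
  simp [pair]

theorem pair_sub (u v : Fin n → ℤ) (i : P.Facet) : P.pair (u - v) i = P.pair u i - P.pair v i := by
  rw [sub_eq_add_neg, pair_add, pair_neg, sub_eq_add_neg]

theorem pair_zsmul (k : ℤ) (u : Fin n → ℤ) (i : P.Facet) :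
    P.pair (k • u) i = k * P.pair u i := by
  simp [pair, Finset.mul_sum, mul_assoc]

theorem laurent_toLaurent_interiorCell (a : P.chartRing P.interiorCell) :
    P.laurent (P.toLaurent P.interiorCell a) = P.chartSections P.interiorCell a := by
  refine congrArg (P.chartSections P.interiorCell) ?_
  induction a using AddMonoidAlgebra.induction_linear with
  | zero => simp
  | add a b ha hb => rw [map_add, map_add, ha, hb]
  | single u c =>
    rw [toLaurent_single]
    exact AddMonoidAlgebra.mapDomain_single

theorem resFun_chartSections_torus (σ : P.Face) (a : P.chartRing σ) :
    P.X.resFun (P.torus_le σ) (P.chartSections σ a) = P.laurent (P.toLaurent σ a) := by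
  rw [← P.toLaurent_chartMap (P.interiorCell_le σ), laurent_toLaurent_interiorCell]
  exact P.resFun_chartSections (P.interiorCell_le σ) a

theorem laurent_bijective : Function.Bijective P.laurent := by
  have h : ∀ p, ∃ a, P.toLaurent P.interiorCell a = p := fun p ↦
    P.exists_toLaurent_eq_iff.2 fun u _ i hi ↦ absurd hi (Finset.notMem_empty _)
  constructor
  · intro p q hpq
    obtain ⟨a, rfl⟩ := h p
    obtain ⟨b, rfl⟩ := h q
    rw [laurent_toLaurent_interiorCell, laurent_toLaurent_interiorCell] at hpq
    rw [(P.chartSections P.interiorCell).injective hpq]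
  · intro x
    obtain ⟨a, rfl⟩ := (P.chartSections P.interiorCell).surjective x
    exact ⟨_, P.laurent_toLaurent_interiorCell a⟩

/-- Laurent polynomials extend to the chart of a cell if and only if their monomials do. -/
theorem exists_resFun_eq_laurent_iff {σ : P.Face} {p : AddMonoidAlgebra ℂ (Fin n → ℤ)} :
    (∃ f, P.X.resFun (P.torus_le σ) f = P.laurent p) ↔
      ∀ u, p.coeff u ≠ 0 → u ∈ P.dualMonoid σ := by
  rw [← P.exists_toLaurent_eq_iff]
  constructor
  · rintro ⟨f, hf⟩
    obtain ⟨a, rfl⟩ := (P.chartSections σ).surjective f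
    rw [resFun_chartSections_torus] at hf
    exact ⟨a, P.laurent_bijective.1 hf⟩
  · rintro ⟨a, rfl⟩
    exact ⟨_, P.resFun_chartSections_torus σ a⟩

theorem resFun_torus_injective {V : P.X.Opens} (h : P.torus ≤ V) :
    Function.Injective (P.X.resFun h) :=
  Scheme.resFun_injective P.genericPoint_mem_torus h

theorem chart_comp_toSpec (σ : P.Face) :
    P.chart σ ≫ P.toSpec = Spec.map (CommRingCat.ofHom (algebraMap ℂ (P.chartRing σ))) :=
  colimit.ι_desc _ _

theorem scalar_affineOpen (σ : P.Face) (c : ℂ) :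
    P.scalar (P.affineOpen σ) c = P.chartSections σ (algebraMap ℂ _ c) := by
  refine P.pullChart_injective σ ?_
  rw [pullChart_chartSections]
  have h1 : P.X.presheaf.map (homOfLE (le_top : P.affineOpen σ ≤ ⊤)).op ≫ P.pullChart σ le_rfl =
      (P.chart σ).appTop := by
    rw [pullChart, Scheme.Hom.map_appLE, Scheme.Hom.appTop, Scheme.Hom.app_eq_appLE]
    rfl
  refine (ConcreteCategory.congr_hom h1 _).trans ?_
  have h2 : P.toSpec.appTop ≫ (P.chart σ).appTop =
      (Spec.map (CommRingCat.ofHom (algebraMap ℂ (P.chartRing σ)))).appTop := by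
    rw [← Scheme.Hom.comp_appTop, chart_comp_toSpec]
  refine (ConcreteCategory.congr_hom h2 _).trans ?_
  exact (ConcreteCategory.congr_hom (Scheme.ΓSpecIso_inv_naturality
    (CommRingCat.ofHom (algebraMap ℂ (P.chartRing σ)))) c).symm

theorem scalar_torus (c : ℂ) : P.scalar P.torus c = P.laurent (AddMonoidAlgebra.single 0 c) := by
  have h := P.scalar_affineOpen P.interiorCell c
  rw [← laurent_toLaurent_interiorCell] at h
  refine h.trans (congrArg P.laurent ?_)
  exact P.toLaurent_single _ _ _

theorem laurent_single (u : Fin n → ℤ) (c : ℂ) :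
    P.laurent (AddMonoidAlgebra.single u c) = P.scalar P.torus c * P.monomial u := by
  rw [scalar_torus, monomial, ← map_mul, AddMonoidAlgebra.single_mul_single, zero_add, mul_one]

theorem monomial_add (u v : Fin n → ℤ) : P.monomial (u + v) = P.monomial u * P.monomial v := by
  rw [monomial, monomial, monomial, ← map_mul, AddMonoidAlgebra.single_mul_single, one_mul]

theorem monomial_zero : P.monomial 0 = 1 := map_one P.laurent

theorem monomial_nsmul (k : ℕ) (u : Fin n → ℤ) : P.monomial (k • u) = P.monomial u ^ k := by
  rw [monomial, monomial, ← map_pow, AddMonoidAlgebra.single_pow, one_pow]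

theorem isUnit_monomial (u : Fin n → ℤ) : IsUnit (P.monomial u) :=
  IsUnit.of_mul_eq_one (P.monomial (-u)) (by rw [← monomial_add, add_neg_cancel, monomial_zero])

theorem exists_monomial_of_isUnit {f : Γ(P.X, P.torus)} (hf : IsUnit f) :
    ∃ (u : Fin n → ℤ) (c : ℂ), c ≠ 0 ∧ f = P.scalar P.torus c * P.monomial u := by
  obtain ⟨p, rfl⟩ := P.laurent_bijective.2 f
  obtain ⟨g, hg⟩ := hf.exists_right_inv
  obtain ⟨q, rfl⟩ := P.laurent_bijective.2 g
  rw [← map_mul, ← map_one P.laurent] at hg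
  obtain ⟨u, c, hc, rfl⟩ :=
    AddMonoidAlgebra.exists_eq_single_of_isUnit (IsUnit.of_mul_eq_one q (P.laurent_bijective.1 hg))
  exact ⟨u, c, hc, P.laurent_single u c⟩

/-- The monomials that are functions on the chart of a cell. -/
def chartMonomial (σ : P.Face) (u : P.dualMonoid σ) : Γ(P.X, P.affineOpen σ) :=
  P.chartSections σ (AddMonoidAlgebra.single u 1)

theorem resFun_chartMonomial (σ : P.Face) (u : P.dualMonoid σ) :
    P.X.resFun (P.torus_le σ) (P.chartMonomial σ u) = P.monomial u.1 := by
  rw [chartMonomial, resFun_chartSections_torus, toLaurent_single, monomial]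

theorem isUnit_chartMonomial {σ : P.Face} (u : P.dualMonoid σ) (hu : ∀ i ∈ σ.1, P.pair u.1 i = 0) :
    IsUnit (P.chartMonomial σ u) := by
  refine IsUnit.of_mul_eq_one (P.chartMonomial σ ⟨-u.1, fun i hi ↦ ?_⟩) ?_
  · rw [pair_neg, hu i hi, neg_zero]
  · refine P.resFun_torus_injective (P.torus_le σ) ?_
    rw [map_mul, resFun_chartMonomial, resFun_chartMonomial, ← monomial_add, map_one,
      add_neg_cancel, monomial_zero]

/-- Both $\chi^u$ and its inverse $\chi^{-u}$ extend to the chart, so both $u$ and $-u$ lie in the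
dual cone. -/
theorem pair_eq_zero_of_isUnit {σ : P.Face} {f : Γ(P.X, P.affineOpen σ)} (hf : IsUnit f)
    {u : Fin n → ℤ} (hu : P.X.resFun (P.torus_le σ) f = P.monomial u) {i : P.Facet}
    (hi : i ∈ σ.1) : P.pair u i = 0 := by
  obtain ⟨g, hg⟩ := hf.exists_right_inv
  have hg' : P.X.resFun (P.torus_le σ) g = P.monomial (-u) := by
    refine (P.isUnit_monomial u).mul_left_cancel ?_
    rw [← monomial_add, add_neg_cancel, monomial_zero, ← hu, ← map_mul, hg, map_one]
  have key : ∀ v : Fin n → ℤ, (∃ f, P.X.resFun (P.torus_le σ) f = P.monomial v) →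
      P.pair v i ≤ 0 := by
    intro v hv
    exact P.exists_resFun_eq_laurent_iff.1 hv v (by simp) i hi
  have h1 := key u ⟨f, hu⟩
  have h2 := key (-u) ⟨g, hg'⟩
  rw [pair_neg] at h2
  omega

theorem eq_zero_of_pair_eq_zero {τ : P.Face} {b : Module.Basis (Fin n) ℤ (Fin n → ℤ)}
    {e : τ.1 ≃ Fin n} (hb : ∀ i : τ.1, P.normal i = b (e i)) {u : Fin n → ℤ}
    (hu : ∀ i ∈ τ.1, P.pair u i = 0) : u = 0 := by
  let φ : (Fin n → ℤ) →ₗ[ℤ] ℤ := ∑ k, u k • LinearMap.proj k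
  have hφ : ∀ v, φ v = ∑ k, u k * v k := fun v ↦ by simp [φ]
  have h0 : φ = 0 := b.ext fun k ↦ by
    have := hu _ (e.symm k).2
    rw [pair, hb, e.apply_symm_apply] at this
    rw [hφ, this, LinearMap.zero_apply]
  funext k
  have := hφ (Pi.single k 1)
  rw [h0] at this
  simpa [Pi.single_apply] using this.symm

/-- The chart of a vertex is an affine space. -/
theorem exists_addEquiv_dualMonoid {τ : P.Face} {b : Module.Basis (Fin n) ℤ (Fin n → ℤ)}
    {e : τ.1 ≃ Fin n} (hb : ∀ i : τ.1, P.normal i = b (e i)) :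
    Nonempty (P.dualMonoid τ ≃+ (Fin n →₀ ℕ)) := by
  -- The coordinates are $-\langle u,\nu_i\rangle\ge0$ for the $n$ facets through the vertex. They
  -- determine $u$ since the normals form a basis, and take all values by `exists_pair_eq`.
  let φ : P.dualMonoid τ →+ (Fin n →₀ ℕ) :=
    { toFun := fun u ↦ Finsupp.equivFunOnFinite.symm fun k ↦ (- P.pair u.1 (e.symm k).1).toNat
      map_zero' := by ext k; simp [pair_zero]
      map_add' := fun u v ↦ by
        ext k
        have h1 := u.2 _ (e.symm k).2
        have h2 := v.2 _ (e.symm k).2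
        simp only [AddSubmonoid.coe_add, pair_add, Finsupp.equivFunOnFinite_symm_apply_apply,
          Finsupp.add_apply]
        omega }
  have hφ : ∀ u k, φ u k = (- P.pair u.1 (e.symm k).1).toNat := fun u k ↦ rfl
  refine ⟨AddEquiv.ofBijective φ ⟨fun u v huv ↦ ?_, fun f ↦ ?_⟩⟩
  · refine Subtype.ext (sub_eq_zero.1 (P.eq_zero_of_pair_eq_zero hb fun i hi ↦ ?_))
    have h := DFunLike.congr_fun huv (e ⟨i, hi⟩)
    rw [hφ, hφ, e.symm_apply_apply] at h
    change (- P.pair u.1 i).toNat = (- P.pair v.1 i).toNat at h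
    have h1 := u.2 i hi
    have h2 := v.2 i hi
    rw [pair_sub]
    omega
  · classical
    obtain ⟨u, hu⟩ := P.exists_pair_eq τ fun i ↦ if hi : i ∈ τ.1 then - (f (e ⟨i, hi⟩) : ℤ) else 0
    refine ⟨⟨u, fun i hi ↦ ?_⟩, ?_⟩
    · rw [hu i hi, dif_pos hi]
      omega
    · ext k
      rw [hφ, hu _ (e.symm k).2, dif_pos (e.symm k).2]
      simp

/-- The chart is contained in the chart of a vertex, whose coordinate ring is a polynomial ring,
hence factorial with trivial class group. A frame found there is restricted. -/
theorem exists_isGenerator {L : P.X.Modules} (hL : L.IsInvertible) (σ : P.Face) :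
    ∃ f : Γ(L, P.affineOpen σ), L.IsGenerator f := by
  obtain ⟨τ, hστ, b, e, hb⟩ := P.exists_vertex σ
  obtain ⟨ψ⟩ := P.exists_addEquiv_dualMonoid hb
  have hψ : P.chartRing τ ≃* MvPolynomial (Fin n) ℂ :=
    (AddMonoidAlgebra.domCongr ℂ ℂ ψ).toRingEquiv.toMulEquiv
  have : UniqueFactorizationMonoid Γ(P.X, P.affineOpen τ) :=
    MulEquiv.uniqueFactorizationMonoid (hψ.symm.trans (P.chartSections τ).toMulEquiv) inferInstance
  obtain ⟨f, hf⟩ := hL.exists_isGenerator (P.isAffineOpen_affineOpen τ)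
  exact ⟨_, hf.resSec (P.affineOpen_mono hστ)⟩

/-- A frame over the torus extends, after multiplication by a monomial, to the chart of a cell. -/
theorem exists_frame {L : P.X.Modules} (hL : L.IsInvertible) {e : Γ(L, P.torus)}
    (he : L.IsGenerator e) (σ : P.Face) : ∃ (m : Fin n → ℤ) (f : Γ(L, P.affineOpen σ)),
      L.IsGenerator f ∧ e = P.monomial m • L.resSec (P.torus_le σ) f := by
  obtain ⟨f, hf⟩ := P.exists_isGenerator hL σ
  obtain ⟨g, hg, rfl⟩ := (hf.resSec (P.torus_le σ)).exists_unit_smul_eq he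
  -- The transition unit is a scalar times a monomial, and the scalar is absorbed into the frame.
  obtain ⟨m, c, hc, rfl⟩ := P.exists_monomial_of_isUnit hg
  refine ⟨m, P.scalar _ c • f, hf.unit_smul (hc.isUnit.map _), ?_⟩
  rw [Scheme.Modules.resSec_smul, map_scalar, smul_smul, mul_comm]

/-- The monomials of two frames over the chart of a cell differ by an invertible monomial. -/
theorem pair_eq_of_frame {L : P.X.Modules} {e : Γ(L, P.torus)}
    {σ τ : P.Face} {m m' : Fin n → ℤ} {f : Γ(L, P.affineOpen σ)} {f' : Γ(L, P.affineOpen τ)}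
    (hf : L.IsGenerator f) (hf' : L.IsGenerator f')
    (h : e = P.monomial m • L.resSec (P.torus_le σ) f)
    (h' : e = P.monomial m' • L.resSec (P.torus_le τ) f') {i : P.Facet} (hi : i ∈ σ.1)
    (hi' : i ∈ τ.1) : P.pair m i = P.pair m' i := by
  have hσ : P.affineOpen (σ ⊓ τ) ≤ P.affineOpen σ := P.affineOpen_mono inf_le_left
  have hτ : P.affineOpen (σ ⊓ τ) ≤ P.affineOpen τ := P.affineOpen_mono inf_le_right
  obtain ⟨g, hg, hgf⟩ := (hf.resSec hσ).exists_unit_smul_eq (hf'.resSec hτ)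
  have h1 := congrArg (L.resSec (P.torus_le (σ ⊓ τ))) hgf
  rw [Scheme.Modules.resSec_smul_resFun, Scheme.Modules.resSec_resSec,
    Scheme.Modules.resSec_resSec] at h1
  rw [h1] at h'
  -- The transition function on the common chart is invertible and restricts to the monomial
  -- $\chi^{m-m'}$.
  have h2 : P.X.resFun (P.torus_le (σ ⊓ τ)) g = P.monomial (m - m') := by
    refine (P.isUnit_monomial m').mul_left_cancel ?_
    rw [← monomial_add, add_sub_cancel]
    refine (hf.resSec (P.torus_le σ)).smul_cancel ?_
    rw [← h, mul_smul, ← h']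
  have := P.pair_eq_zero_of_isUnit hg h2 (P.mem_inf.2 ⟨hi, hi'⟩)
  rw [pair_sub] at this
  omega

end SmoothPolytope

/-! ### Orders along the toric divisors -/

namespace AlgebraicGeometry.Scheme

variable {X : Scheme.{0}}

theorem mem_basicOpen_fromSpec {U : X.Opens} (hU : IsAffineOpen U) (y : PrimeSpectrum Γ(X, U))
    (f : Γ(X, U)) : hU.fromSpec y ∈ X.basicOpen f ↔ f ∉ y.asIdeal := by
  have := hU.fromSpec_preimage_basicOpen f
  change y ∈ hU.fromSpec ⁻¹ᵁ X.basicOpen f ↔ _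
  rw [this]
  rfl

theorem fromSpec_mem {U : X.Opens} (hU : IsAffineOpen U) (y : PrimeSpectrum Γ(X, U)) :
    hU.fromSpec y ∈ U := by
  rw [← SetLike.mem_coe, ← hU.range_fromSpec]
  exact ⟨y, rfl⟩

theorem maximalIdeal_stalk_eq {U : X.Opens} (hU : IsAffineOpen U) (y : PrimeSpectrum Γ(X, U))
    {f : Γ(X, U)} (hy : y.asIdeal = Ideal.span {f}) :
    IsLocalRing.maximalIdeal (X.presheaf.stalk (hU.fromSpec y)) =
      Ideal.span {X.presheaf.germ U (hU.fromSpec y) (fromSpec_mem hU y) f} := by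
  have key := @IsLocalization.AtPrime.map_eq_maximalIdeal _ _ y.asIdeal _
    (X.presheaf.stalk (hU.fromSpec y)) _
    (TopCat.Presheaf.algebra_section_stalk X.presheaf ⟨hU.fromSpec y, fromSpec_mem hU y⟩)
    (hU.isLocalization_stalk' y (fromSpec_mem hU y)) _
  rw [hy, Ideal.map_span, Set.image_singleton] at key
  exact key.symm

end AlgebraicGeometry.Scheme

namespace SmoothPolytope

variable {n : ℕ} (P : SmoothPolytope n)

/-- The open cell of a facet. -/
def facetCell (i : P.Facet) : P.Face := ⟨{i}, P.exists_facet i⟩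

theorem mem_facetCell {i j : P.Facet} : j ∈ (P.facetCell i).1 ↔ j = i := Finset.mem_singleton

theorem facetCell_le {i : P.Facet} {τ : P.Face} (hi : i ∈ τ.1) : P.facetCell i ≤ τ :=
  Finset.singleton_subset_iff.2 hi

/-- The restriction of functions on the chart of a facet to the torus orbit of this facet. -/
def orbitMap (i : P.Facet) : P.chartRing (P.facetCell i) →ₐ[ℂ] AddMonoidAlgebra ℂ (Fin n → ℤ) :=
  AddMonoidAlgebra.lift ℂ _ _
    { toFun := fun u ↦ if P.pair u.toAdd.1 i = 0 then AddMonoidAlgebra.single u.toAdd.1 1 else 0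
      map_one' := if_pos (P.pair_zero i)
      map_mul' := fun u v ↦ by
        -- Both pairings are nonpositive, so their sum vanishes only if both do. This makes dropping
        -- the other monomials multiplicative.
        have hu : P.pair u.toAdd.1 i ≤ 0 := u.toAdd.2 i (P.mem_facetCell.2 rfl)
        have hv : P.pair v.toAdd.1 i ≤ 0 := v.toAdd.2 i (P.mem_facetCell.2 rfl)
        rw [toAdd_mul, AddSubmonoid.coe_add, pair_add]
        by_cases h : P.pair u.toAdd.1 i = 0
        · by_cases h' : P.pair v.toAdd.1 i = 0
          · rw [if_pos h, if_pos h', if_pos (by omega), AddMonoidAlgebra.single_mul_single, one_mul]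
          · rw [if_neg h', if_neg (by omega), mul_zero]
        · rw [if_neg h, if_neg (by omega), zero_mul] }

theorem orbitMap_single (i : P.Facet) (u : P.dualMonoid (P.facetCell i)) (c : ℂ) :
    P.orbitMap i (AddMonoidAlgebra.single u c) =
      if P.pair u.1 i = 0 then AddMonoidAlgebra.single u.1 c else 0 := by
  rw [orbitMap, AddMonoidAlgebra.lift_single]
  change c • (if P.pair u.1 i = 0 then AddMonoidAlgebra.single u.1 1 else 0) = _
  split_ifs
  · rw [AddMonoidAlgebra.smul_single, smul_eq_mul, mul_one]
  · rw [smul_zero]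

theorem coeff_orbitMap (i : P.Facet) (a : P.chartRing (P.facetCell i))
    (u : P.dualMonoid (P.facetCell i)) (hu : P.pair u.1 i = 0) :
    (P.orbitMap i a).coeff u.1 = a.coeff u := by
  classical
  induction a using AddMonoidAlgebra.induction_linear with
  | zero => simp
  | add a b ha hb => simp [ha, hb]
  | single v c =>
    rw [orbitMap_single]
    by_cases h : v = u
    · subst h
      rw [if_pos hu]
      simp
    · have h' : v.1 ≠ u.1 := fun h' ↦ h (Subtype.ext h')
      split_ifs
      · simp [AddMonoidAlgebra.coeff_single, h, h']
      · simp [AddMonoidAlgebra.coeff_single, h]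

/-- Division of a monomial by $\chi^w$ raises the pairing with $\nu_i$ by one and leaves those with
the other normals through the cell unchanged. A monomial with negative pairing therefore stays in
the dual cone. -/
theorem dvd_of_pair_neg {τ : P.Face} {i : P.Facet} (w : P.dualMonoid τ) (hw : P.pair w.1 i = -1)
    (hw' : ∀ j ∈ τ.1, j ≠ i → P.pair w.1 j = 0) {a : P.chartRing τ}
    (ha : ∀ u, a.coeff u ≠ 0 → P.pair u.1 i < 0) :
    AddMonoidAlgebra.single w (1 : ℂ) ∣ a := by
  have hsum : a = ∑ u ∈ a.coeff.support, AddMonoidAlgebra.single u (a.coeff u) :=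
    (AddMonoidAlgebra.sum_coeff_single a).symm
  rw [hsum]
  refine Finset.dvd_sum fun u hu ↦ ?_
  have hui := ha u (Finsupp.mem_support_iff.1 hu)
  have hmem : u.1 - w.1 ∈ P.dualMonoid τ := fun j hj ↦ by
    rw [pair_sub]
    by_cases h : j = i
    · subst h
      omega
    · rw [hw' j hj h]
      have := u.2 j hj
      omega
  refine ⟨AddMonoidAlgebra.single ⟨_, hmem⟩ (a.coeff u), ?_⟩
  rw [AddMonoidAlgebra.single_mul_single, one_mul]
  congr 1
  exact Subtype.ext (add_sub_cancel _ _).symm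

/-- Elements of the kernel have no monomials with pairing zero, so `dvd_of_pair_neg` applies. Thus
the ideal of the divisor is prime and principal, and $\chi^w$ is a uniformizer at its generic point.
-/
theorem ker_orbitMap {i : P.Facet} (w : P.dualMonoid (P.facetCell i)) (hw : P.pair w.1 i = -1) :
    RingHom.ker (P.orbitMap i) = Ideal.span {AddMonoidAlgebra.single w 1} := by
  apply le_antisymm
  · intro a ha
    rw [Ideal.mem_span_singleton]
    refine P.dvd_of_pair_neg w hw (fun j hj h ↦ absurd (P.mem_facetCell.1 hj) h) fun u hu ↦ ?_
    have h1 := u.2 i (P.mem_facetCell.2 rfl)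
    rcases h1.lt_or_eq with h | h
    · exact h
    · rw [← P.coeff_orbitMap i a u h, (RingHom.mem_ker).1 ha] at hu
      exact absurd rfl hu
  · rw [Ideal.span_singleton_le_iff_mem, RingHom.mem_ker, orbitMap_single, if_neg (by omega)]

theorem exists_weight_facet {τ : P.Face} {i : P.Facet} (hi : i ∈ τ.1) : ∃ w : P.dualMonoid τ,
    P.pair w.1 i = -1 ∧ ∀ j ∈ τ.1, j ≠ i → P.pair w.1 j = 0 := by
  classical
  obtain ⟨w, hw⟩ := P.exists_pair_eq τ (Pi.single i (-1))
  have h1 : P.pair w i = -1 := by rw [hw i hi, Pi.single_eq_same]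
  have h2 : ∀ j ∈ τ.1, j ≠ i → P.pair w j = 0 := fun j hj h ↦ by
    rw [hw j hj, Pi.single_eq_of_ne h]
  refine ⟨⟨w, fun j hj ↦ ?_⟩, h1, h2⟩
  by_cases h : j = i
  · rw [h, h1]
    norm_num
  · rw [h2 j hj h]

/-- The ideal of the toric divisor of a facet in the chart of this facet. -/
def facetIdeal (i : P.Facet) : Ideal Γ(P.X, P.affineOpen (P.facetCell i)) :=
  (RingHom.ker (P.orbitMap i)).comap (P.chartSections (P.facetCell i)).symm

instance instIsPrimeFacetIdeal (i : P.Facet) : (P.facetIdeal i).IsPrime :=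
  have : (RingHom.ker (P.orbitMap i)).IsPrime := RingHom.ker_isPrime _
  Ideal.comap_isPrime _ _

theorem chartSections_mem_facetIdeal {i : P.Facet} {a : P.chartRing (P.facetCell i)} :
    P.chartSections (P.facetCell i) a ∈ P.facetIdeal i ↔ P.orbitMap i a = 0 := by
  rw [facetIdeal, Ideal.mem_comap, RingHom.mem_ker]
  simp

theorem facetIdeal_eq_span {i : P.Facet} (w : P.dualMonoid (P.facetCell i))
    (hw : P.pair w.1 i = -1) :
    P.facetIdeal i = Ideal.span {P.chartMonomial (P.facetCell i) w} := by
  rw [facetIdeal, P.ker_orbitMap w hw]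
  ext f
  obtain ⟨a, rfl⟩ := (P.chartSections (P.facetCell i)).surjective f
  rw [Ideal.mem_comap, RingEquiv.symm_apply_apply, Ideal.mem_span_singleton,
    Ideal.mem_span_singleton, chartMonomial, map_dvd_iff]

/-- The generic point of the toric divisor of a facet. -/
def divisorPoint (i : P.Facet) : P.X :=
  (P.isAffineOpen_affineOpen (P.facetCell i)).fromSpec ⟨P.facetIdeal i, inferInstance⟩

theorem divisorPoint_mem (i : P.Facet) : P.divisorPoint i ∈ P.affineOpen (P.facetCell i) :=
  Scheme.fromSpec_mem _ _

/-- The coordinate ring of `ρ` is the localization of that of `τ` at $\chi^w$, so the chart of `ρ`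
is the locus where $\chi^w$ does not vanish. -/
theorem basicOpen_chartMonomial_le {ρ τ : P.Face} (h : ρ ≤ τ) (w : P.dualMonoid τ)
    (hw : ∀ i ∈ ρ.1, P.pair w i = 0) (hw' : ∀ i ∈ τ.1, i ∉ ρ.1 → P.pair w i < 0) :
    P.X.basicOpen (P.chartMonomial τ w) ≤ P.affineOpen ρ := by
  intro x hx
  obtain ⟨z, rfl⟩ : x ∈ P.affineOpen τ := P.X.basicOpen_le _ hx
  have h1 : z ∈ (P.chartFunctor.obj τ).basicOpen (P.pullChart τ le_rfl (P.chartMonomial τ w)) := by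
    rw [pullChart, Scheme.basicOpen_appLE]
    exact ⟨trivial, hx⟩
  rw [chartMonomial, pullChart_chartSections] at h1
  have h2 := basicOpen_eq_of_affine (R := CommRingCat.of (P.chartRing τ))
    (AddMonoidAlgebra.single w (1 : ℂ))
  have h3 : (z : PrimeSpectrum (P.chartRing τ)) ∈
    (PrimeSpectrum.basicOpen (AddMonoidAlgebra.single w (1 : ℂ)) : Set (PrimeSpectrum (P.chartRing τ))) :=
    h2.le h1
  let _ := (P.chartMap h).toRingHom.toAlgebra
  have := P.isLocalization h w hw hw'
  have hrange := PrimeSpectrum.localization_away_comap_range (P.chartRing ρ)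
      (AddMonoidAlgebra.single w (1 : ℂ))
  rw [← hrange] at h3
  obtain ⟨t, rfl⟩ := h3
  refine ⟨t, ?_⟩
  exact congrArg (fun g : P.chartFunctor.obj ρ ⟶ P.X ↦ g t) (P.chart_comp h).symm

theorem isClosed_divisor (i : P.Facet) : IsClosed (P.divisor i) := by
  have h : P.divisor i = (⋃ σ : {σ : P.Face // i ∉ σ.1}, (P.affineOpen σ.1 : Set P.X))ᶜ := by
    apply Set.ext
    intro x
    rw [Set.mem_compl_iff, Set.mem_iUnion, not_exists]
    exact ⟨fun hx σ ↦ hx σ.1 σ.2, fun hx σ hσ ↦ hx ⟨σ, hσ⟩⟩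
  rw [h, isClosed_compl_iff]
  exact isOpen_iUnion fun σ ↦ (P.affineOpen σ.1).isOpen

theorem mem_basicOpen_resFun {V V' : P.X.Opens} (h : V' ≤ V) (f : Γ(P.X, V)) {x : P.X}
    (hx : x ∈ P.X.basicOpen (P.X.resFun h f)) : x ∈ P.X.basicOpen f :=
  ((P.X.basicOpen_res f (homOfLE h).op).le hx).2

/-- In the chart of a cell that avoids the facet, the point would lie in the torus, where $\chi^w$
is invertible; but $\chi^w$ generates the prime ideal of this point. -/
theorem divisorPoint_mem_divisor (i : P.Facet) : P.divisorPoint i ∈ P.divisor i := by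
  intro τ hτ hmem
  have hT : P.divisorPoint i ∈ P.affineOpen (P.facetCell i ⊓ τ) := by
    rw [← affineOpen_inf]
    exact ⟨P.divisorPoint_mem i, hmem⟩
  have hle : P.facetCell i ⊓ τ ≤ P.interiorCell := fun j hj ↦ by
    obtain ⟨h1, h2⟩ := P.mem_inf.1 hj
    rw [P.mem_facetCell.1 h1] at h2
    exact absurd h2 hτ
  obtain ⟨w, hw, -⟩ := P.exists_weight_facet (P.mem_facetCell.2 (rfl : i = i))
  have hb : P.X.basicOpen (P.X.resFun (P.torus_le (P.facetCell i))
      (P.chartMonomial (P.facetCell i) w)) = P.torus := by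
    rw [resFun_chartMonomial]
    exact P.X.basicOpen_of_isUnit (P.isUnit_monomial w.1)
  have hu : P.divisorPoint i ∈ P.X.basicOpen (P.chartMonomial (P.facetCell i) w) :=
    P.mem_basicOpen_resFun (P.torus_le _) _ (hb.ge (P.affineOpen_mono hle hT))
  refine (Scheme.mem_basicOpen_fromSpec _ _ _).1 hu ?_
  change _ ∈ P.facetIdeal i
  rw [P.facetIdeal_eq_span w hw]
  exact Ideal.mem_span_singleton_self _

/-- A function that vanishes at the generic point of the divisor restricts to the kernel of
`orbitMap`, which detects all coefficients with pairing zero. -/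
theorem pair_neg_of_notMem_basicOpen {τ : P.Face} {i : P.Facet} (hi : i ∈ τ.1) (a : P.chartRing τ)
    (h : P.divisorPoint i ∉ P.X.basicOpen (P.chartSections τ a)) (u : P.dualMonoid τ)
    (hu : a.coeff u ≠ 0) : P.pair u.1 i < 0 := by
  have hle := P.facetCell_le hi
  have h' : P.divisorPoint i ∉ P.X.basicOpen
      (P.chartSections (P.facetCell i) (P.chartMap hle a)) := by
    intro h'
    rw [← P.resFun_chartSections hle] at h'
    exact h (P.mem_basicOpen_resFun _ _ h')
  rw [divisorPoint, Scheme.mem_basicOpen_fromSpec, not_not] at h'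
  have h0 := P.chartSections_mem_facetIdeal.1 h'
  rcases (u.2 i hi).lt_or_eq with h | h
  · exact h
  have h1 := P.coeff_orbitMap i (P.chartMap hle a)
    (AddSubmonoid.inclusion (P.dualMonoid_anti hle) u) h
  rw [h0] at h1
  refine absurd ?_ hu
  have h2 : (P.chartMap hle a).coeff (AddSubmonoid.inclusion (P.dualMonoid_anti hle) u) =
      a.coeff u := by
    change (AddMonoidAlgebra.mapDomain _ a).coeff _ = _
    rw [AddMonoidAlgebra.coeff_mapDomain]
    exact Finsupp.mapDomain_apply (AddSubmonoid.inclusion_injective _) _ _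
  rw [← h2, ← h1]
  rfl

/-- If a basic neighbourhood of $x$ missed the generic point, its function would be divisible by the
monomial $\chi^w$ with pairing $-1$ at $i$ only. Then $\chi^w$ is nonzero at $x$, which puts $x$
into the chart of a cell off the facet $i$, contrary to $x\in D_i$. -/
theorem mem_of_isOpen_of_mem_divisor {i : P.Facet} {x : P.X} (hx : x ∈ P.divisor i)
    {O : P.X.Opens} (hxO : x ∈ O) : P.divisorPoint i ∈ O := by
  classical
  obtain ⟨τ, hτ⟩ := P.exists_mem_affineOpen x
  have hi : i ∈ τ.1 := by
    by_contra h
    exact hx τ h hτ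
  obtain ⟨f, hfO, hxf⟩ := (P.isAffineOpen_affineOpen τ).exists_basicOpen_le (V := O) ⟨x, hxO⟩ hτ
  refine hfO ?_
  by_contra hη
  obtain ⟨a, rfl⟩ := (P.chartSections τ).surjective f
  obtain ⟨w, hw, hw'⟩ := P.exists_weight_facet hi
  obtain ⟨b, rfl⟩ := P.dvd_of_pair_neg w hw hw' (P.pair_neg_of_notMem_basicOpen hi a hη)
  rw [map_mul, Scheme.basicOpen_mul] at hxf
  obtain ⟨ρ, hρ⟩ := P.exists_face_of_subset τ (Finset.erase_subset i τ.1)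
  refine hx ρ (by rw [hρ]; simp) (P.basicOpen_chartMonomial_le (τ := τ) (w := w) ?_ ?_ ?_ hxf.1)
  · intro j hj
    rw [hρ] at hj
    exact Finset.mem_of_mem_erase hj
  · intro j hj
    rw [hρ] at hj
    exact hw' j (Finset.mem_of_mem_erase hj) (Finset.ne_of_mem_erase hj)
  · intro j hj hj'
    rw [hρ, Finset.mem_erase, not_and_or, not_not] at hj'
    rw [hj'.resolve_right (not_not.2 hj), hw]
    norm_num

theorem isGenericPoint_divisorPoint (i : P.Facet) :
    IsGenericPoint (P.divisorPoint i) (P.divisor i) := by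
  apply Set.Subset.antisymm
  · exact (P.isClosed_divisor i).closure_subset_iff.2
      (Set.singleton_subset_iff.2 (P.divisorPoint_mem_divisor i))
  · intro x hx
    rw [mem_closure_iff]
    intro O hO hxO
    exact ⟨P.divisorPoint i, P.mem_of_isOpen_of_mem_divisor hx (O := ⟨O, hO⟩) hxO, rfl⟩

/-- The order of a section over the torus in terms of a frame over the chart of a facet. -/
theorem hasOrderAt_divisorPoint {L : P.X.Modules} {i : P.Facet}
    {f : Γ(L, P.affineOpen (P.facetCell i))} (hf : L.IsGenerator f) (v : Fin n → ℤ) :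
    L.HasOrderAt (P.monomial v • L.resSec (P.torus_le (P.facetCell i)) f) (P.divisorPoint i)
      (- P.pair v i) := by
  obtain ⟨w, hw, -⟩ := P.exists_weight_facet (P.mem_facetCell.2 (rfl : i = i))
  have hv : ∀ j ∈ (P.facetCell i).1, P.pair (v + P.pair v i • w.1) j = 0 := by
    intro j hj
    rw [P.mem_facetCell.1 hj, pair_add, pair_zsmul, hw]
    ring
  -- With $c=\langle v,\nu_i\rangle$ and $\varpi=\chi^w$, one has $\chi^v=\chi^{v+cw}\varpi^{-c}$,
  -- where $\chi^{v+cw}$ is a unit. The exponents are the positive and negative parts of $c$, on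
  -- opposite sides of the equation.
  refine ⟨_, P.divisorPoint_mem i, f, P.chartMonomial _ w,
    P.chartMonomial _ ⟨v + P.pair v i • w.1, fun j hj ↦ (hv j hj).le⟩,
    (P.pair v i).toNat, (- P.pair v i).toNat, hf, P.isUnit_chartMonomial _ hv,
    Scheme.maximalIdeal_stalk_eq _ _ (P.facetIdeal_eq_span w hw), by omega, ?_⟩
  have hres : ∀ g : Γ(P.X, P.affineOpen (P.facetCell i)), P.X.presheaf.map (homOfLE
      (inf_le_left : P.affineOpen (P.facetCell i) ⊓ P.torus ≤ P.affineOpen (P.facetCell i))).op g =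
      P.X.resFun (inf_le_right : P.affineOpen (P.facetCell i) ⊓ P.torus ≤ P.torus)
        (P.X.resFun (P.torus_le (P.facetCell i)) g) :=
    fun g ↦ (Scheme.resFun_resFun _ _ g).symm
  rw [hres, hres, Scheme.Modules.resSec_smul_resFun, smul_smul, ← map_mul,
    Scheme.Modules.resSec_resSec]
  congr 2
  rw [map_pow, map_mul, map_pow, resFun_chartMonomial, resFun_chartMonomial, ← monomial_nsmul,
    ← monomial_nsmul, ← monomial_add, ← monomial_add]
  congr 1
  funext k
  simp only [Pi.add_apply, Pi.smul_apply, ← natCast_zsmul, smul_eq_mul]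
  have h : (((P.pair v i).toNat : ℕ) : ℤ) = P.pair v i + ((- P.pair v i).toNat : ℕ) := by omega
  rw [h]
  ring

/-- The uniformizer is the germ of a nonzero monomial, and germs are injective on an integral
scheme. This excludes the degenerate case in which orders are not unique. -/
theorem maximalIdeal_stalk_divisorPoint_ne_bot (i : P.Facet) :
    IsLocalRing.maximalIdeal (P.X.presheaf.stalk (P.divisorPoint i)) ≠ ⊥ := by
  obtain ⟨w, hw, -⟩ := P.exists_weight_facet (P.mem_facetCell.2 (rfl : i = i))
  rw [divisorPoint, Scheme.maximalIdeal_stalk_eq _ _ (P.facetIdeal_eq_span w hw), Ne,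
    Ideal.span_singleton_eq_bot]
  intro h
  have h0 : P.chartMonomial (P.facetCell i) w = 0 := by
    refine germ_injective_of_isIntegral _ _ (P.divisorPoint_mem i) ?_
    rw [map_zero]
    exact h
  have := congrArg (P.X.resFun (P.torus_le (P.facetCell i))) h0
  rw [resFun_chartMonomial, map_zero] at this
  have h1 := P.laurent_bijective.1 (this.trans (map_zero P.laurent).symm)
  simpa using congrArg (fun p ↦ p.coeff w.1) h1

theorem hasOrderAlong_iff {L : P.X.Modules} {i : P.Facet}
    {f : Γ(L, P.affineOpen (P.facetCell i))} (hf : L.IsGenerator f) (v : Fin n → ℤ) (m : ℤ) :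
    P.HasOrderAlong L (P.monomial v • L.resSec (P.torus_le (P.facetCell i)) f) i m ↔
      P.pair v i = -m := by
  have h := P.hasOrderAt_divisorPoint hf v
  constructor
  · rintro ⟨η, hη, hm⟩
    rw [hη.eq (P.isGenericPoint_divisorPoint i)] at hm
    have := h.unique P.genericPoint_mem_torus (P.maximalIdeal_stalk_divisorPoint_ne_bot i) hm
    omega
  · intro hm
    refine ⟨_, P.isGenericPoint_divisorPoint i, ?_⟩
    have hm' : m = - P.pair v i := by omega
    rw [hm']
    exact h

end SmoothPolytope

/-! ### Morphisms of line bundles -/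

namespace AlgebraicGeometry.Scheme

variable {X : Scheme.{0}} [IsIntegral X] {L : X.Modules}

theorem Modules.IsGenerator.resSec_injective {V T : X.Opens} {e : Γ(L, V)} (he : L.IsGenerator e)
    (hT : genericPoint X ∈ T) : Function.Injective (L.resSec (inf_le_left : V ⊓ T ≤ V)) := by
  intro x y hxy
  rcases isEmpty_or_nonempty V with hV | ⟨⟨z, hz⟩⟩
  -- An empty `V` does not contain the generic point; there the empty cover shows that all sections
  -- agree.
  · refine L.eq_of_resSec_eq (ι := Empty) (fun i ↦ i.elim) (fun i ↦ i.elim) (fun z hz ↦ ?_)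
      fun i ↦ i.elim
    exact hV.elim ⟨z, hz⟩
  · obtain ⟨f, rfl⟩ := he.exists_smul_eq x
    obtain ⟨g, rfl⟩ := he.exists_smul_eq y
    rw [Modules.resSec_smul_resFun, Modules.resSec_smul_resFun] at hxy
    rw [resFun_injective (⟨genericPoint_mem hz, hT⟩ : genericPoint X ∈ V ⊓ T) _
      ((he.resSec _).smul_cancel hxy)]

end AlgebraicGeometry.Scheme

namespace SmoothPolytope

variable {n : ℕ} (P : SmoothPolytope n)

/-- A section of `M` defines a morphism from a module with a frame. -/
theorem exists_homSections {L M : P.X.Modules} {U : P.X.Opens} {f : Γ(L, U)}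
    (hf : L.IsGenerator f) (g : Γ(M, U)) :
    ∃ φ : P.homSections L M U, ∀ (V) (hV : V ≤ U) (a : Γ(P.X, V)),
      φ.1 ⟨V, hV⟩ (a • L.resSec hV f) = a • M.resSec hV g := by
  let r : ∀ V : {V : P.X.Opens // V ≤ U}, Γ(L, V.1) → Γ(P.X, V.1) := fun V ↦
    (Equiv.ofBijective _ (hf V.1 V.2)).symm
  have hr : ∀ V x, r V x • L.resSec V.2 f = x := fun V ↦
    (Equiv.ofBijective _ (hf V.1 V.2)).apply_symm_apply
  have hr' : ∀ V a, r V (a • L.resSec V.2 f) = a := fun V ↦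
    (Equiv.ofBijective _ (hf V.1 V.2)).symm_apply_apply
  have hadd : ∀ V x y, r V (x + y) = r V x + r V y := fun V x y ↦ by
    refine (hf V.1 V.2).1 ?_
    change r V (x + y) • _ = (r V x + r V y) • _
    rw [add_smul, hr, hr, hr]
  have hsmul : ∀ V (a : Γ(P.X, V.1)) x, r V (a • x) = a * r V x := fun V a x ↦ by
    refine (hf V.1 V.2).1 ?_
    change r V (a • x) • _ = (a * r V x) • _
    rw [mul_smul, hr, hr]
  refine ⟨⟨fun V ↦
    { toFun := fun x ↦ r V x • M.resSec V.2 g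
      map_add' := fun x y ↦ by rw [hadd, add_smul]
      map_smul' := fun c x ↦ by
        rw [smul_def, hsmul, mul_smul]
        rfl }, fun V a x ↦ ?_, fun V V' h x ↦ ?_⟩, fun V hV a ↦ ?_⟩
  · change r V (a • x) • M.resSec V.2 g = a • (r V x • M.resSec V.2 g)
    rw [hsmul, mul_smul]
  · change r V' (L.resSec h x) • _ = M.resSec h (r V x • _)
    rw [Scheme.Modules.resSec_smul_resFun, Scheme.Modules.resSec_resSec]
    congr 1
    rw [← hr' V' (P.X.resFun h (r V x))]
    congr 1
    conv_lhs => rw [← hr V x]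
    rw [Scheme.Modules.resSec_smul_resFun, Scheme.Modules.resSec_resSec]
  · exact congrArg (· • M.resSec hV g) (hr' ⟨V, hV⟩ a)

/-- Morphisms of line bundles are determined by their restriction to the torus. -/
theorem homSections_ext {L M : P.X.Modules} {U : P.X.Opens} (hU : P.torus ≤ U) {f : Γ(L, P.torus)}
    (hf : L.IsGenerator f) {g : Γ(M, U)} (hg : M.IsGenerator g) {φ ψ : P.homSections L M U}
    (h : φ.1 ⟨P.torus, hU⟩ f = ψ.1 ⟨P.torus, hU⟩ f) : φ = ψ := by
  refine Subtype.ext (funext fun V ↦ LinearMap.ext fun x ↦ ?_)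
  refine (hg.resSec V.2).resSec_injective P.genericPoint_mem_torus ?_
  have hle : V.1 ⊓ P.torus ≤ U := inf_le_left.trans V.2
  rw [← φ.2.2 V ⟨_, hle⟩ inf_le_left, ← ψ.2.2 V ⟨_, hle⟩ inf_le_left]
  obtain ⟨a, ha⟩ := (hf.resSec (inf_le_right : V.1 ⊓ P.torus ≤ P.torus)).exists_smul_eq
    (L.resSec (inf_le_left : V.1 ⊓ P.torus ≤ V.1) x)
  rw [ha, φ.2.1, ψ.2.1, φ.2.2 ⟨_, hU⟩ ⟨_, hle⟩, ψ.2.2 ⟨_, hU⟩ ⟨_, hle⟩, h]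

/-- The morphisms of line bundles over the chart of a cell, in terms of Laurent polynomials. -/
theorem exists_homSections_iff {L M : P.X.Modules} {eL : Γ(L, P.torus)} {eM : Γ(M, P.torus)}
    {σ : P.Face} {mL mM : Fin n → ℤ} {fL : Γ(L, P.affineOpen σ)} {fM : Γ(M, P.affineOpen σ)}
    (hfL : L.IsGenerator fL) (hfM : M.IsGenerator fM)
    (hL : eL = P.monomial mL • L.resSec (P.torus_le σ) fL)
    (hM : eM = P.monomial mM • M.resSec (P.torus_le σ) fM) (p : AddMonoidAlgebra ℂ (Fin n → ℤ)) :
    (∃ φ : P.homSections L M (P.affineOpen σ),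
      φ.1 ⟨P.torus, P.torus_le σ⟩ eL = P.laurent p • eM) ↔
      ∀ u, p.coeff u ≠ 0 → ∀ i ∈ σ.1, P.pair u i + P.pair mM i - P.pair mL i ≤ 0 := by
  have h1 : (∃ φ : P.homSections L M (P.affineOpen σ),
      φ.1 ⟨P.torus, P.torus_le σ⟩ eL = P.laurent p • eM) ↔
      ∃ a, P.X.resFun (P.torus_le σ) a =
        P.laurent (p * AddMonoidAlgebra.single (mM - mL) 1) := by
    -- A morphism is $f_L\mapsto a f_M$ in the local frames. Over the torus this means
    -- $a=p\,\chi^{m_M-m_L}$, so the question is whether this Laurent polynomial extends to the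
    -- chart.
    have hcalc : ∀ a : Γ(P.X, P.affineOpen σ),
        P.monomial mL • (P.X.resFun (P.torus_le σ) a • M.resSec (P.torus_le σ) fM) =
          P.laurent p • eM ↔
        P.X.resFun (P.torus_le σ) a = P.laurent (p * AddMonoidAlgebra.single (mM - mL) 1) := by
      intro a
      rw [map_mul]
      change _ ↔ _ = P.laurent p * P.monomial (mM - mL)
      rw [hM, smul_smul, smul_smul, (hfM.resSec (P.torus_le σ)).bijective.1.eq_iff]
      have hm : P.monomial mM = P.monomial mL * P.monomial (mM - mL) := by
        rw [← monomial_add, add_sub_cancel]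
      rw [hm, mul_left_comm]
      exact (P.isUnit_monomial mL).mul_right_inj
    constructor
    · rintro ⟨φ, hφ⟩
      obtain ⟨a, ha⟩ := hfM.exists_smul_eq (φ.1 ⟨_, le_rfl⟩ fL)
      refine ⟨a, (hcalc a).1 ?_⟩
      rw [← hφ, hL, φ.2.1, φ.2.2 ⟨_, le_rfl⟩ ⟨_, P.torus_le σ⟩, ha,
        Scheme.Modules.resSec_smul_resFun]
    · rintro ⟨a, ha⟩
      obtain ⟨φ, hφ⟩ := P.exists_homSections hfL (a • fM)
      refine ⟨φ, ?_⟩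
      rw [← (hcalc a).2 ha, hL, hφ, Scheme.Modules.resSec_smul_resFun]
  rw [h1, exists_resFun_eq_laurent_iff]
  have hpair : ∀ u i, P.pair (u + (mM - mL)) i = P.pair u i + P.pair mM i - P.pair mL i := by
    intro u i
    rw [pair_add, pair_sub]
    ring
  constructor
  · intro h u hu i hi
    rw [← hpair]
    refine h _ ?_ i hi
    rwa [AddMonoidAlgebra.coeff_mul_single_eq_coeff_mul u fun _ _ ↦ add_left_inj _, mul_one]
  · intro h u hu i hi
    have hu' : u = (u - (mM - mL)) + (mM - mL) := (sub_add_cancel _ _).symm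
    rw [hu', hpair]
    refine h _ ?_ i hi
    rw [hu', AddMonoidAlgebra.coeff_mul_single_eq_coeff_mul (u - (mM - mL)) fun _ _ ↦ add_left_inj _,
      mul_one] at hu
    exact hu

/-- The negative of the order along the divisor of a facet of a frame over the torus. -/
def poleOrder {L : P.X.Modules} (hL : L.IsInvertible) {e : Γ(L, P.torus)} (he : L.IsGenerator e)
    (i : P.Facet) : ℤ := P.pair (P.exists_frame hL he (P.facetCell i)).choose i

theorem pair_eq_poleOrder {L : P.X.Modules} (hL : L.IsInvertible) {e : Γ(L, P.torus)}
    (he : L.IsGenerator e) {σ : P.Face} {m : Fin n → ℤ} {f : Γ(L, P.affineOpen σ)}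
    (hf : L.IsGenerator f) (h : e = P.monomial m • L.resSec (P.torus_le σ) f) {i : P.Facet}
    (hi : i ∈ σ.1) : P.pair m i = P.poleOrder hL he i := by
  obtain ⟨f', hf', h'⟩ := (P.exists_frame hL he (P.facetCell i)).choose_spec
  exact P.pair_eq_of_frame hf hf' h h' hi (P.mem_facetCell.2 rfl)

theorem hasOrderAlong_monomial_smul_iff {L : P.X.Modules} (hL : L.IsInvertible) {e : Γ(L, P.torus)}
    (he : L.IsGenerator e) (u : Fin n → ℤ) (i : P.Facet) (m : ℤ) :
    P.HasOrderAlong L (P.monomial u • e) i m ↔ P.poleOrder hL he i + P.pair u i = -m := by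
  obtain ⟨k, f, hf, h⟩ := P.exists_frame hL he (P.facetCell i)
  rw [← P.pair_eq_poleOrder hL he hf h (P.mem_facetCell.2 rfl), h, smul_smul, ← monomial_add,
    P.hasOrderAlong_iff hf, pair_add, add_comm]

theorem exists_homSections_affineOpen_iff {L M : P.X.Modules} (hL : L.IsInvertible)
    (hM : M.IsInvertible) {eL : Γ(L, P.torus)} {eM : Γ(M, P.torus)} (heL : L.IsGenerator eL)
    (heM : M.IsGenerator eM) {U : P.X.Opens} (hT : P.torus ≤ U) {σ : P.Face}
    (hU : U = P.affineOpen σ) (p : AddMonoidAlgebra ℂ (Fin n → ℤ)) :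
    (∃ φ : P.homSections L M U, φ.1 ⟨P.torus, hT⟩ eL = P.laurent p • eM) ↔
      ∀ u, p.coeff u ≠ 0 → ∀ i ∈ σ.1,
        P.poleOrder hM heM i - P.poleOrder hL heL i + P.pair u i ≤ 0 := by
  subst hU
  obtain ⟨mL, fL, hfL, hL'⟩ := P.exists_frame hL heL σ
  obtain ⟨mM, fM, hfM, hM'⟩ := P.exists_frame hM heM σ
  rw [P.exists_homSections_iff hfL hfM hL' hM']
  refine forall_congr' fun u ↦ imp_congr_right fun _ ↦ forall_congr' fun i ↦ forall_congr' fun hi ↦ ?_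
  rw [P.pair_eq_poleOrder hL heL hfL hL' hi, P.pair_eq_poleOrder hM heM hfM hM' hi]
  constructor <;> intro h <;> linarith

variable {N : ℕ} (σ : Fin N ≃ P.Face)

/-- Iterated meets: $U_s$ is again the chart of a cell, so everything proved for charts applies to
intersections. -/
theorem exists_affineInter_eq {s : Finset (Fin N)} (hs : s.Nonempty) : ∃ τ : P.Face,
    P.affineInter σ s = P.affineOpen τ ∧ ∀ i, i ∈ τ.1 ↔ ∀ k ∈ s, i ∈ (σ k).1 := by
  induction hs using Finset.Nonempty.cons_induction with
  | singleton k => exact ⟨σ k, by simp [affineInter], by simp⟩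
  | cons k s hk hs ih =>
    obtain ⟨τ, hτ, hτ'⟩ := ih
    refine ⟨σ k ⊓ τ, ?_, fun i ↦ ?_⟩
    · rw [affineInter, Finset.inf_cons, ← affineOpen_inf, ← hτ]
      rfl
    · rw [mem_inf, hτ']
      simp

end SmoothPolytope

/-! ### The functor -/

theorem CechSystem.dFun_empty {K : Type} [LinearOrder K] {S : CechSystem.{u, v} K} {X Y : S.Obj}
    (f : ∀ s : Finset K, S.Hom s X Y) : dFun X Y f ∅ = 0 := by
  rw [dFun_apply, Finset.sum_empty]

namespace SmoothPolytope

variable {n : ℕ} (P : SmoothPolytope n)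

theorem laurent_smul (c : ℂ) (p : AddMonoidAlgebra ℂ (Fin n → ℤ)) :
    P.laurent (c • p) = P.scalar P.torus c * P.laurent p := by
  rw [scalar_torus, ← map_mul]
  refine congrArg P.laurent (AddMonoidAlgebra.ext (Finsupp.ext fun u ↦ ?_))
  rw [AddMonoidAlgebra.coeff_single_zero_mul]
  rfl

variable {P} in
/-- A frame over the torus identifies sections with Laurent polynomials. -/
def frameEquiv {M : P.X.Modules} {e : Γ(M, P.torus)} (he : M.IsGenerator e) :
    AddMonoidAlgebra ℂ (Fin n → ℤ) ≃ₗ[ℂ] Γ(M, P.torus) :=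
  LinearEquiv.ofBijective
    { toFun := fun p ↦ P.laurent p • e
      map_add' := fun p q ↦ by rw [map_add, add_smul]
      map_smul' := fun c p ↦ by
        rw [laurent_smul, mul_smul]
        rfl }
    (he.bijective.comp P.laurent_bijective)

theorem frameEquiv_apply {M : P.X.Modules} {e : Γ(M, P.torus)} (he : M.IsGenerator e)
    (p : AddMonoidAlgebra ℂ (Fin n → ℤ)) : frameEquiv he p = P.laurent p • e := rfl

variable {N : ℕ} (σ : Fin N ≃ P.Face) {e : ∀ L : P.LineBundle, Γ(L.1, P.torus)}
  (he : ∀ L : P.LineBundle, L.1.IsGenerator (e L))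

/-- The negatives of the orders of the chosen frame of a line bundle along the toric divisors. -/
def height₀ (L : P.LineBundle) : P.Facet → ℤ := P.poleOrder L.2 (he L)

/-- The Laurent polynomial of a morphism of line bundles. -/
def coeffHom (s : Finset (Fin N)) (L M : P.LineBundle) :
    P.homSections L.1 M.1 (P.affineInter σ s) →ₗ[ℂ] AddMonoidAlgebra ℂ (Fin n → ℤ) where
  toFun φ := (frameEquiv (he M)).symm (P.onTorus σ φ (e L))
  map_add' φ ψ := (frameEquiv (he M)).symm.map_add (P.onTorus σ φ (e L)) (P.onTorus σ ψ (e L))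
  map_smul' c φ := (frameEquiv (he M)).symm.map_smul c (P.onTorus σ φ (e L))

theorem coeffHom_eq_iff {s : Finset (Fin N)} {L M : P.LineBundle}
    {φ : P.homSections L.1 M.1 (P.affineInter σ s)} {p : AddMonoidAlgebra ℂ (Fin n → ℤ)} :
    P.coeffHom σ he s L M φ = p ↔ P.onTorus σ φ (e L) = P.laurent p • e M := by
  rw [← P.frameEquiv_apply (he M)]
  exact (frameEquiv (he M)).symm_apply_eq

theorem onTorus_eq {s : Finset (Fin N)} {L M : P.LineBundle}
    (φ : P.homSections L.1 M.1 (P.affineInter σ s)) :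
    P.onTorus σ φ (e L) = P.laurent (P.coeffHom σ he s L M φ) • e M :=
  (P.coeffHom_eq_iff σ he).1 rfl

theorem coeffHom_homRes {s t : Finset (Fin N)} (h : s ⊆ t) {L M : P.LineBundle}
    (φ : P.homSections L.1 M.1 (P.affineInter σ s)) :
    P.coeffHom σ he t L M (homRes (P.affineInter_anti σ h) φ) = P.coeffHom σ he s L M φ := rfl

theorem coeffHom_one (s : Finset (Fin N)) (L : P.LineBundle) :
    P.coeffHom σ he s L L ((P.lineBundleSystem σ).one s L) = 1 := by
  refine (P.coeffHom_eq_iff σ he).2 ?_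
  rw [map_one, one_smul]
  rfl

theorem coeffHom_comp {s : Finset (Fin N)} {L M K : P.LineBundle}
    (φ : P.homSections L.1 M.1 (P.affineInter σ s)) (ψ : P.homSections M.1 K.1 (P.affineInter σ s)) :
    P.coeffHom σ he s L K (homComp L.1 M.1 K.1 _ φ ψ) =
      P.coeffHom σ he s L M φ * P.coeffHom σ he s M K ψ := by
  rw [coeffHom_eq_iff]
  change P.onTorus σ ψ (P.onTorus σ φ (e L)) = _
  rw [P.onTorus_eq σ he φ, onTorus, ψ.2.1, map_mul, mul_smul]
  exact congrArg (P.laurent _ • ·) (P.onTorus_eq σ he ψ)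

/-- The Laurent polynomials of morphisms over `U_s`. -/
def admissible (L M : P.LineBundle) (s : Finset (Fin N)) :
    AddSubgroup (AddMonoidAlgebra ℂ (Fin n → ℤ)) where
  carrier := {p | ∀ u, p.coeff u ≠ 0 → ∀ i, (∀ k ∈ s, i ∈ (σ k).1) →
    P.height₀ he M i - P.height₀ he L i + P.pair u i ≤ 0}
  zero_mem' u hu := absurd rfl hu
  add_mem' {p q} hp hq u hu := by
    by_cases h : p.coeff u = 0
    · refine hq u fun h' ↦ hu ?_
      change p.coeff u + q.coeff u = 0
      rw [h, h', add_zero]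
    · exact hp u h
  neg_mem' {p} hp u hu := hp u fun h ↦ hu (by
    change - p.coeff u = 0
    rw [h, neg_zero])

theorem exists_coeffHom_eq_iff {L M : P.LineBundle} {s : Finset (Fin N)} (hs : s.Nonempty)
    {p : AddMonoidAlgebra ℂ (Fin n → ℤ)} :
    (∃ φ, P.coeffHom σ he s L M φ = p) ↔ p ∈ P.admissible σ he L M s := by
  obtain ⟨τ, hτ, hτ'⟩ := P.exists_affineInter_eq σ hs
  simp only [coeffHom_eq_iff]
  refine (P.exists_homSections_affineOpen_iff L.2 M.2 (he L) (he M)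
    (P.torus_le_affineInter σ s) hτ p).trans ?_
  refine forall_congr' fun u ↦ imp_congr_right fun _ ↦ forall_congr' fun i ↦ ?_
  rw [hτ']
  rfl

theorem coeffHom_injective {L M : P.LineBundle} {s : Finset (Fin N)} (hs : s.Nonempty) :
    Function.Injective (P.coeffHom σ he s L M) := by
  intro φ ψ h
  obtain ⟨τ, hτ, -⟩ := P.exists_affineInter_eq σ hs
  have hg : ∃ g : Γ(M.1, P.affineInter σ s), M.1.IsGenerator g := by
    rw [hτ]
    exact P.exists_isGenerator M.2 τ
  obtain ⟨g, hg⟩ := hg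
  exact P.homSections_ext (P.torus_le_affineInter σ s) (he L) hg
    ((frameEquiv (he M)).symm.injective h)

/-- Restriction to the chart of a cell below all cells of `s` gives a bound which also covers `s =
∅`, where $U_s$ is all of $X$ and need not be a chart. -/
theorem pair_le_of_coeffHom {L M : P.LineBundle} {s : Finset (Fin N)}
    (φ : P.homSections L.1 M.1 (P.affineInter σ s)) {τ : P.Face} (hτ : ∀ k ∈ s, τ ≤ σ k)
    {u : Fin n → ℤ} (hu : (P.coeffHom σ he s L M φ).coeff u ≠ 0) {i : P.Facet} (hi : i ∈ τ.1) :
    P.height₀ he M i - P.height₀ he L i + P.pair u i ≤ 0 := by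
  have hle : P.affineOpen τ ≤ P.affineInter σ s :=
    Finset.le_inf fun k hk ↦ P.affineOpen_mono (hτ k hk)
  exact (P.exists_homSections_affineOpen_iff L.2 M.2 (he L) (he M) (P.torus_le τ) rfl _).1
    ⟨homRes hle φ, P.onTorus_eq σ he φ⟩ u hu i hi

/-- Laurent polynomials as constant functions. -/
def constLaurent (R : Set (Fin n → ℝ)) : AddMonoidAlgebra ℂ (Fin n → ℤ) →ₐ[ℂ]
    AddMonoidAlgebra (R → ℂ) (Fin n → ℤ) :=
  AddMonoidAlgebra.mapAlgHom (Fin n → ℤ) (Pi.constAlgHom ℂ R ℂ)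

theorem coeff_constLaurent (R : Set (Fin n → ℝ)) (p : AddMonoidAlgebra ℂ (Fin n → ℤ))
    (u : Fin n → ℤ) : (constLaurent R p).coeff u = fun _ ↦ p.coeff u := by
  rw [constLaurent, AddMonoidAlgebra.coeff_mapAlgHom]
  rfl

theorem constLaurent_injective {R : Set (Fin n → ℝ)} (hR : R.Nonempty) :
    Function.Injective (constLaurent R) := by
  intro p q h
  refine AddMonoidAlgebra.ext (Finsupp.ext fun u ↦ ?_)
  have := congrArg (fun r ↦ r.coeff u) h
  simp only [coeff_constLaurent] at this
  exact congrFun this ⟨_, hR.some_mem⟩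

variable {W : P.Face → Set (Fin n → ℝ)}

/-- The cell of a point $x\in W_s$ lies below every $\sigma_k$, since $W_k$ is contained in the open
star. So a nonzero coefficient of $\chi^u$ forces $H_M-H_L+u\le0$ on all facets through $x$. -/
theorem constLaurent_mem (hW : P.IsCellularCover W) {L M : P.LineBundle} {s : Finset (Fin N)}
    (φ : P.homSections L.1 M.1 (P.affineInter σ s)) :
    constLaurent (P.region σ W s) (P.coeffHom σ he s L M φ) ∈
      P.gradedSections (P.height₀ he M - P.height₀ he L) (P.region σ W s) := by
  intro u
  rw [coeff_constLaurent]
  refine ⟨IsLocallyConstant.const _, ?_⟩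
  rintro x ⟨i, hi, hx⟩
  by_contra hu
  obtain ⟨τ, hτ⟩ := P.active_mem_face hx.1
  refine hi.not_ge (P.pair_le_of_coeffHom σ he φ (τ := τ) (fun k hk ↦ ?_) hu ?_)
  · have := (hW.subset_openStar _ (x.2.2 k hk)).2
    rw [← hτ] at this
    exact this
  · rw [hτ]
    exact P.mem_active.2 (P.mem_facet.1 hx).2

variable (hW : P.IsCellularCover W)

/-- The Laurent polynomial of a morphism of line bundles over `U_s`, as a constant function on the
corresponding region of the polytope. -/
def constHom (s : Finset (Fin N)) (L M : P.LineBundle) :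
    P.homSections L.1 M.1 (P.affineInter σ s) →ₗ[ℂ]
      P.gradedSections (P.height₀ he M - P.height₀ he L) (P.region σ W s) :=
  LinearMap.codRestrict _
    ((constLaurent (P.region σ W s)).toLinearMap ∘ₗ P.coeffHom σ he s L M)
    fun φ ↦ P.constLaurent_mem σ he hW φ

theorem coe_constHom {s : Finset (Fin N)} {L M : P.LineBundle}
    (φ : P.homSections L.1 M.1 (P.affineInter σ s)) :
    (P.constHom σ he hW s L M φ).1 =
      constLaurent (P.region σ W s) (P.coeffHom σ he s L M φ) := rfl

theorem constHom_homRes {s t : Finset (Fin N)} (h : s ⊆ t) {L M : P.LineBundle}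
    (φ : P.homSections L.1 M.1 (P.affineInter σ s)) :
    P.constHom σ he hW t L M (homRes (P.affineInter_anti σ h) φ) =
      P.gradedRes _ (P.region_anti σ W h) (P.constHom σ he hW s L M φ) := by
  refine Subtype.ext (AddMonoidAlgebra.ext (Finsupp.ext fun u ↦ ?_))
  rw [coeff_gradedRes, coe_constHom, coe_constHom, coeff_constLaurent, coeff_constLaurent,
    P.coeffHom_homRes σ he h]
  rfl

theorem constHom_comp {s : Finset (Fin N)} {L M K : P.LineBundle}
    (φ : P.homSections L.1 M.1 (P.affineInter σ s)) (ψ : P.homSections M.1 K.1 (P.affineInter σ s)) :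
    P.constHom σ he hW s L K (homComp L.1 M.1 K.1 _ φ ψ) =
      P.gradedMul _ _ _ _ (P.constHom σ he hW s L M φ) (P.constHom σ he hW s M K ψ) := by
  refine Subtype.ext ?_
  change _ = (P.constHom σ he hW s L M φ).1 * (P.constHom σ he hW s M K ψ).1
  rw [coe_constHom, coe_constHom, coe_constHom, coeffHom_comp, map_mul]

theorem constHom_one (s : Finset (Fin N)) (L : P.LineBundle) :
    P.constHom σ he hW s L L ((P.lineBundleSystem σ).one s L) = P.gradedOne _ _ :=
  Subtype.ext ((congrArg (constLaurent _) (P.coeffHom_one σ he s L)).trans (map_one _))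

/-- The passage from line bundles to functions on the boundary of the polytope. -/
def coeffMorphism : CechSystem.Morphism (P.lineBundleSystem σ) (P.functionSystem σ W) where
  obj L := P.height₀ he L
  map s L M := P.constHom σ he hW s L M
  map_res h _ _ φ := P.constHom_homRes σ he hW h φ
  map_one s L := P.constHom_one σ he hW s L
  map_comp φ ψ := P.constHom_comp σ he hW φ ψ

variable {σ}

theorem region_eq (hW : P.IsCellularCover W) {s : Finset (Fin N)} (hs : s.Nonempty) :
    P.region σ W s = ⋂ τ ∈ s.map σ.toEmbedding, W τ := by
  ext x
  simp only [region, Set.mem_ofPred_eq, Set.mem_iInter, Finset.mem_map, Equiv.coe_toEmbedding,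
    forall_exists_index, and_imp, forall_apply_eq_imp_iff₂]
  refine ⟨fun h ↦ h.2, fun h ↦ ⟨?_, h⟩⟩
  obtain ⟨k, hk⟩ := hs
  exact (hW.subset_openStar _ (h k hk)).1

theorem region_nonempty_iff (hW : P.IsCellularCover W) {s : Finset (Fin N)} (hs : s.Nonempty) :
    (P.region σ W s).Nonempty ↔ CechSystem.core σ s = ∅ := by
  rw [P.region_eq hW hs, hW.nonempty_iff _ (hs.map)]
  constructor
  · intro h
    by_contra hne
    obtain ⟨x, hx⟩ := Finset.nonempty_iff_ne_empty.2 hne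
    obtain ⟨-, y, hy, -, z, hz, hyz, hzy⟩ := CechSystem.mem_core.1 hx
    rcases h.total (Finset.mem_coe.2 (Finset.mem_map_of_mem σ.toEmbedding hy))
      (Finset.mem_coe.2 (Finset.mem_map_of_mem σ.toEmbedding hz)) with h | h
    · exact hyz h
    · exact hzy h
  · intro h a ha b hb _
    obtain ⟨y, hy, rfl⟩ := Finset.mem_map.1 (Finset.mem_coe.1 ha)
    obtain ⟨z, hz, rfl⟩ := Finset.mem_map.1 (Finset.mem_coe.1 hb)
    by_contra hyz
    rw [not_or] at hyz
    exact (CechSystem.core_nonempty hy hz hyz.1 hyz.2).ne_empty h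

theorem eq_of_region_empty {s : Finset (Fin N)} (h : ¬ (P.region σ W s).Nonempty)
    {H : P.Facet → ℤ} (p q : P.gradedSections H (P.region σ W s)) : p = q :=
  Subtype.ext <| AddMonoidAlgebra.ext <| Finsupp.ext fun _ ↦ funext fun x ↦ absurd ⟨x.1, x.2⟩ h

/-- If the region is nonempty, it is connected, so coefficients are constants. It meets each facet
that contains all the cells of `s`, so vanishing on the positive part is exactly the condition for
the Laurent polynomial to come from a morphism. -/
theorem exists_constHom_eq {s : Finset (Fin N)} (hs : s.Nonempty) {L M : P.LineBundle}
    (q : P.gradedSections (P.height₀ he M - P.height₀ he L) (P.region σ W s)) :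
    ∃ φ, P.constHom σ he hW s L M φ = q := by
  by_cases hne : (P.region σ W s).Nonempty
  swap
  · exact ⟨0, P.eq_of_region_empty hne _ _⟩
  obtain ⟨x, hx⟩ := hne
  let p := AddMonoidAlgebra.mapAlgHom (Fin n → ℤ)
    (Pi.evalAlgHom ℂ (fun _ : P.region σ W s ↦ ℂ) ⟨x, hx⟩) q.1
  have hp : ∀ u, p.coeff u = q.1.coeff u ⟨x, hx⟩ := fun u ↦ AddMonoidAlgebra.coeff_mapAlgHom _ _ _
  have hconn : PreconnectedSpace (P.region σ W s) := by
    rw [P.region_eq hW hs]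
    exact Subtype.preconnectedSpace (hW.isPreconnected _ hs.map)
  have hq : ∀ u y, q.1.coeff u y = p.coeff u := fun u y ↦ by
    rw [hp]
    exact (q.2 u).1.apply_eq_of_preconnectedSpace _ _
  have hchain : IsChain (· ≤ ·) (s.map σ.toEmbedding : Set P.Face) :=
    (hW.nonempty_iff _ hs.map).1 (P.region_eq hW hs ▸ ⟨x, hx⟩)
  obtain ⟨φ, hφ⟩ := (P.exists_coeffHom_eq_iff σ he hs (L := L) (M := M) (p := p)).2 (by
    intro u hu i hi
    by_contra hpos
    obtain ⟨y, hy, hyi⟩ := hW.meets_facet _ hs.map hchain i fun τ hτ ↦ by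
      obtain ⟨k, hk, rfl⟩ := Finset.mem_map.1 hτ
      exact hi k hk
    rw [← P.region_eq hW hs] at hy
    refine hu ?_
    rw [← hq u ⟨y, hy⟩]
    exact (q.2 u).2 ⟨y, hy⟩ ⟨i, not_le.1 hpos, hyi⟩)
  refine ⟨φ, Subtype.ext <| AddMonoidAlgebra.ext <| Finsupp.ext fun u ↦ ?_⟩
  rw [coe_constHom, coeff_constLaurent, hφ]
  exact funext fun y ↦ (hq u y).symm

/-- Restrictions do not change the Laurent polynomial, so Čech cochains become functions with values
in a single group and the Čech differential becomes `coboundary`. -/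
theorem coeffHom_dFun {L M : P.LineBundle}
    (f : ∀ s, P.homSections L.1 M.1 (P.affineInter σ s)) (s : Finset (Fin N)) :
    P.coeffHom σ he s L M (CechSystem.dFun (S := P.lineBundleSystem σ) L M f s) =
      CechSystem.coboundary (fun s ↦ P.coeffHom σ he s L M (f s)) s := by
  refine (congrArg (P.coeffHom σ he s L M)
    (CechSystem.dFun_apply (S := P.lineBundleSystem σ) f s)).trans ?_
  refine (map_sum (P.coeffHom σ he s L M) _ _).trans (Finset.sum_congr rfl fun j _ ↦ ?_)
  refine (map_zsmul (P.coeffHom σ he s L M) _ _).trans (congrArg _ ?_)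
  exact congrArg (P.coeffHom σ he s L M) (CechSystem.pull_of_subset (S := P.lineBundleSystem σ)
    (Finset.erase_subset j s) f)

theorem exists_isGLB_face (c : Finset (Fin N)) (hc : c.Nonempty) :
    ∃ v, IsGLB (σ '' c) (σ v) := by
  refine ⟨σ.symm (c.inf' hc σ), ?_⟩
  rw [σ.apply_symm_apply]
  constructor
  · rintro _ ⟨k, hk, rfl⟩
    exact Finset.inf'_le _ hk
  · intro τ hτ
    exact Finset.le_inf' _ _ fun k hk ↦ hτ ⟨k, hk, rfl⟩

theorem admissible_mono (L M : P.LineBundle) : Monotone (P.admissible σ he L M) :=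
  fun _ _ hst _ hp u hu i hi ↦ hp u hu i fun k hk ↦ hi k (hst hk)

/-- A facet that contains all the cells of `c` also contains their meet, because its own open cell
is a lower bound of them. Adjoining the meet therefore imposes no fewer conditions. -/
theorem admissible_insert_le (L M : P.LineBundle) (s c : Finset (Fin N)) (v : Fin N) (hc : c ⊆ s)
    (hv : IsGLB (σ '' c) (σ v)) : P.admissible σ he L M (insert v s) ≤ P.admissible σ he L M s := by
  intro p hp u hu i hi
  refine hp u hu i fun k hk ↦ ?_
  rcases Finset.mem_insert.1 hk with rfl | hk
  · have hle : P.facetCell i ≤ σ k := hv.2 (by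
      rintro _ ⟨j, hj, rfl⟩
      exact P.facetCell_le (hi j (hc hj)))
    exact hle (P.mem_facetCell.2 rfl)
  · exact hi k hk

theorem exists_forall_constHom_eq {L M : P.LineBundle}
    (g : ∀ s, P.gradedSections (P.height₀ he M - P.height₀ he L) (P.region σ W s)) (hg : g ∅ = 0) :
    ∃ f : ∀ s, P.homSections L.1 M.1 (P.affineInter σ s),
      f ∅ = 0 ∧ ∀ s, P.constHom σ he hW s L M (f s) = g s := by
  have h : ∀ s : Finset (Fin N), ∃ φ : P.homSections L.1 M.1 (P.affineInter σ s),
      P.constHom σ he hW s L M φ = g s ∧ (s = ∅ → φ = 0) := by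
    intro s
    rcases s.eq_empty_or_nonempty with rfl | hs
    · exact ⟨0, by rw [map_zero, hg], fun _ ↦ rfl⟩
    · obtain ⟨φ, hφ⟩ := P.exists_constHom_eq he hW hs (g s)
      exact ⟨φ, hφ, fun h ↦ absurd h hs.ne_empty⟩
  choose φ hφ hφ' using h
  exact ⟨φ, hφ' ∅ rfl, hφ⟩

/-- The kernel of the passage to constant functions is acyclic. -/
theorem exists_coboundary_coeffHom_eq {L M : P.LineBundle}
    (f : ∀ s, P.homSections L.1 M.1 (P.affineInter σ s)) (hf0 : f ∅ = 0)
    (hf : ∀ s, P.constHom σ he hW s L M (f s) = 0)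
    (hdf : CechSystem.coboundary (fun s ↦ P.coeffHom σ he s L M (f s)) = 0) :
    ∃ g : ∀ s, P.homSections L.1 M.1 (P.affineInter σ s), g ∅ = 0 ∧
      (∀ s, P.constHom σ he hW s L M (g s) = 0) ∧
      CechSystem.coboundary (fun s ↦ P.coeffHom σ he s L M (g s)) =
        fun s ↦ P.coeffHom σ he s L M (f s) := by
  have hA : ∀ s, P.coeffHom σ he s L M (f s) ∈ P.admissible σ he L M s := by
    intro s
    rcases s.eq_empty_or_nonempty with rfl | hs
    · rw [hf0, map_zero]
      exact AddSubgroup.zero_mem _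
    · exact (P.exists_coeffHom_eq_iff σ he hs).1 ⟨_, rfl⟩
  -- On a nonempty chain the region has a point, so a Laurent polynomial that is zero as a constant
  -- function is zero.
  have hcore : ∀ s, CechSystem.core σ s = ∅ → P.coeffHom σ he s L M (f s) = 0 := by
    intro s hs
    rcases s.eq_empty_or_nonempty with rfl | hne
    · rw [hf0, map_zero]
    · refine constLaurent_injective ((P.region_nonempty_iff hW hne).2 hs) ?_
      rw [map_zero]
      exact congrArg Subtype.val (hf s)
  obtain ⟨g, hgA, hg0, hg⟩ := CechSystem.exists_coboundary_eq σ.injective P.exists_isGLB_face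
    (P.admissible σ he L M) (P.admissible_mono he L M) (P.admissible_insert_le he L M)
    (fun s ↦ P.coeffHom σ he s L M (f s)) hA hcore hdf
  have h : ∀ s : Finset (Fin N), ∃ φ : P.homSections L.1 M.1 (P.affineInter σ s),
      P.coeffHom σ he s L M φ = g s ∧ (s = ∅ → φ = 0) := by
    intro s
    rcases s.eq_empty_or_nonempty with rfl | hs
    · refine ⟨0, ?_, fun _ ↦ rfl⟩
      rw [hg0 ∅ (Finset.subset_empty.1 (CechSystem.core_subset σ ∅)), map_zero]
    · obtain ⟨φ, hφ⟩ := (P.exists_coeffHom_eq_iff σ he hs).2 (hgA s)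
      exact ⟨φ, hφ, fun h ↦ absurd h hs.ne_empty⟩
  choose φ hφ hφ' using h
  refine ⟨φ, hφ' ∅ rfl, fun s ↦ ?_, ?_⟩
  · rcases s.eq_empty_or_nonempty with rfl | hs
    · rw [hφ' ∅ rfl, map_zero]
    · by_cases hne : (P.region σ W s).Nonempty
      · refine Subtype.ext ?_
        rw [coe_constHom, hφ, hg0 s ((P.region_nonempty_iff hW hs).1 hne), map_zero]
        rfl
      · exact P.eq_of_region_empty hne _ _
  · simp only [hφ]
    exact hg

theorem bijective_cohomologyMap_coeffMorphism (L M : P.LineBundle) :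
    Function.Bijective ((P.coeffMorphism σ he hW).toDGFunctor.cohomologyMap L M) := by
  refine DGFunctor.bijective_cohomologyMap _ (fun g ↦ ?_) fun f hf hdf ↦ ?_
  · obtain ⟨f, hf0, hf⟩ := P.exists_forall_constHom_eq he hW (L := L) (M := M) g.1 g.2
    exact ⟨⟨f, hf0⟩, Subtype.ext (funext hf)⟩
  · obtain ⟨g, hg0, hg, hgf⟩ := P.exists_coboundary_coeffHom_eq he hW (L := L) (M := M) f.1 f.2
      (fun s ↦ congrFun (congrArg Subtype.val hf) s) (by
        funext s
        refine (P.coeffHom_dFun he f.1 s).symm.trans ?_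
        exact (congrArg (P.coeffHom σ he s L M) (congrFun (congrArg Subtype.val hdf) s)).trans
          (map_zero _))
    refine ⟨⟨g, hg0⟩, Subtype.ext (funext hg), Subtype.ext (funext fun s ↦ ?_)⟩
    change CechSystem.dFun (S := P.lineBundleSystem σ) L M g s = f.1 s
    rcases s.eq_empty_or_nonempty with rfl | hs
    · exact (CechSystem.dFun_empty (S := P.lineBundleSystem σ) g).trans (Eq.symm f.2)
    · exact P.coeffHom_injective σ he hs ((P.coeffHom_dFun he g s).trans (congrFun hgf s))

end SmoothPolytope

/-! ### Line bundles as sheaves of fractional ideals -/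

namespace AlgebraicGeometry.Scheme

variable (X : Scheme.{0}) (T : X.Opens)

/-- A subsheaf of modules of the direct image of the functions on the open set `T`. -/
structure Subsheaf where
  sec : ∀ V : X.Opens, AddSubgroup Γ(X, V ⊓ T)
  smul_mem : ∀ {V : X.Opens} (a : Γ(X, V)) {f}, f ∈ sec V →
    X.resFun (inf_le_left : V ⊓ T ≤ V) a * f ∈ sec V
  res_mem : ∀ {V V' : X.Opens} (h : V' ≤ V) {f}, f ∈ sec V →
    X.resFun (inf_le_inf_right T h) f ∈ sec V'
  mem_of_locally : ∀ {ι : Type} {V : X.Opens} (U : ι → X.Opens) (hU : ∀ i, U i ≤ V)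
    (_ : V ≤ ⨆ i, U i) {f}, (∀ i, X.resFun (inf_le_inf_right T (hU i)) f ∈ sec (U i)) → f ∈ sec V

namespace Subsheaf

variable {X T} (S : Subsheaf X T)

/-- The underlying presheaf of abelian groups. -/
def presheaf : TopCat.Presheaf Ab X where
  obj V := AddCommGrpCat.of (S.sec V.unop)
  map {V V'} h := AddCommGrpCat.ofHom
    (((X.resFun (inf_le_inf_right T h.unop.le)).toAddMonoidHom.comp
      (S.sec V.unop).subtype).codRestrict (S.sec V'.unop) fun f ↦ S.res_mem h.unop.le f.2)
  map_id _ := AddCommGrpCat.hom_ext <| AddMonoidHom.ext fun f ↦ Subtype.ext (resFun_refl f.1)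
  map_comp _ _ := AddCommGrpCat.hom_ext <| AddMonoidHom.ext fun f ↦
    Subtype.ext (resFun_resFun _ _ f.1).symm

instance instModuleSec (V : X.Opens) : Module Γ(X, V) (S.sec V) where
  smul a f := ⟨X.resFun (inf_le_left : V ⊓ T ≤ V) a * f.1, S.smul_mem a f.2⟩
  one_smul f := Subtype.ext <| by
    change X.resFun _ 1 * f.1 = f.1
    rw [map_one, one_mul]
  mul_smul a b f := Subtype.ext <| by
    change X.resFun _ (a * b) * f.1 = X.resFun _ a * (X.resFun _ b * f.1)
    rw [map_mul, mul_assoc]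
  smul_zero a := Subtype.ext (mul_zero _)
  smul_add a f g := Subtype.ext (mul_add _ _ _)
  add_smul a b f := Subtype.ext <| by
    change X.resFun _ (a + b) * f.1 = X.resFun _ a * f.1 + X.resFun _ b * f.1
    rw [map_add, add_mul]
  zero_smul f := Subtype.ext <| by
    change X.resFun _ 0 * f.1 = 0
    rw [map_zero, zero_mul]

instance instModulePresheaf (V : (X.Opens)ᵒᵖ) :
    Module (X.ringCatSheaf.obj.obj V) (S.presheaf.obj V) :=
  inferInstanceAs (Module Γ(X, V.unop) (S.sec V.unop))

/-- Sections glue as functions on the parts inside `T`, and the membership condition is local. -/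
theorem isSheaf_presheaf : S.presheaf.IsSheaf := by
  refine (TopCat.Presheaf.isSheaf_iff_isSheafUniqueGluing _).2 ?_
  intro ι U sf hsf
  have hcov : (⨆ i, U i) ⊓ T ≤ ⨆ i, U i ⊓ T := by rw [iSup_inf_eq]
  obtain ⟨g, hg⟩ := exists_resFun_eq (fun i ↦ U i ⊓ T)
    (fun i ↦ inf_le_inf_right T (le_iSup U i)) hcov (fun i ↦ (sf i : S.sec (U i)).1) fun i j ↦ by
      have h : X.resFun _ (sf i : S.sec (U i)).1 = X.resFun _ (sf j : S.sec (U j)).1 :=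
        congrArg Subtype.val (hsf i j)
      have hle : U i ⊓ T ⊓ (U j ⊓ T) ≤ U i ⊓ U j ⊓ T := by
        rw [inf_inf_inf_comm, inf_idem]
      have h' := congrArg (X.resFun hle) h
      rw [resFun_resFun, resFun_resFun] at h'
      exact h'
  refine ⟨⟨g, S.mem_of_locally U (le_iSup U) le_rfl fun i ↦ ?_⟩, fun i ↦ Subtype.ext (hg i), ?_⟩
  · rw [hg]
    exact (sf i : S.sec (U i)).2
  · intro t ht
    refine Subtype.ext (eq_of_resFun_eq (fun i ↦ U i ⊓ T)
      (fun i ↦ inf_le_inf_right T (le_iSup U i)) hcov fun i ↦ ?_)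
    rw [hg]
    exact congrArg Subtype.val (ht i)

theorem resFun_smul {V V' : X.Opens} (h : V' ≤ V) (a : Γ(X, V)) (f : Γ(X, V ⊓ T)) :
    X.resFun (inf_le_inf_right T h) (X.resFun inf_le_left a * f) =
      X.resFun inf_le_left (X.resFun h a) * X.resFun (inf_le_inf_right T h) f := by
  rw [map_mul, resFun_resFun, resFun_resFun]

/-- The associated sheaf of modules. -/
def modules : X.Modules where
  val := PresheafOfModules.ofPresheaf S.presheaf fun V _ h a f ↦
    Subtype.ext (resFun_smul h.unop.le a (f : S.sec V.unop).1)
  isSheaf := S.isSheaf_presheaf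

/-- Sections as functions. -/
def toFun {V : X.Opens} (x : Γ(S.modules, V)) : Γ(X, V ⊓ T) := (x : S.sec V).1

/-- The section given by a function. -/
def ofFun {V : X.Opens} (f : Γ(X, V ⊓ T)) (hf : f ∈ S.sec V) : Γ(S.modules, V) :=
  (⟨f, hf⟩ : S.sec V)

theorem toFun_ofFun {V : X.Opens} (f : Γ(X, V ⊓ T)) (hf : f ∈ S.sec V) : S.toFun (S.ofFun f hf) = f := rfl

theorem toFun_mem {V : X.Opens} (x : Γ(S.modules, V)) : S.toFun x ∈ S.sec V := (x : S.sec V).2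

theorem toFun_injective {V : X.Opens} : Function.Injective (S.toFun (V := V)) :=
  fun _ _ h ↦ Subtype.ext h

theorem toFun_smul {V : X.Opens} (a : Γ(X, V)) (x : Γ(S.modules, V)) :
    S.toFun (a • x) = X.resFun inf_le_left a * S.toFun x := rfl

theorem toFun_resSec {V V' : X.Opens} (h : V' ≤ V) (x : Γ(S.modules, V)) :
    S.toFun (S.modules.resSec h x) = X.resFun (inf_le_inf_right T h) (S.toFun x) := rfl

end Subsheaf

theorem resFun_injective_of_inf_le {X : Scheme.{0}} [IsIntegral X] {T V V' : X.Opens}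
    (hT : genericPoint X ∈ T) (h : V' ≤ V) (h' : V ⊓ T ≤ V') : Function.Injective (X.resFun h) := by
  rcases isEmpty_or_nonempty V with hV | ⟨⟨z, hz⟩⟩
  · intro x y _
    refine eq_of_resFun_eq (ι := Empty) (fun i ↦ i.elim) (fun i ↦ i.elim) (fun z hz ↦ ?_)
      fun i ↦ i.elim
    exact hV.elim ⟨z, hz⟩
  · exact resFun_injective (h' ⟨genericPoint_mem hz, hT⟩) h

end AlgebraicGeometry.Scheme

/-! ### Line bundles with prescribed orders -/

namespace SmoothPolytope

variable {n : ℕ} (P : SmoothPolytope n)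

/-- The subsheaf of functions on the torus whose products with the monomials `χ^{m_σ}` extend to
the charts. -/
def monomialSubsheaf (m : P.Face → Fin n → ℤ) : Scheme.Subsheaf P.X P.torus where
  sec V :=
    { carrier := {f | ∀ σ, ∃ g : Γ(P.X, V ⊓ P.affineOpen σ),
        P.X.resFun (inf_le_inf_left V (P.torus_le σ)) g =
          P.X.resFun (inf_le_right : V ⊓ P.torus ≤ P.torus) (P.monomial (m σ)) * f}
      zero_mem' := fun σ ↦ ⟨0, by rw [map_zero, mul_zero]⟩
      add_mem' := fun hf hf' σ ↦ by
        obtain ⟨g, hg⟩ := hf σ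
        obtain ⟨g', hg'⟩ := hf' σ
        exact ⟨g + g', by rw [map_add, hg, hg', mul_add]⟩
      neg_mem' := fun hf σ ↦ by
        obtain ⟨g, hg⟩ := hf σ
        exact ⟨-g, by rw [map_neg, hg, mul_neg]⟩ }
  smul_mem {V} a f hf σ := by
    obtain ⟨g, hg⟩ := hf σ
    refine ⟨P.X.resFun inf_le_left a * g, ?_⟩
    rw [map_mul, hg, Scheme.resFun_resFun, mul_left_comm]
  res_mem {V V'} h f hf σ := by
    obtain ⟨g, hg⟩ := hf σ
    refine ⟨P.X.resFun (inf_le_inf_right _ h) g, ?_⟩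
    have := congrArg (P.X.resFun (inf_le_inf_right P.torus h)) hg
    rw [map_mul, Scheme.resFun_resFun, Scheme.resFun_resFun] at this
    rw [← this, Scheme.resFun_resFun]
  mem_of_locally {ι V} U hU hV f hf σ := by
    choose g hg using fun i ↦ hf i σ
    have hcov : V ⊓ P.affineOpen σ ≤ ⨆ i, U i ⊓ P.affineOpen σ := by
      rw [← iSup_inf_eq]
      exact inf_le_inf_right _ hV
    have hcov' : V ⊓ P.torus ≤ ⨆ i, U i ⊓ P.torus := by
      rw [← iSup_inf_eq]
      exact inf_le_inf_right _ hV
    have hg' : ∀ i (O : P.X.Opens) (hO : O ≤ U i ⊓ P.affineOpen σ) (hO' : O ≤ V ⊓ P.torus),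
        P.X.resFun hO (g i) = P.X.resFun (hO'.trans inf_le_right) (P.monomial (m σ)) *
          P.X.resFun hO' f := by
      intro i O hO hO'
      have := congrArg (P.X.resFun
        (le_inf (hO.trans inf_le_left) (hO'.trans inf_le_right) : O ≤ U i ⊓ P.torus)) (hg i)
      rwa [map_mul, Scheme.resFun_resFun, Scheme.resFun_resFun, Scheme.resFun_resFun] at this
    obtain ⟨k, hk⟩ := Scheme.exists_resFun_eq (fun i ↦ U i ⊓ P.affineOpen σ)
      (fun i ↦ inf_le_inf_right _ (hU i)) hcov g fun i j ↦ by
        refine Scheme.resFun_injective_of_inf_le P.genericPoint_mem_torus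
          (inf_le_left : _ ⊓ P.torus ≤ _) le_rfl ?_
        have hle : (U i ⊓ P.affineOpen σ) ⊓ (U j ⊓ P.affineOpen σ) ⊓ P.torus ≤ V ⊓ P.torus :=
          inf_le_inf_right _ (inf_le_left.trans (inf_le_left.trans (hU i)))
        rw [Scheme.resFun_resFun, Scheme.resFun_resFun, hg' i _ _ hle, hg' j _ _ hle]
    refine ⟨k, Scheme.eq_of_resFun_eq (fun i ↦ U i ⊓ P.torus)
      (fun i ↦ inf_le_inf_right _ (hU i)) hcov' fun i ↦ ?_⟩
    have := congrArg (P.X.resFun (inf_le_inf_left (U i) (P.torus_le σ))) (hk i)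
    rw [Scheme.resFun_resFun, hg' i _ _ (inf_le_inf_right _ (hU i))] at this
    rw [map_mul, Scheme.resFun_resFun, Scheme.resFun_resFun]
    exact this

/-- Every function on the facets is given by the orders of a frame of a line bundle. -/
theorem exists_lineBundle (H : P.Facet → ℤ) :
    ∃ (L : P.X.Modules) (hL : L.IsInvertible) (e : Γ(L, P.torus)) (he : L.IsGenerator e),
      ∀ i, P.poleOrder hL he i = H i := by
  choose m hm using fun σ ↦ P.exists_pair_eq σ H
  let S := P.monomialSubsheaf m
  -- The local frame is $\chi^{-m_\tau}$. Its compatibility with another chart holds because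
  -- $m_\sigma-m_\tau$ pairs to zero with the facets through both cells, so that
  -- $\chi^{m_\sigma-m_\tau}$ is regular on the intersection.
  have hframe : ∀ (τ : P.Face), P.X.resFun (inf_le_right : P.affineOpen τ ⊓ P.torus ≤ P.torus)
      (P.monomial (- m τ)) ∈ S.sec (P.affineOpen τ) := by
    intro τ σ
    have hmem : ∀ i ∈ (τ ⊓ σ).1, P.pair (m σ - m τ) i = 0 := fun i hi ↦ by
      rw [pair_sub, hm σ i (P.mem_inf.1 hi).2, hm τ i (P.mem_inf.1 hi).1, sub_self]
    refine ⟨P.X.resFun (P.affineOpen_inf τ σ).le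
      (P.chartMonomial (τ ⊓ σ) ⟨m σ - m τ, fun i hi ↦ (hmem i hi).le⟩), ?_⟩
    rw [← map_mul, ← monomial_add, ← sub_eq_add_neg, Scheme.resFun_resFun,
      ← P.resFun_chartMonomial (τ ⊓ σ) ⟨m σ - m τ, fun i hi ↦ (hmem i hi).le⟩,
      Scheme.resFun_resFun]
  let f : ∀ τ, Γ(S.modules, P.affineOpen τ) := fun τ ↦ S.ofFun _ (hframe τ)
  have hf : ∀ τ, S.modules.IsGenerator (f τ) := by
    intro τ V hV
    have hval : ∀ a : Γ(P.X, V), S.toFun (a • S.modules.resSec hV (f τ)) =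
        P.X.resFun (inf_le_left : V ⊓ P.torus ≤ V) a *
          P.X.resFun (inf_le_right : V ⊓ P.torus ≤ P.torus) (P.monomial (- m τ)) := by
      intro a
      rw [S.toFun_smul, S.toFun_resSec, S.toFun_ofFun, Scheme.resFun_resFun]
    constructor
    · intro a b hab
      refine Scheme.resFun_injective_of_inf_le P.genericPoint_mem_torus
        (inf_le_left : V ⊓ P.torus ≤ V) le_rfl ?_
      have := congrArg S.toFun hab
      simp only [hval] at this
      exact ((P.isUnit_monomial _).map _).mul_right_cancel this
    · intro x
      -- The defining condition at `τ` itself says that $\chi^{m_\tau}$ times the section extends,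
      -- and the extension is the coefficient.
      obtain ⟨g, hg⟩ := S.toFun_mem x τ
      refine ⟨P.X.resFun (le_inf le_rfl hV) g, S.toFun_injective ?_⟩
      rw [hval, Scheme.resFun_resFun, hg, mul_right_comm, ← map_mul, ← monomial_add,
        add_neg_cancel, monomial_zero, map_one, one_mul]
  have hL : S.modules.IsInvertible := fun x ↦ by
    obtain ⟨σ, hσ⟩ := P.exists_mem_affineOpen x
    exact ⟨_, f σ, hσ, hf σ⟩
  -- This is the section $1$, whichever cell is used to write it as $\chi^{m_\tau}f_\tau$.
  let e : Γ(S.modules, P.torus) := P.monomial (m P.interiorCell) •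
    S.modules.resSec (P.torus_le P.interiorCell) (f P.interiorCell)
  have he : S.modules.IsGenerator e :=
    ((hf P.interiorCell).resSec _).unit_smul (P.isUnit_monomial _)
  have hval : ∀ τ, e = P.monomial (m τ) • S.modules.resSec (P.torus_le τ) (f τ) := by
    have hone : ∀ τ, S.toFun (P.monomial (m τ) • S.modules.resSec (P.torus_le τ) (f τ)) = 1 := by
      intro τ
      rw [S.toFun_smul, S.toFun_resSec, S.toFun_ofFun, Scheme.resFun_resFun, ← map_mul,
        ← monomial_add, add_neg_cancel, monomial_zero, map_one]
    intro τ
    exact S.toFun_injective ((hone P.interiorCell).trans (hone τ).symm)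
  refine ⟨S.modules, hL, e, he, fun i ↦ ?_⟩
  rw [← P.pair_eq_poleOrder hL he (hf (P.facetCell i)) (hval _) (P.mem_facetCell.2 rfl)]
  exact hm _ i (P.mem_facetCell.2 rfl)

end SmoothPolytope

/-! ### The equivalence -/

namespace SmoothPolytope

variable {n : ℕ} (P : SmoothPolytope n)

/-- Two frames over the torus differ by a scalar times a monomial $\chi^u$; the scalar does not
affect orders. -/
theorem poleOrder_smul {L : P.X.Modules} (hL : L.IsInvertible) {e e' : Γ(L, P.torus)}
    (he : L.IsGenerator e) (he' : L.IsGenerator e') :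
    ∃ u, ∀ i, P.poleOrder hL he' i = P.poleOrder hL he i + P.pair u i := by
  obtain ⟨g, hg, rfl⟩ := he.exists_unit_smul_eq he'
  obtain ⟨u, c, hc, rfl⟩ := P.exists_monomial_of_isUnit hg
  refine ⟨u, fun i ↦ ?_⟩
  obtain ⟨m, f, hf, h⟩ := P.exists_frame hL he (P.facetCell i)
  have h' : (P.scalar P.torus c * P.monomial u) • e = P.monomial (m + u) •
      L.resSec (P.torus_le (P.facetCell i)) (P.scalar (P.affineOpen (P.facetCell i)) c • f) := by
    rw [Scheme.Modules.resSec_smul, map_scalar, h, smul_smul, smul_smul, monomial_add]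
    congr 1
    ring
  rw [← P.pair_eq_poleOrder hL he hf h (P.mem_facetCell.2 rfl),
    ← P.pair_eq_poleOrder hL he' (hf.unit_smul (hc.isUnit.map _)) h' (P.mem_facetCell.2 rfl),
    pair_add]

/-- In the summand of $u$ the function $H+u$ is zero, so there is no positive part on which the
constant $1$ would have to vanish. -/
theorem single_mem_of_eq_neg_pair {H : P.Facet → ℤ} (R : Set (Fin n → ℝ)) {u : Fin n → ℤ}
    (h : H = - P.pair u) : AddMonoidAlgebra.single u 1 ∈ P.gradedSections H R := by
  refine P.single_mem_gradedSections ⟨IsLocallyConstant.const 1, ?_⟩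
  rintro x ⟨i, hi, -⟩
  rw [h, neg_add_cancel] at hi
  exact absurd hi (lt_irrefl _)

variable {N : ℕ} (σ : Fin N ≃ P.Face)

/-- Functions that differ by a lattice vector are isomorphic. -/
theorem hIso_of_eq_add_pair (W : P.Face → Set (Fin n → ℝ)) {H H' : P.Facet → ℤ} {u : Fin n → ℤ}
    (h : H = H' + P.pair u) : (P.cechQ σ W).HIso H H' := by
  have h1 : H' - H = - P.pair u := by
    rw [h]
    abel
  have h2 : H - H' = - P.pair (-u) := by
    funext i
    rw [h, Pi.neg_apply, pair_neg]
    simp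
  have hres : ∀ {R R' : Set (Fin n → ℝ)} (hR : R' ⊆ R) (v : Fin n → ℤ),
      AddMonoidAlgebra.mapAlgHom (Fin n → ℤ) (restrictFun hR) (AddMonoidAlgebra.single v 1) =
        AddMonoidAlgebra.single v 1 := fun hR v ↦ by
    rw [AddMonoidAlgebra.mapAlgHom_single, map_one]
  have hmul : ∀ {R : Set (Fin n → ℝ)} {v w : Fin n → ℤ} (_ : v + w = 0),
      (AddMonoidAlgebra.single v 1 * AddMonoidAlgebra.single w 1 :
        AddMonoidAlgebra (R → ℂ) (Fin n → ℤ)) = 1 := fun {R v w} hvw ↦ by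
    rw [AddMonoidAlgebra.single_mul_single, hvw, one_mul]
    rfl
  exact CechSystem.hIso_of_inverse (S := P.functionSystem σ W) (X := H) (Y := H')
    (fun s ↦ ⟨AddMonoidAlgebra.single u 1, P.single_mem_of_eq_neg_pair _ h1⟩)
    (fun s ↦ ⟨AddMonoidAlgebra.single (-u) 1, P.single_mem_of_eq_neg_pair _ h2⟩)
    (fun hst ↦ Subtype.ext (hres (P.region_anti σ W hst) u))
    (fun hst ↦ Subtype.ext (hres (P.region_anti σ W hst) (-u)))
    (fun s ↦ Subtype.ext (hmul (add_neg_cancel u))) (fun s ↦ Subtype.ext (hmul (neg_add_cancel u)))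

variable {σ} in
theorem isQuasiEquivalence_coeffMorphism {e : ∀ L : P.LineBundle, Γ(L.1, P.torus)}
    (he : ∀ L : P.LineBundle, L.1.IsGenerator (e L)) {W : P.Face → Set (Fin n → ℝ)}
    (hW : P.IsCellularCover W) : (P.coeffMorphism σ he hW).toDGFunctor.IsQuasiEquivalence where
  bijective L M := P.bijective_cohomologyMap_coeffMorphism he hW L M
  essSurj Z := by
    obtain ⟨L, hL, e₀, he₀, h₀⟩ := P.exists_lineBundle Z
    -- The given frame of the constructed bundle need not be the one with invariant `Z`, but its
    -- invariant differs from `Z` by a lattice vector.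
    obtain ⟨u, hu⟩ := P.poleOrder_smul hL he₀ (he ⟨L, hL⟩)
    refine ⟨⟨L, hL⟩, P.hIso_of_eq_add_pair σ W (u := u) (funext fun i ↦ ?_)⟩
    refine (hu i).trans ?_
    rw [h₀]
    rfl

end SmoothPolytope

end

/-! ### The proposition -/

theorem mainTheorem6 {n : ℕ} (P : SmoothPolytope n) {N : ℕ} (σ : Fin N ≃ P.Face) :
    -- line bundles have trivializations over the torus, and covers of `Q` as used here exist
    (∀ L : P.LineBundle, ∃ e : Γ(L.1, P.torus), L.1.IsGenerator e) ∧
    (∃ W : P.Face → Set (Fin n → ℝ), P.IsCellularCover W) ∧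
    ∀ (e : ∀ L : P.LineBundle, Γ(L.1, P.torus)) (_ : ∀ L : P.LineBundle, L.1.IsGenerator (e L))
      (W : P.Face → Set (Fin n → ℝ)) (_ : P.IsCellularCover W),
      ∃ (H : P.LineBundle → (Fin n → ℤ) → P.Facet → ℤ)
        (F : DGFunctor (P.cechX σ) (P.cechQ σ W)),
        -- `H(L, u)` is the negative of the order of the monomial section `χ^u e_L`
        (∀ (L : P.LineBundle) (u : Fin n → ℤ) (i : P.Facet) (m : ℤ),
          P.HasOrderAlong L.1 (P.monomial u • e L) i m ↔ H L u i = -m) ∧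
        (∀ (L : P.LineBundle) (u : Fin n → ℤ) (i : P.Facet), H L u i = H L 0 i + P.pair u i) ∧
        -- the Čech groups split into summands labelled by the lattice vectors `u`
        (∀ (L M : P.LineBundle) (s : Finset (Fin N)), s.Nonempty →
          (∀ φ : P.homSections L.1 M.1 (P.affineInter σ s),
            ∃! p : AddMonoidAlgebra ℂ (Fin n → ℤ), P.onTorus σ φ (e L) = P.laurent p • e M) ∧
          ∀ p : AddMonoidAlgebra ℂ (Fin n → ℤ),
            (∃! φ : P.homSections L.1 M.1 (P.affineInter σ s),
              P.onTorus σ φ (e L) = P.laurent p • e M) ↔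
            ∀ u, p.coeff u ≠ 0 → ∀ i, (∀ k ∈ s, i ∈ (σ k).1) → H M u i - H L 0 i ≤ 0) ∧
        -- the functor on objects
        (∀ L : P.LineBundle, F.obj L = H L 0) ∧
        -- the functor on morphisms: the coefficients of the monomials, restricted from `U_s` to `W_s`
        (∀ (L M : P.LineBundle) (φ : (P.cechX σ).Hom L M) (s : Finset (Fin N))
          (x : P.region σ W s),
          P.onTorus σ (SmoothPolytope.cechX.component φ s) (e L) =
            P.laurent (SmoothPolytope.cechQ.value (F.map L M φ) s x) • e M) ∧
        F.IsQuasiEquivalence := by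
  refine ⟨fun L ↦ P.exists_isGenerator L.2 P.interiorCell, ⟨_, P.isCellularCover_dualCover⟩,
    fun e he W hW ↦ ⟨fun L u i ↦ P.height₀ he L i + P.pair u i,
      (P.coeffMorphism σ he hW).toDGFunctor, fun L u i m ↦ ?_, fun L u i ↦ ?_,
      fun L M s hs ↦ ⟨fun φ ↦ ?_, fun p ↦ ?_⟩, fun L ↦ ?_, fun L M φ s x ↦ ?_,
      P.isQuasiEquivalence_coeffMorphism he hW⟩⟩
  · exact P.hasOrderAlong_monomial_smul_iff L.2 (he L) u i m
  · simp only [P.pair_zero, add_zero]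
  · exact ⟨_, P.onTorus_eq σ he φ, fun q hq ↦ ((P.coeffHom_eq_iff σ he).2 hq).symm⟩
  · have hiff : (∀ u, p.coeff u ≠ 0 → ∀ i, (∀ k ∈ s, i ∈ (σ k).1) →
        P.height₀ he M i + P.pair u i - (P.height₀ he L i + P.pair 0 i) ≤ 0) ↔
        p ∈ P.admissible σ he L M s := by
      refine forall_congr' fun u ↦ imp_congr_right fun _ ↦ forall_congr' fun i ↦
        imp_congr_right fun _ ↦ ?_
      rw [P.pair_zero, add_zero, add_sub_right_comm]
    rw [hiff, ← P.exists_coeffHom_eq_iff σ he hs]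
    simp only [← P.coeffHom_eq_iff σ he]
    exact ⟨fun h ↦ h.exists, fun ⟨φ, hφ⟩ ↦
      ⟨φ, hφ, fun ψ hψ ↦ P.coeffHom_injective σ he hs (hψ.trans hφ.symm)⟩⟩
  · funext i
    exact ((congrArg (P.height₀ he L i + ·) (P.pair_zero i)).trans (add_zero _)).symm
  · refine (P.onTorus_eq σ he (SmoothPolytope.cechX.component φ s)).trans ?_
    refine congrArg (fun p ↦ P.laurent p • e M) (AddMonoidAlgebra.ext (Finsupp.ext fun u ↦ ?_))
    refine Eq.symm ((AddMonoidAlgebra.coeff_mapAlgHom _ _ u).trans ?_)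
    exact congrFun (SmoothPolytope.coeff_constLaurent (P.region σ W s)
      (P.coeffHom σ he s L M (SmoothPolytope.cechX.component φ s)) u) x
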